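/- Let $\mathbb{T}$ be a dependent type theory: a family of derivable judgements $(\Gamma)\ A \in \mathsf{Type}$, $(\Gamma)\ a \in A$, $(\Gamma)\ A = B \in \mathsf{Type}$, $(\Gamma)\ a = b \in A$ that is closed under (at least) the usual structural rules (axiom, weakening, substitution — also of definitionally equal elements —, definitional equality is an equivalence relation, conversion; judgements are made in well-formed contexts, and presuppose that the types and elements they mention are well-formed) and the following rules for identity types, relative to an arbitrary context and stable under substitution: * formation: if $A \in \mathsf{Type}$ and $a, b \in A$, then $\mathrm{Id}_A(a,b) \in \mathsf{Type}$; * introduction: if $a \in A$, then $\mathrm{r}(a) \in \mathrm{Id}_A(a,a)$; * elimination: for a dependent context $\Theta(x,y,u)$ relative to $(x \in A, y \in A, u \in \mathrm{Id}_A(x,y))$ and a type $C(x,y,u)$ relative to $(x \in A, y \in A, u \in \mathrm{Id}_A(x,y), \Theta(x,y,u))$, if $p \in \mathrm{Id}_A(a,b)$ and $(x \in A, \Theta(x,x,\mathrm{r}(x)))\ d(x) \in C(x,x,\mathrm{r}(x))$, then $(\Theta(a,b,p))\ \mathrm{J}(a,b,p,d) \in C(a,b,p)$; * computation: moreover $(\Theta(a,a,\mathrm{r}(a)))\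 \mathrm{J}(a,a,\mathrm{r}(a),d) = d(a) \in C(a,a,\mathrm{r}(a))$. For a context $\Psi$ and $a,b \in \Psi$, the identity context $\mathrm{Id}_\Psi(a,b)$ is defined by induction on the length of $\Psi$: it is empty if $\Psi$ is, and for $\Psi' = (y \in \Psi, y' \in A(y))$ it is $$\mathrm{Id}_{\Psi'}((a,a'),(b,b')) = \big(u \in \mathrm{Id}_\Psi(a,b),\ v \in \mathrm{Id}_{A(b)}(u_!(a'),b')\big),$$ where $u_!(a') \in A(b)$ is the transport of $a' \in A(a)$ along $u$, given by the eliminator of $\mathrm{Id}_\Psi$ (which is constructed in the same induction), with $(1_a)_!(a') = a'$; here $1_a \in \mathrm{Id}_\Psi(a,a)$ is the element with components the reflexivity elements $\mathrm{r}(a_i)$. Let $\mathcal{C}(\mathbb{T})$ be the classifying category of $\mathbb{T}$: its objects are the contexts up to renaming of variables and componentwise definitional equality, its maps are the context morphisms up to pointwise definitional equality, and composition is substitution. Let $\mathcal{D}$ be the class of display maps $(\Gamma, x \in A) \to \Gamma$, let $\mathcal{A}$ be the class of maps with the left lifting property with respect to every map in $\mathcal{D}$, and let $\mathcal{B}$ be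 the class of maps with the right lifting property with respect to every map in $\mathcal{A}$. Let $f : \Phi \to \Psi$ be a context morphism. Then: (i) $f \in \mathcal{A}$ if and only if $f$ is a type-theoretic injective equivalence, that is, there are derivable judgements $(y \in \Psi)\ s(y) \in \Phi$ and $(y \in \Psi)\ \varepsilon_y \in \mathrm{Id}_\Psi(f(s(y)), y)$ such that $(x \in \Phi)\ x = s(f(x)) \in \Phi$ and $(x \in \Phi)\ \varepsilon_{f(x)} = 1_{f(x)} \in \mathrm{Id}_\Psi(f(x),f(x))$ are derivable. (ii) $f \in \mathcal{B}$ if and only if $f$ is a type-theoretic normal isofibration, that is, there is a derivable judgement $(x \in \Phi, y \in \Psi, u \in \mathrm{Id}_\Psi(f(x),y))\ j(x,y,u) \in \Phi$ such that $(x \in \Phi, y \in \Psi, u \in \mathrm{Id}_\Psi(f(x),y))\ f(j(x,y,u)) = y \in \Psi$ and $(x \in \Phi)\ j(x,f(x),1_{f(x)}) = x \in \Phi$ are derivable. -/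

import Mathlib

open CategoryTheory

universe u

namespace DTT

/-! ## Raw expressions -/

/-- The symbols of a theory other than those for identity types: each symbol `o` has `arity o`
arguments, and binds `binds o i` variables in its `i`-th argument. -/
structure Signature where
  Op : Type u
  arity : Op → ℕ
  binds : (o : Op) → Fin (arity o) → ℕ

/-- Raw expressions (for types as well as for elements) with `n` free variables `0, …, n - 1`, where
the variable `i` is the `i`-th one that the context declares. A binder adds its variables at the end.

* `Id A a b` is `Id_A(a, b)`, and `refl A a` is `r(a) ∈ Id_A(a, a)`;
* `J A Θ C d a b p z` is the eliminator `J(a, b, p, d)` taken at `z ∈ Θ(a, b, p)`, with all the data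
  that it depends on written out: `Θ` is a telescope of length `m` over `x, y, u`; `C` has the bound
  variables `x, y, u` and those of `Θ`; `d` has the bound variables `x` and those of `Θ`. -/
inductive Expr (S : Signature.{u}) : ℕ → Type u
  | var {n : ℕ} (i : Fin n) : Expr S n
  | op {n : ℕ} (o : S.Op) (args : (i : Fin (S.arity o)) → Expr S (n + S.binds o i)) : Expr S n
  | Id {n : ℕ} (A a b : Expr S n) : Expr S n
  | refl {n : ℕ} (A a : Expr S n) : Expr S n
  | J {n m : ℕ} (A : Expr S n) (Θ : (i : Fin m) → Expr S (n + 3 + i)) (C : Expr S (n + 3 + m))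
      (d : Expr S (n + 1 + m)) (a b p : Expr S n) (z : Fin m → Expr S n) : Expr S n

variable {S : Signature.{u}}

/-- Extend a renaming by `k` bound variables. -/
def liftRen {n n' : ℕ} (ρ : Fin n → Fin n') (k : ℕ) : Fin (n + k) → Fin (n' + k) :=
  Fin.append (fun i => Fin.castAdd k (ρ i)) (fun j => Fin.natAdd n' j)

namespace Expr

/-- Renaming of variables. -/
def rename {n : ℕ} (e : Expr S n) {n' : ℕ} (ρ : Fin n → Fin n') : Expr S n' :=
  match e with
  | var i => var (ρ i)
  | op o args => op o (fun i => (args i).rename (liftRen ρ _))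
  | Id A a b => Id (A.rename ρ) (a.rename ρ) (b.rename ρ)
  | refl A a => refl (A.rename ρ) (a.rename ρ)
  | J A Θ C d a b p z =>
      J (A.rename ρ) (fun i => (Θ i).rename (liftRen (liftRen ρ 3) i))
        (C.rename (liftRen (liftRen ρ 3) _)) (d.rename (liftRen (liftRen ρ 1) _))
        (a.rename ρ) (b.rename ρ) (p.rename ρ) (fun i => (z i).rename ρ)

end Expr

/-- Extend a substitution by `k` bound variables. -/
def liftSub {n n' : ℕ} (σ : Fin n → Expr S n') (k : ℕ) : Fin (n + k) → Expr S (n' + k) :=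
  Fin.append (fun i => (σ i).rename (Fin.castAdd k)) (fun j => .var (Fin.natAdd n' j))

namespace Expr

/-- Simultaneous capture-avoiding substitution. -/
def subst {n : ℕ} (e : Expr S n) {n' : ℕ} (σ : Fin n → Expr S n') : Expr S n' :=
  match e with
  | var i => σ i
  | op o args => op o (fun i => (args i).subst (liftSub σ _))
  | Id A a b => Id (A.subst σ) (a.subst σ) (b.subst σ)
  | refl A a => refl (A.subst σ) (a.subst σ)
  | J A Θ C d a b p z =>
      J (A.subst σ) (fun i => (Θ i).subst (liftSub (liftSub σ 3) i))
        (C.subst (liftSub (liftSub σ 3) _)) (d.subst (liftSub (liftSub σ 1) _))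
        (a.subst σ) (b.subst σ) (p.subst σ) (fun i => (z i).subst σ)

end Expr

theorem liftRen_liftRen {n n' n'' : ℕ} (ρ : Fin n → Fin n') (ρ' : Fin n' → Fin n'') (k : ℕ) :
    (fun i => liftRen ρ' k (liftRen ρ k i)) = liftRen (fun i => ρ' (ρ i)) k := by
  funext i
  refine Fin.addCases (fun i => ?_) (fun i => ?_) i <;> simp [liftRen]

theorem liftSub_liftRen {n n' n'' : ℕ} (ρ : Fin n → Fin n') (σ : Fin n' → Expr S n'') (k : ℕ) :
    (fun i => liftSub σ k (liftRen ρ k i)) = liftSub (fun i => σ (ρ i)) k := by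
  funext i
  refine Fin.addCases (fun i => ?_) (fun i => ?_) i <;> simp [liftRen, liftSub]

theorem liftSub_var {n : ℕ} (k : ℕ) :
    liftSub (fun i : Fin n => (Expr.var i : Expr S n)) k = fun i => Expr.var i := by
  funext i
  refine Fin.addCases (fun i => ?_) (fun i => ?_) i <;> simp [liftSub, Expr.rename]

namespace Expr

theorem rename_rename {n : ℕ} (e : Expr S n) : ∀ {n' n'' : ℕ} (ρ : Fin n → Fin n')
    (ρ' : Fin n' → Fin n''), (e.rename ρ).rename ρ' = e.rename (fun i => ρ' (ρ i)) := by
  induction e with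
  | var i => intros; rfl
  | op o args ih => intros; simp [rename, ih, liftRen_liftRen]
  | Id A a b hA ha hb => intros; simp [rename, hA, ha, hb]
  | refl A a hA ha => intros; simp [rename, hA, ha]
  | J A Θ C d a b p z hA hΘ hC hd ha hb hp hz =>
    intros; simp [rename, hA, hΘ, hC, hd, ha, hb, hp, hz, liftRen_liftRen]

theorem subst_rename {n : ℕ} (e : Expr S n) : ∀ {n' n'' : ℕ} (ρ : Fin n → Fin n')
    (σ : Fin n' → Expr S n''), (e.rename ρ).subst σ = e.subst (fun i => σ (ρ i)) := by
  induction e with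
  | var i => intros; rfl
  | op o args ih => intros; simp [rename, subst, ih, liftSub_liftRen]
  | Id A a b hA ha hb => intros; simp [rename, subst, hA, ha, hb]
  | refl A a hA ha => intros; simp [rename, subst, hA, ha]
  | J A Θ C d a b p z hA hΘ hC hd ha hb hp hz =>
    intros; simp [rename, subst, hA, hΘ, hC, hd, ha, hb, hp, hz, liftSub_liftRen]

end Expr

theorem liftRen_liftSub {n n' n'' : ℕ} (σ : Fin n → Expr S n') (ρ : Fin n' → Fin n'') (k : ℕ) :
    (fun i => (liftSub σ k i).rename (liftRen ρ k)) = liftSub (fun i => (σ i).rename ρ) k := by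
  funext i
  refine Fin.addCases (fun i => ?_) (fun i => ?_) i <;>
    simp [liftRen, liftSub, Expr.rename_rename, Expr.rename]

namespace Expr

theorem rename_subst {n : ℕ} (e : Expr S n) : ∀ {n' n'' : ℕ} (σ : Fin n → Expr S n')
    (ρ : Fin n' → Fin n''), (e.subst σ).rename ρ = e.subst (fun i => (σ i).rename ρ) := by
  induction e with
  | var i => intros; rfl
  | op o args ih => intros; simp [rename, subst, ih, liftRen_liftSub]
  | Id A a b hA ha hb => intros; simp [rename, subst, hA, ha, hb]
  | refl A a hA ha => intros; simp [rename, subst, hA, ha]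
  | J A Θ C d a b p z hA hΘ hC hd ha hb hp hz =>
    intros; simp [rename, subst, hA, hΘ, hC, hd, ha, hb, hp, hz, liftRen_liftSub]

end Expr

theorem liftSub_liftSub {n n' n'' : ℕ} (σ : Fin n → Expr S n') (τ : Fin n' → Expr S n'') (k : ℕ) :
    (fun i => (liftSub σ k i).subst (liftSub τ k)) = liftSub (fun i => (σ i).subst τ) k := by
  funext i
  refine Fin.addCases (fun i => ?_) (fun i => ?_) i <;>
    simp [liftSub, Expr.rename_subst, Expr.subst_rename, Expr.subst]

namespace Expr

theorem subst_subst {n : ℕ} (e : Expr S n) : ∀ {n' n'' : ℕ} (σ : Fin n → Expr S n')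
    (τ : Fin n' → Expr S n''), (e.subst σ).subst τ = e.subst (fun i => (σ i).subst τ) := by
  induction e with
  | var i => intros; rfl
  | op o args ih => intros; simp [subst, ih, liftSub_liftSub]
  | Id A a b hA ha hb => intros; simp [subst, hA, ha, hb]
  | refl A a hA ha => intros; simp [subst, hA, ha]
  | J A Θ C d a b p z hA hΘ hC hd ha hb hp hz =>
    intros; simp [subst, hA, hΘ, hC, hd, ha, hb, hp, hz, liftSub_liftSub]

theorem subst_var {n : ℕ} (e : Expr S n) : e.subst (fun i => var i) = e := by
  induction e with
  | var i => rfl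
  | op o args ih => simp [subst, ih, liftSub_var]
  | Id A a b hA ha hb => simp [subst, hA, ha, hb]
  | refl A a hA ha => simp [subst, hA, ha]
  | J A Θ C d a b p z hA hΘ hC hd ha hb hp hz =>
    simp [subst, hA, hΘ, hC, hd, ha, hb, hp, hz, liftSub_var]

end Expr

/-! ## Raw contexts, dependent contexts and judgements -/

/-- Raw contexts `(x₀ ∈ A₀, …, xₙ₋₁ ∈ Aₙ₋₁(x₀, …, xₙ₋₂))`. -/
abbrev Ctx (S : Signature.{u}) (n : ℕ) : Type u := (i : Fin n) → Expr S i

/-- Raw dependent contexts of length `m` relative to a context of length `n`. -/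
abbrev Tel (S : Signature.{u}) (n m : ℕ) : Type u := (i : Fin m) → Expr S (n + i)

namespace Ctx

/-- The first `i` declarations of a context. -/
def take {n : ℕ} (Γ : Ctx S n) (i : Fin n) : Ctx S i :=
  fun j => Γ ⟨j, j.2.trans i.2⟩

/-- `(Γ, x ∈ A)`. -/
def snoc {n : ℕ} (Γ : Ctx S n) (A : Expr S n) : Ctx S (n + 1) :=
  Fin.snoc (α := fun i : Fin (n + 1) => Expr S i) Γ A

/-- `(Γ, Θ)`. -/
def append {n m : ℕ} (Γ : Ctx S n) (Θ : Tel S n m) : Ctx S (n + m) :=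
  Fin.addCases (motive := fun i : Fin (n + m) => Expr S i) Γ Θ

/-- `(x ∈ Γ)` regarded as a dependent context relative to any context of length `k`. -/
def toTel {n : ℕ} (Γ : Ctx S n) (k : ℕ) : Tel S k n :=
  fun i => (Γ i).rename (fun j => Fin.natAdd k j)

/-- `(Γ, x ∈ A, y ∈ A, u ∈ Id_A(x, y))`. -/
def idExt {n : ℕ} (Γ : Ctx S n) (A : Expr S n) : Ctx S (n + 3) :=
  ((Γ.snoc A).snoc (A.rename (Fin.castAdd 1))).snoc
    (.Id (A.rename (Fin.castAdd 2)) (.var (Fin.natAdd n (0 : Fin 2)))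
      (.var (Fin.natAdd n (1 : Fin 2))))

end Ctx

/-- The initial segment of length `i` of a tuple. -/
def initSeg {α : Type*} {n : ℕ} (σ : Fin n → α) (i : Fin n) : Fin i → α :=
  fun j => σ ⟨j, j.2.trans i.2⟩

/-- The four forms of judgement in `n` variables: `A ∈ Type`, `a ∈ A`, `A = B ∈ Type`
and `a = b ∈ A`. -/
inductive Judgement (S : Signature.{u}) (n : ℕ) : Type u
  | isType (A : Expr S n)
  | isElem (a A : Expr S n)
  | eqType (A B : Expr S n)
  | eqElem (a b A : Expr S n)

namespace Judgement

def subst {n n' : ℕ} (σ : Fin n → Expr S n') : Judgement S n → Judgement S n'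
  | isType A => isType (A.subst σ)
  | isElem a A => isElem (a.subst σ) (A.subst σ)
  | eqType A B => eqType (A.subst σ) (B.subst σ)
  | eqElem a b A => eqElem (a.subst σ) (b.subst σ) (A.subst σ)

theorem subst_var {n : ℕ} (j : Judgement S n) : j.subst (fun i => .var i) = j := by
  cases j <;> simp [subst, Expr.subst_var]

end Judgement

open Judgement

/-- A family of derivable judgements `(Γ) 𝒥`, not yet subject to any rule. -/
structure PreTheory (S : Signature.{u}) where
  Der : {n : ℕ} → Ctx S n → Judgement S n → Prop

namespace PreTheory

variable (T : PreTheory S)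

/-- Well-formed contexts. -/
def Wf {n : ℕ} (Γ : Ctx S n) : Prop := ∀ i : Fin n, T.Der (Γ.take i) (isType (Γ i))

/-- `σ` is a context morphism from `Φ` to `Ψ`: `(Φ) σᵢ ∈ Ψᵢ(σ₀, …, σᵢ₋₁)` for each `i`. -/
def IsMor {n m : ℕ} (Φ : Ctx S n) (Ψ : Ctx S m) (σ : Fin m → Expr S n) : Prop :=
  ∀ i : Fin m, T.Der Φ (isElem (σ i) ((Ψ i).subst (initSeg σ i)))

/-- `σ` and `τ` are pointwise definitionally equal: `(Φ) σᵢ = τᵢ ∈ Ψᵢ(σ₀, …, σᵢ₋₁)`. -/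
def MorEq {n m : ℕ} (Φ : Ctx S n) (Ψ : Ctx S m) (σ τ : Fin m → Expr S n) : Prop :=
  ∀ i : Fin m, T.Der Φ (eqElem (σ i) (τ i) ((Ψ i).subst (initSeg σ i)))

/-- The type of the `i`-th component of an element whose earlier components are those of `a`, in a
dependent context `Θ`. -/
def _root_.DTT.Tel.at {n m : ℕ} (Θ : Tel S n m) (a : Fin m → Expr S n) (i : Fin m) : Expr S n :=
  (Θ i).subst (Fin.append (fun j => .var j) (initSeg a i))

/-- `(Γ) a ∈ Θ`, for a dependent context `Θ` relative to `Γ`. -/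
def IsElemTel {n m : ℕ} (Γ : Ctx S n) (Θ : Tel S n m) (a : Fin m → Expr S n) : Prop :=
  ∀ i : Fin m, T.Der Γ (isElem (a i) (Θ.at a i))

/-- `(Γ) a = b ∈ Θ`, for a dependent context `Θ` relative to `Γ`. -/
def EqElemTel {n m : ℕ} (Γ : Ctx S n) (Θ : Tel S n m) (a b : Fin m → Expr S n) : Prop :=
  ∀ i : Fin m, T.Der Γ (eqElem (a i) (b i) (Θ.at a i))

end PreTheory

/-- The dependent context `Θ[σ]`, for a dependent context `Θ` relative to a context of length `n`. -/
def Tel.subst {n n' m : ℕ} (Θ : Tel S n m) (σ : Fin n → Expr S n') : Tel S n' m :=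
  fun i => (Θ i).subst (liftSub σ i)

/-- The substitution `(γ, a, b, p)`. -/
def triple {n : ℕ} (a b p : Expr S n) : Fin (n + 3) → Expr S n :=
  Fin.append (fun j => .var j) ![a, b, p]

/-- The substitution `(γ, x, x, r(x))` in the variables `γ, x`, for `x ∈ A`. -/
def diag {n : ℕ} (A : Expr S n) : Fin (n + 3) → Expr S (n + 1) :=
  Fin.append (fun j => .var (Fin.castAdd 1 j))
    ![.var (Fin.natAdd n 0), .var (Fin.natAdd n 0),
      .refl (A.rename (Fin.castAdd 1)) (.var (Fin.natAdd n 0))]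

/-- A dependent type theory with identity types: a family of derivable judgements over the raw
expressions that is closed under (at least) the structural rules and the rules for identity types.
All contexts are well-formed. Since `Id`, `refl` and `J` are constructors of raw expressions, they
commute with substitution. -/
structure TypeTheory (S : Signature.{u}) extends PreTheory S where
  /-- Each judgement presupposes that the types and elements it mentions are such. -/
  presup_elem {n : ℕ} {Γ : Ctx S n} {a A : Expr S n} (hΓ : toPreTheory.Wf Γ) :
    Der Γ (isElem a A) → Der Γ (isType A)
  presup_eqType {n : ℕ} {Γ : Ctx S n} {A B : Expr S n} (hΓ : toPreTheory.Wf Γ) :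
    Der Γ (eqType A B) → Der Γ (isType A) ∧ Der Γ (isType B)
  presup_eqElem {n : ℕ} {Γ : Ctx S n} {a b A : Expr S n} (hΓ : toPreTheory.Wf Γ) :
    Der Γ (eqElem a b A) → Der Γ (isElem a A) ∧ Der Γ (isElem b A)
  /-- The axiom (together with weakening): `(x₀ ∈ A₀, …, xₙ₋₁ ∈ Aₙ₋₁) xᵢ ∈ Aᵢ`. -/
  var {n : ℕ} {Γ : Ctx S n} (hΓ : toPreTheory.Wf Γ) (i : Fin n) :
    Der Γ (isElem (.var i) ((Γ i).rename (fun j => ⟨j, j.2.trans i.2⟩)))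
  /-- Weakening and substitution, in simultaneous form: they are the cases where `σ` omits a
  variable, and where `σ` replaces one variable by an element. -/
  subst {n m : ℕ} {Φ : Ctx S n} {Ψ : Ctx S m} (hΦ : toPreTheory.Wf Φ) (hΨ : toPreTheory.Wf Ψ)
    {σ : Fin m → Expr S n} (hσ : toPreTheory.IsMor Φ Ψ σ) {j : Judgement S m} :
    Der Ψ j → Der Φ (j.subst σ)
  /-- Substitution of definitionally equal elements in types. -/
  subst_eqType {n m : ℕ} {Φ : Ctx S n} {Ψ : Ctx S m} (hΦ : toPreTheory.Wf Φ)
    (hΨ : toPreTheory.Wf Ψ) {σ τ : Fin m → Expr S n} (hσ : toPreTheory.IsMor Φ Ψ σ)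
    (hτ : toPreTheory.IsMor Φ Ψ τ) (h : toPreTheory.MorEq Φ Ψ σ τ) {A : Expr S m} :
    Der Ψ (isType A) → Der Φ (eqType (A.subst σ) (A.subst τ))
  /-- Substitution of definitionally equal elements in elements. -/
  subst_eqElem {n m : ℕ} {Φ : Ctx S n} {Ψ : Ctx S m} (hΦ : toPreTheory.Wf Φ)
    (hΨ : toPreTheory.Wf Ψ) {σ τ : Fin m → Expr S n} (hσ : toPreTheory.IsMor Φ Ψ σ)
    (hτ : toPreTheory.IsMor Φ Ψ τ) (h : toPreTheory.MorEq Φ Ψ σ τ) {a A : Expr S m} :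
    Der Ψ (isElem a A) → Der Φ (eqElem (a.subst σ) (a.subst τ) (A.subst σ))
  eqType_refl {n : ℕ} {Γ : Ctx S n} {A : Expr S n} (hΓ : toPreTheory.Wf Γ) :
    Der Γ (isType A) → Der Γ (eqType A A)
  eqType_symm {n : ℕ} {Γ : Ctx S n} {A B : Expr S n} (hΓ : toPreTheory.Wf Γ) :
    Der Γ (eqType A B) → Der Γ (eqType B A)
  eqType_trans {n : ℕ} {Γ : Ctx S n} {A B C : Expr S n} (hΓ : toPreTheory.Wf Γ) :
    Der Γ (eqType A B) → Der Γ (eqType B C) → Der Γ (eqType A C)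
  eqElem_refl {n : ℕ} {Γ : Ctx S n} {a A : Expr S n} (hΓ : toPreTheory.Wf Γ) :
    Der Γ (isElem a A) → Der Γ (eqElem a a A)
  eqElem_symm {n : ℕ} {Γ : Ctx S n} {a b A : Expr S n} (hΓ : toPreTheory.Wf Γ) :
    Der Γ (eqElem a b A) → Der Γ (eqElem b a A)
  eqElem_trans {n : ℕ} {Γ : Ctx S n} {a b c A : Expr S n} (hΓ : toPreTheory.Wf Γ) :
    Der Γ (eqElem a b A) → Der Γ (eqElem b c A) → Der Γ (eqElem a c A)
  conv_elem {n : ℕ} {Γ : Ctx S n} {a A B : Expr S n} (hΓ : toPreTheory.Wf Γ) :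
    Der Γ (isElem a A) → Der Γ (eqType A B) → Der Γ (isElem a B)
  conv_eqElem {n : ℕ} {Γ : Ctx S n} {a b A B : Expr S n} (hΓ : toPreTheory.Wf Γ) :
    Der Γ (eqElem a b A) → Der Γ (eqType A B) → Der Γ (eqElem a b B)
  /-- Formation rule. -/
  id_form {n : ℕ} {Γ : Ctx S n} {A a b : Expr S n} (hΓ : toPreTheory.Wf Γ) :
    Der Γ (isType A) → Der Γ (isElem a A) → Der Γ (isElem b A) → Der Γ (isType (.Id A a b))
  /-- Introduction rule. -/
  id_intro {n : ℕ} {Γ : Ctx S n} {A a : Expr S n} (hΓ : toPreTheory.Wf Γ) :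
    Der Γ (isElem a A) → Der Γ (isElem (.refl A a) (.Id A a a))
  /-- Elimination rule. -/
  id_elim {n m : ℕ} {Γ : Ctx S n} {A a b p : Expr S n} {Θ : Tel S (n + 3) m}
    {C : Expr S (n + 3 + m)} {d : Expr S (n + 1 + m)} {z : Fin m → Expr S n}
    (hΓ : toPreTheory.Wf Γ) (hA : Der Γ (isType A))
    (hΘ : toPreTheory.Wf ((Γ.idExt A).append Θ))
    (hC : Der ((Γ.idExt A).append Θ) (isType C))
    (hd : Der ((Γ.snoc A).append (Θ.subst (diag A))) (isElem d (C.subst (liftSub (diag A) m))))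
    (ha : Der Γ (isElem a A)) (hb : Der Γ (isElem b A)) (hp : Der Γ (isElem p (.Id A a b)))
    (hz : toPreTheory.IsElemTel Γ (Θ.subst (triple a b p)) z) :
    Der Γ (isElem (.J A Θ C d a b p z) (C.subst (Fin.append (triple a b p) z)))
  /-- Computation rule. -/
  id_comp {n m : ℕ} {Γ : Ctx S n} {A a : Expr S n} {Θ : Tel S (n + 3) m}
    {C : Expr S (n + 3 + m)} {d : Expr S (n + 1 + m)} {z : Fin m → Expr S n}
    (hΓ : toPreTheory.Wf Γ) (hA : Der Γ (isType A))
    (hΘ : toPreTheory.Wf ((Γ.idExt A).append Θ))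
    (hC : Der ((Γ.idExt A).append Θ) (isType C))
    (hd : Der ((Γ.snoc A).append (Θ.subst (diag A))) (isElem d (C.subst (liftSub (diag A) m))))
    (ha : Der Γ (isElem a A))
    (hz : toPreTheory.IsElemTel Γ (Θ.subst (triple a a (.refl A a))) z) :
    Der Γ (eqElem (.J A Θ C d a a (.refl A a) z)
      (d.subst (Fin.append (Fin.append (fun j => .var j) ![a]) z))
      (C.subst (Fin.append (triple a a (.refl A a)) z)))

/-! ## Identity contexts -/

/-- The substitution (or renaming) of four blocks of variables `x, y, u, z`. -/
def blocks {α : Type*} {n m l k : ℕ} (x : Fin n → α) (y : Fin m → α) (u : Fin l → α)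
    (z : Fin k → α) : Fin (n + m + l + k) → α :=
  Fin.append (Fin.append (Fin.append x y) u) z

section positions
variable {n m : ℕ}
/-- The variables `x` among `x, y, u, z`. -/
def X (i : Fin n) : Fin (n + n + n + m) := Fin.castAdd m (Fin.castAdd n (Fin.castAdd n i))
/-- The variables `y` among `x, y, u, z`. -/
def Y (i : Fin n) : Fin (n + n + n + m) := Fin.castAdd m (Fin.castAdd n (Fin.natAdd n i))
/-- The variables `u` among `x, y, u, z`. -/
def U (i : Fin n) : Fin (n + n + n + m) := Fin.castAdd m (Fin.natAdd (n + n) i)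
/-- The variables `z` among `x, y, u, z`. -/
def Z (i : Fin m) : Fin (n + n + n + m) := Fin.natAdd (n + n + n) i
end positions

/-- The reordering `((x, x'), (y, y'), (u, v), z) ↦ (x, y, u, (x', y', v, z))` of variables. -/
def shuffle (n m : ℕ) :
    Fin ((n + 1) + (n + 1) + (n + 1) + m) → Fin (n + n + n + (3 + m)) :=
  blocks (Fin.snoc (α := fun _ => Fin (n + n + n + (3 + m))) X (Z (Fin.castAdd m 0)))
    (Fin.snoc (α := fun _ => Fin (n + n + n + (3 + m))) Y (Z (Fin.castAdd m 1)))
    (Fin.snoc (α := fun _ => Fin (n + n + n + (3 + m))) U (Z (Fin.castAdd m 2)))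
    (fun t => Z (Fin.natAdd 3 t))

/-- The inverse of `shuffle`. -/
def unshuffle (n m : ℕ) :
    Fin (n + n + n + (3 + m)) → Fin ((n + 1) + (n + 1) + (n + 1) + m) :=
  blocks (fun i => X i.castSucc) (fun i => Y i.castSucc) (fun i => U i.castSucc)
    (Fin.append ![X (Fin.last n), Y (Fin.last n), U (Fin.last n)] Z)

/-- The reflexivity element `(x ∈ Ψ) r(x) ∈ Id_Ψ(x, x)` of an identity context. -/
def reflCtx {n : ℕ} (Ψ : Ctx S n) (i : Fin n) : Expr S n :=
  .refl ((Ψ i).rename (fun j => ⟨j, j.2.trans i.2⟩)) (.var i)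

/-- The eliminator `(x ∈ Ψ, y ∈ Ψ, u ∈ Id_Ψ(x, y), z ∈ Θ(x, y, u)) J(x, y, u, d)(z) ∈ C(x, y, u, z)`
of identity contexts, for `(x ∈ Ψ, z ∈ Θ(x, x, r(x))) d(x, z) ∈ C(x, x, r(x), z)`, by recursion on
the length of `Ψ`.

For `Ψ = (x ∈ Ψ', x' ∈ A(x))` one first eliminates `u` in
`(x ∈ Ψ', y ∈ Ψ', u ∈ Id(x, y))`, with `x', y', v, z` as parameters, where
`v ∈ Id_{A(y)}(u_!(x'), y')`; the eliminating family that this requires is given by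
eliminating `v ∈ Id_{A(x)}(x', y')` with `d`. -/
def ctxJ : (n : ℕ) → (Ψ : Ctx S n) → {m : ℕ} → (Θ : Tel S (n + n + n) m) →
    (C : Expr S (n + n + n + m)) → (d : Expr S (n + m)) → Expr S (n + n + n + m)
  | 0, _, m, _, _, d => d.rename (Fin.cast (by omega))
  | n + 1, Ψ, m, Θ, C, d =>
    let Ψ' : Ctx S n := fun i => Ψ i.castSucc
    let A : Expr S n := Ψ (Fin.last n)
    -- `(x, y, u, z ∈ A(x)) u_!(z) ∈ A(y)`
    let tr : Expr S (n + n + n + 1) :=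
      ctxJ n Ψ' (m := 1) (fun _ => A.rename X) (A.rename Y) (.var (Fin.natAdd n 0))
    -- `(x' ∈ A(x), y' ∈ A(y), v ∈ Id_{A(y)}(u_!(x'), y'), z ∈ Θ)`
    let Θ' : Tel S (n + n + n) (3 + m) :=
      Fin.addCases (motive := fun i : Fin (3 + m) => Expr S (n + n + n + i))
        (fun i : Fin 3 => match i with
          | 0 => A.rename (X (m := 0))
          | 1 => A.rename (Y (m := 1))
          | 2 => .Id (A.rename (Y (m := 2))) (tr.rename (Fin.castAdd 1)) (.var (Z (m := 2) 1)))
        (fun i => (Θ i).rename (shuffle n i))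
    -- the variables `x`, `x'`, `y'`, `v`, `z` of the eliminating family
    let x : {k : ℕ} → Fin n → Fin (n + (3 + m) + k) := fun {k} i => Fin.castAdd k (Fin.castAdd _ i)
    let at' : {k : ℕ} → Fin ((n + 1) + (n + 1) + (n + 1) + k) → Expr S (n + (3 + m) + 3 + k) :=
      fun {k} => blocks
        (Fin.snoc (α := fun _ => Expr S (n + (3 + m) + 3 + k))
          (fun i => .var (Fin.castAdd k (x i))) (.var (Fin.castAdd k (Fin.natAdd _ 0))))
        (Fin.snoc (α := fun _ => Expr S (n + (3 + m) + 3 + k))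
          (fun i => .var (Fin.castAdd k (x i))) (.var (Fin.castAdd k (Fin.natAdd _ 1))))
        (Fin.snoc (α := fun _ => Expr S (n + (3 + m) + 3 + k))
          (fun i => (reflCtx Ψ' i).rename (fun j => Fin.castAdd k (x j)))
          (.var (Fin.castAdd k (Fin.natAdd _ 2))))
        (fun t => .var (Fin.natAdd _ t))
    let d' : Expr S (n + (3 + m)) :=
      .J (A.rename (Fin.castAdd (3 + m)))
        (fun i : Fin m => (Θ i).subst at')
        (C.subst at')
        (d.rename (Fin.append
          (Fin.snoc (α := fun _ => Fin (n + (3 + m) + 1 + m))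
            (fun i => Fin.castAdd m (x i)) (Fin.castAdd m (Fin.natAdd _ 0)))
          (fun t => Fin.natAdd _ t)))
        (.var (Fin.natAdd n (Fin.castAdd m 0))) (.var (Fin.natAdd n (Fin.castAdd m 1)))
        (.var (Fin.natAdd n (Fin.castAdd m 2))) (fun t => .var (Fin.natAdd n (Fin.natAdd 3 t)))
    (ctxJ n Ψ' Θ' (C.rename (shuffle n m)) d').rename (unshuffle n m)

/-- The Leibniz rule `(x ∈ Ψ, y ∈ Ψ, u ∈ Id_Ψ(x, y), z ∈ A(x)) u_!(z) ∈ A(y)`, obtained by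
eliminating `u`, with `A(y)` as the eliminating type and `z ∈ A(x)` as the eliminating family. -/
def transport {n : ℕ} (Ψ : Ctx S n) (A : Expr S n) : Expr S (n + n + n + 1) :=
  ctxJ n Ψ (m := 1) (fun _ => A.rename X) (A.rename Y) (.var (Fin.natAdd n 0))

/-- The identity context `(x ∈ Ψ, y ∈ Ψ) Id_Ψ(x, y)`. Its `i`-th declaration is
`uᵢ ∈ Id_{Ψᵢ(y)}(u_!(xᵢ), yᵢ)`, where `u = (u₀, …, uᵢ₋₁)`. -/
def idCtx {n : ℕ} (Ψ : Ctx S n) : Tel S (n + n) n := fun i =>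
  let lt : Fin i → Fin n := fun j => ⟨j, j.2.trans i.2⟩
  .Id ((Ψ i).rename (fun j => Fin.castAdd i (Fin.natAdd n (lt j))))
    ((transport (Ψ.take i) (Ψ i)).rename
      (blocks (fun j => Fin.castAdd i (Fin.castAdd n (lt j)))
        (fun j => Fin.castAdd i (Fin.natAdd n (lt j)))
        (fun j => Fin.natAdd (n + n) j)
        (fun _ => Fin.castAdd i (Fin.castAdd n i))))
    (.var (Fin.castAdd i (Fin.natAdd n i)))

/-- The identity context `Id_Ψ(a, b)`, for `a, b ∈ Ψ` relative to a context of length `k`. -/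
def idCtxAt {n k : ℕ} (Ψ : Ctx S n) (a b : Fin n → Expr S k) : Tel S k n :=
  (idCtx Ψ).subst (Fin.append a b)

/-- The reflexivity element `1_a = r(a) ∈ Id_Ψ(a, a)`. -/
def reflAt {n k : ℕ} (Ψ : Ctx S n) (a : Fin n → Expr S k) : Fin n → Expr S k :=
  fun i => (reflCtx Ψ i).subst a

/-! ## The classifying category -/

namespace TypeTheory

variable (T : TypeTheory S)

/-- Well-formed contexts of length `n`. -/
structure Context (n : ℕ) where
  ctx : Ctx S n
  wf : T.Wf ctx

variable {T}

theorem Wf.take {n : ℕ} {Γ : Ctx S n} (h : T.Wf Γ) (i : Fin n) : T.Wf (Γ.take i) :=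
  fun j => h ⟨j, j.2.trans i.2⟩

theorem IsMor.take {n m : ℕ} {Φ : Ctx S n} {Ψ : Ctx S m} {σ : Fin m → Expr S n}
    (h : T.IsMor Φ Ψ σ) (i : Fin m) : T.IsMor Φ (Ψ.take i) (initSeg σ i) :=
  fun j => h ⟨j, j.2.trans i.2⟩

theorem MorEq.take {n m : ℕ} {Φ : Ctx S n} {Ψ : Ctx S m} {σ τ : Fin m → Expr S n}
    (h : T.MorEq Φ Ψ σ τ) (i : Fin m) : T.MorEq Φ (Ψ.take i) (initSeg σ i) (initSeg τ i) :=
  fun j => h ⟨j, j.2.trans i.2⟩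

theorem rename_eq_subst {n n' : ℕ} (e : Expr S n) (ρ : Fin n → Fin n') :
    e.rename ρ = e.subst (fun i => .var (ρ i)) := by
  conv_lhs => rw [← Expr.subst_var e]
  rw [Expr.rename_subst]; rfl

theorem isMor_proj {n : ℕ} {Γ : Ctx S n} (h : T.Wf Γ) (i : Fin n) :
    T.IsMor Γ (Γ.take i) (fun j => .var ⟨j, j.2.trans i.2⟩) := by
  intro j
  have := T.var h ⟨j, j.2.trans i.2⟩
  rw [rename_eq_subst] at this
  exact this

theorem isMor_id {n : ℕ} {Γ : Ctx S n} (h : T.Wf Γ) : T.IsMor Γ Γ (fun j => .var j) := by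
  intro j
  have := T.var h j
  rw [rename_eq_subst] at this
  exact this

theorem isMor_comp {n m l : ℕ} {Φ : Ctx S n} {Ψ : Ctx S m} {Ξ : Ctx S l} (hΦ : T.Wf Φ)
    (hΨ : T.Wf Ψ) {σ : Fin m → Expr S n} {τ : Fin l → Expr S m} (hσ : T.IsMor Φ Ψ σ)
    (hτ : T.IsMor Ψ Ξ τ) : T.IsMor Φ Ξ (fun i => (τ i).subst σ) := by
  intro i
  have := T.subst hΦ hΨ hσ (hτ i)
  simp only [Judgement.subst, Expr.subst_subst] at this
  exact this

theorem morEq_refl {n m : ℕ} {Φ : Ctx S n} {Ψ : Ctx S m} (hΦ : T.Wf Φ)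
    {σ : Fin m → Expr S n} (hσ : T.IsMor Φ Ψ σ) : T.MorEq Φ Ψ σ σ :=
  fun i => T.eqElem_refl hΦ (hσ i)

theorem morEq_symm {n m : ℕ} {Φ : Ctx S n} {Ψ : Ctx S m} (hΦ : T.Wf Φ) (hΨ : T.Wf Ψ)
    {σ τ : Fin m → Expr S n} (hσ : T.IsMor Φ Ψ σ) (hτ : T.IsMor Φ Ψ τ)
    (h : T.MorEq Φ Ψ σ τ) : T.MorEq Φ Ψ τ σ := fun i =>
  T.conv_eqElem hΦ (T.eqElem_symm hΦ (h i))
    (T.subst_eqType hΦ (Wf.take hΨ i) (IsMor.take hσ i) (IsMor.take hτ i) (MorEq.take h i) (hΨ i))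

theorem morEq_trans {n m : ℕ} {Φ : Ctx S n} {Ψ : Ctx S m} (hΦ : T.Wf Φ) (hΨ : T.Wf Ψ)
    {σ τ υ : Fin m → Expr S n} (hσ : T.IsMor Φ Ψ σ) (hτ : T.IsMor Φ Ψ τ)
    (h : T.MorEq Φ Ψ σ τ) (h' : T.MorEq Φ Ψ τ υ) : T.MorEq Φ Ψ σ υ := fun i =>
  T.eqElem_trans hΦ (h i) (T.conv_eqElem hΦ (h' i) (T.eqType_symm hΦ
    (T.subst_eqType hΦ (Wf.take hΨ i) (IsMor.take hσ i) (IsMor.take hτ i) (MorEq.take h i) (hΨ i))))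

theorem morEq_comp {n m l : ℕ} {Φ : Ctx S n} {Ψ : Ctx S m} {Ξ : Ctx S l} (hΦ : T.Wf Φ)
    (hΨ : T.Wf Ψ) (hΞ : T.Wf Ξ) {σ σ' : Fin m → Expr S n} {τ τ' : Fin l → Expr S m}
    (hσ : T.IsMor Φ Ψ σ) (hσ' : T.IsMor Φ Ψ σ') (hτ : T.IsMor Ψ Ξ τ)
    (h : T.MorEq Φ Ψ σ σ') (h' : T.MorEq Ψ Ξ τ τ') :
    T.MorEq Φ Ξ (fun i => (τ i).subst σ) (fun i => (τ' i).subst σ') := by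
  refine morEq_trans hΦ hΞ (isMor_comp hΦ hΨ hσ hτ) (isMor_comp hΦ hΨ hσ' hτ)
    (fun i => ?_) (fun i => ?_)
  · have := T.subst_eqElem hΦ hΨ hσ hσ' h (hτ i)
    rw [Expr.subst_subst] at this
    exact this
  · have := T.subst hΦ hΨ hσ' (h' i)
    simp only [Judgement.subst, Expr.subst_subst] at this
    exact this

variable (T) in
/-- Componentwise definitional equality of contexts. (With variables numbered by position,
contexts that differ by a renaming of variables are the same.) -/
def CtxEq {n : ℕ} (Φ Φ' : Ctx S n) : Prop :=
  ∀ i : Fin n, T.Der (Φ.take i) (eqType (Φ i) (Φ' i))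

theorem CtxEq.take {n : ℕ} {Φ Φ' : Ctx S n} (h : T.CtxEq Φ Φ') (i : Fin n) :
    T.CtxEq (Φ.take i) (Φ'.take i) :=
  fun j => h ⟨j, j.2.trans i.2⟩

theorem CtxEq.isMor {n : ℕ} {Φ Φ' : Ctx S n} (hΦ : T.Wf Φ) (h : T.CtxEq Φ Φ') :
    T.IsMor Φ Φ' (fun j => .var j) := by
  intro i
  exact T.conv_elem hΦ (isMor_id hΦ i) (T.subst hΦ (Wf.take hΦ i) (isMor_proj hΦ i) (h i))

theorem CtxEq.symm : ∀ {n : ℕ} {Φ Φ' : Ctx S n}, T.Wf Φ → T.Wf Φ' → T.CtxEq Φ Φ' →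
    T.CtxEq Φ' Φ := by
  intro n
  induction n using Nat.strong_induction_on with
  | _ n ih =>
    intro Φ Φ' hΦ hΦ' h i
    have h1 := ih i i.2 (Wf.take hΦ i) (Wf.take hΦ' i) (CtxEq.take h i)
    have h2 := T.subst (Wf.take hΦ' i) (Wf.take hΦ i) (CtxEq.isMor (Wf.take hΦ' i) h1) (h i)
    rw [Judgement.subst_var] at h2
    exact T.eqType_symm (Wf.take hΦ' i) h2

theorem CtxEq.trans {n : ℕ} {Φ Φ' Φ'' : Ctx S n} (hΦ : T.Wf Φ) (hΦ' : T.Wf Φ')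
    (h : T.CtxEq Φ Φ') (h' : T.CtxEq Φ' Φ'') : T.CtxEq Φ Φ'' := by
  intro i
  have h2 := T.subst (Wf.take hΦ i) (Wf.take hΦ' i)
    (CtxEq.isMor (Wf.take hΦ i) (CtxEq.take h i)) (h' i)
  rw [Judgement.subst_var] at h2
  exact T.eqType_trans (Wf.take hΦ i) (h i) h2

variable (T) in
/-- Definitional equality as an equivalence relation on contexts. -/
instance ctxSetoid (n : ℕ) : Setoid (T.Context n) where
  r Φ Φ' := T.CtxEq Φ.ctx Φ'.ctx
  iseqv :=
    { refl := fun Φ i => T.eqType_refl (Wf.take Φ.wf i) (Φ.wf i)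
      symm := fun {Φ Φ'} h => CtxEq.symm Φ.wf Φ'.wf h
      trans := fun {Φ Φ' _} h h' => CtxEq.trans Φ.wf Φ'.wf h h' }

theorem isMor_congr {n m : ℕ} {Φ Φ' : T.Context n} {Ψ Ψ' : T.Context m} (h : Φ ≈ Φ')
    (h' : Ψ ≈ Ψ') {σ : Fin m → Expr S n} (hσ : T.IsMor Φ.ctx Ψ.ctx σ) :
    T.IsMor Φ'.ctx Ψ'.ctx σ := by
  have h1 := isMor_comp Φ.wf Ψ.wf hσ (CtxEq.isMor Ψ.wf h')
  have h2 := isMor_comp Φ'.wf Φ.wf (CtxEq.isMor Φ'.wf (CtxEq.symm Φ.wf Φ'.wf h)) h1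
  simpa only [Expr.subst, Expr.subst_var] using h2

theorem morEq_congr {n m : ℕ} {Φ Φ' : T.Context n} {Ψ Ψ' : T.Context m} (h : Φ ≈ Φ')
    (h' : Ψ ≈ Ψ') {σ τ : Fin m → Expr S n} (hσ : T.IsMor Φ.ctx Ψ.ctx σ)
    (hτ : T.IsMor Φ.ctx Ψ.ctx τ) (hστ : T.MorEq Φ.ctx Ψ.ctx σ τ) :
    T.MorEq Φ'.ctx Ψ'.ctx σ τ := by
  have h0 := CtxEq.isMor Φ'.wf (CtxEq.symm Φ.wf Φ'.wf h)
  have h1 := CtxEq.isMor Ψ.wf h'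
  have h2 := morEq_comp Φ.wf Ψ.wf Ψ'.wf hσ hτ h1 hστ (morEq_refl Ψ.wf h1)
  have h3 := morEq_comp Φ'.wf Φ.wf Ψ'.wf h0 h0 (isMor_comp Φ.wf Ψ.wf hσ h1)
    (morEq_refl Φ'.wf h0) h2
  simpa only [Expr.subst, Expr.subst_var] using h3

/-- `σ` is a context morphism between contexts in the classes `q` and `r`. -/
def IsMorCls {n m : ℕ} (q : Quotient (T.ctxSetoid n)) (r : Quotient (T.ctxSetoid m))
    (σ : Fin m → Expr S n) : Prop :=
  Quotient.liftOn₂ q r (fun Φ Ψ => T.IsMor Φ.ctx Ψ.ctx σ) (fun _ _ _ _ h h' =>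
    propext ⟨isMor_congr h h', isMor_congr (Setoid.symm h) (Setoid.symm h')⟩)

/-- Pointwise definitional equality of context morphisms between contexts in the classes
`q` and `r`. -/
def MorEqCls {n m : ℕ} (q : Quotient (T.ctxSetoid n)) (r : Quotient (T.ctxSetoid m))
    (σ τ : Fin m → Expr S n) : Prop :=
  Quotient.liftOn₂ q r
    (fun Φ Ψ => T.IsMor Φ.ctx Ψ.ctx σ ∧ T.IsMor Φ.ctx Ψ.ctx τ ∧ T.MorEq Φ.ctx Ψ.ctx σ τ)
    (fun _ _ _ _ h h' => propext
      ⟨fun H => ⟨isMor_congr h h' H.1, isMor_congr h h' H.2.1, morEq_congr h h' H.1 H.2.1 H.2.2⟩,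
        fun H => ⟨isMor_congr (Setoid.symm h) (Setoid.symm h') H.1,
          isMor_congr (Setoid.symm h) (Setoid.symm h') H.2.1,
          morEq_congr (Setoid.symm h) (Setoid.symm h') H.1 H.2.1 H.2.2⟩⟩)

variable (T) in
/-- The objects of the classifying category: classes of contexts up to definitional equality. -/
structure Cl where
  len : ℕ
  cls : Quotient (T.ctxSetoid len)

/-- Pointwise definitional equality as an equivalence relation on context morphisms. -/
def homSetoid (P Q : T.Cl) :
    Setoid {σ : Fin Q.len → Expr S P.len // IsMorCls P.cls Q.cls σ} where
  r σ τ := MorEqCls P.cls Q.cls σ.1 τ.1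
  iseqv := by
    obtain ⟨n, q⟩ := P
    obtain ⟨m, r⟩ := Q
    induction q using Quotient.inductionOn with | _ Φ
    induction r using Quotient.inductionOn with | _ Ψ
    exact
      { refl := fun σ => ⟨σ.2, σ.2, morEq_refl Φ.wf σ.2⟩
        symm := fun h => ⟨h.2.1, h.1, morEq_symm Φ.wf Ψ.wf h.1 h.2.1 h.2.2⟩
        trans := fun h h' => ⟨h.1, h'.2.1, morEq_trans Φ.wf Ψ.wf h.1 h.2.1 h.2.2 h'.2.2⟩ }

theorem isMorCls_id (P : T.Cl) : IsMorCls P.cls P.cls (fun i => .var i) := by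
  obtain ⟨n, q⟩ := P
  induction q using Quotient.inductionOn with | _ Φ
  exact isMor_id Φ.wf

theorem isMorCls_comp {P Q R : T.Cl} {σ : Fin Q.len → Expr S P.len}
    {τ : Fin R.len → Expr S Q.len} (hσ : IsMorCls P.cls Q.cls σ) (hτ : IsMorCls Q.cls R.cls τ) :
    IsMorCls P.cls R.cls (fun i => (τ i).subst σ) := by
  obtain ⟨n, q⟩ := P
  obtain ⟨m, r⟩ := Q
  obtain ⟨l, s⟩ := R
  induction q using Quotient.inductionOn with | _ Φ
  induction r using Quotient.inductionOn with | _ Ψ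
  induction s using Quotient.inductionOn with | _ Ξ
  exact isMor_comp Φ.wf Ψ.wf hσ hτ

theorem morEqCls_comp {P Q R : T.Cl} {σ σ' : Fin Q.len → Expr S P.len}
    {τ τ' : Fin R.len → Expr S Q.len} (h : MorEqCls P.cls Q.cls σ σ')
    (h' : MorEqCls Q.cls R.cls τ τ') :
    MorEqCls P.cls R.cls (fun i => (τ i).subst σ) (fun i => (τ' i).subst σ') := by
  obtain ⟨n, q⟩ := P
  obtain ⟨m, r⟩ := Q
  obtain ⟨l, s⟩ := R
  induction q using Quotient.inductionOn with | _ Φ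
  induction r using Quotient.inductionOn with | _ Ψ
  induction s using Quotient.inductionOn with | _ Ξ
  exact ⟨isMor_comp Φ.wf Ψ.wf h.1 h'.1, isMor_comp Φ.wf Ψ.wf h.2.1 h'.2.1,
    morEq_comp Φ.wf Ψ.wf Ξ.wf h.1 h.2.1 h'.1 h.2.2 h'.2.2⟩

/-- The classifying category: its maps are the classes of context morphisms up to pointwise
definitional equality, and composition is substitution. -/
instance : Category.{u} T.Cl where
  Hom P Q := Quotient (homSetoid P Q)
  id P := Quotient.mk _ ⟨fun i => .var i, isMorCls_id P⟩
  comp {P Q R} f g := Quotient.map₂ (sa := homSetoid P Q) (sb := homSetoid Q R)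
    (sc := homSetoid P R)
    (fun σ τ => ⟨fun i => (τ.1 i).subst σ.1, isMorCls_comp σ.2 τ.2⟩)
    (fun _ _ h _ _ h' => morEqCls_comp h h') f g
  id_comp f := by
    induction f using Quotient.inductionOn with | _ σ
    exact congrArg (Quotient.mk _) (Subtype.ext (funext fun i => Expr.subst_var _))
  comp_id f := by
    induction f using Quotient.inductionOn with | _ σ
    rfl
  assoc f g h := by
    induction f using Quotient.inductionOn with | _ σ
    induction g using Quotient.inductionOn with | _ τ
    induction h using Quotient.inductionOn with | _ υ
    exact congrArg (Quotient.mk _) (Subtype.ext (funext fun i => (Expr.subst_subst _ _ _).symm))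

/-- A context as an object of the classifying category. -/
def Context.toCl {n : ℕ} (Φ : T.Context n) : T.Cl := ⟨n, Quotient.mk _ Φ⟩

/-- Context morphisms. -/
structure CtxMor {n m : ℕ} (Φ : T.Context n) (Ψ : T.Context m) where
  tm : Fin m → Expr S n
  isMor : T.IsMor Φ.ctx Ψ.ctx tm

/-- A context morphism as a map of the classifying category. -/
def CtxMor.toHom {n m : ℕ} {Φ : T.Context n} {Ψ : T.Context m} (f : CtxMor Φ Ψ) :
    Φ.toCl ⟶ Ψ.toCl :=
  Quotient.mk (homSetoid Φ.toCl Ψ.toCl) ⟨f.tm, f.isMor⟩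

theorem wf_snoc {n : ℕ} {Γ : Ctx S n} {A : Expr S n} (hΓ : T.Wf Γ) (hA : T.Der Γ (isType A)) :
    T.Wf (Γ.snoc A) := by
  intro i
  have key : ∀ i : Fin n, (Γ.snoc A) i.castSucc = Γ i := fun i =>
    Fin.snoc_castSucc (α := fun i : Fin (n + 1) => Expr S i) A Γ i
  refine Fin.lastCases ?_ (fun i => ?_) i
  · have h1 : (Γ.snoc A).take (Fin.last n) = Γ := funext key
    have h2 : (Γ.snoc A) (Fin.last n) = A :=
      Fin.snoc_last (α := fun i : Fin (n + 1) => Expr S i) A Γ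
    rw [h1, h2]; exact hA
  · have h1 : (Γ.snoc A).take i.castSucc = Γ.take i :=
      funext fun j => key ⟨j, j.2.trans i.2⟩
    rw [h1, key]; exact hΓ i

/-- The context `(Γ, x ∈ A)`. -/
def Context.ext {n : ℕ} (Γ : T.Context n) (A : Expr S n) (hA : T.Der Γ.ctx (isType A)) :
    T.Context (n + 1) :=
  ⟨Γ.ctx.snoc A, wf_snoc Γ.wf hA⟩

/-- The projection `(Γ, x ∈ A) → Γ`. -/
def Context.proj {n : ℕ} (Γ : T.Context n) (A : Expr S n) (hA : T.Der Γ.ctx (isType A)) :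
    CtxMor (Γ.ext A hA) Γ where
  tm := fun i => .var i.castSucc
  isMor := by
    have h := isMor_proj (Γ.ext A hA).wf (Fin.last n)
    have h1 : (Γ.ext A hA).ctx.take (Fin.last n) = Γ.ctx := funext fun i =>
      Fin.snoc_castSucc (α := fun i : Fin (n + 1) => Expr S i) A Γ.ctx i
    rw [h1] at h
    exact h

variable (T) in
/-- The class of display maps in the classifying category. -/
inductive display : MorphismProperty T.Cl
  | mk {n : ℕ} (Γ : T.Context n) (A : Expr S n) (hA : T.Der Γ.ctx (isType A)) :
      display (Γ.proj A hA).toHom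

variable (T) in
/-- The class `𝒜` of maps with the left lifting property with respect to all display maps. -/
def classA : MorphismProperty T.Cl := T.display.llp

variable (T) in
/-- The class `ℬ` of maps with the right lifting property with respect to all maps in `𝒜`. -/
def classB : MorphismProperty T.Cl := T.classA.rlp

/-! ## Type-theoretic injective equivalences and normal isofibrations -/

/-- `f : Φ → Ψ` is a type-theoretic injective equivalence. -/
def IsInjectiveEquivalence {n m : ℕ} {Φ : T.Context n} {Ψ : T.Context m} (f : CtxMor Φ Ψ) :
    Prop :=
  -- `(y ∈ Ψ) s(y) ∈ Φ`
  ∃ s : Fin n → Expr S m, T.IsMor Ψ.ctx Φ.ctx s ∧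
    -- `(x ∈ Φ) x = s(f(x)) ∈ Φ`
    T.MorEq Φ.ctx Φ.ctx (fun i => .var i) (fun i => (s i).subst f.tm) ∧
    -- `(y ∈ Ψ) ε(y) ∈ Id_Ψ(f(s(y)), y)`
    ∃ ε : Fin m → Expr S m,
      T.IsElemTel Ψ.ctx (idCtxAt Ψ.ctx (fun i => (f.tm i).subst s) (fun i => .var i)) ε ∧
      -- `(x ∈ Φ) ε(f(x)) = 1_{f(x)} ∈ Id_Ψ(f(x), f(x))`
      T.EqElemTel Φ.ctx (idCtxAt Ψ.ctx f.tm f.tm) (fun i => (ε i).subst f.tm)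
        (reflAt Ψ.ctx f.tm)

/-- The context `(x ∈ Φ, y ∈ Ψ, u ∈ Id_Ψ(f(x), y))`. -/
def pathCtx {n m : ℕ} {Φ : T.Context n} {Ψ : T.Context m} (f : CtxMor Φ Ψ) :
    Ctx S (n + m + m) :=
  (Φ.ctx.append (Ψ.ctx.toTel n)).append
    (idCtxAt Ψ.ctx (fun i => (f.tm i).rename (Fin.castAdd m)) (fun i => .var (Fin.natAdd n i)))

/-- `f : Φ → Ψ` is a type-theoretic normal isofibration. -/
def IsNormalIsofibration {n m : ℕ} {Φ : T.Context n} {Ψ : T.Context m} (f : CtxMor Φ Ψ) :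
    Prop :=
  -- `(x ∈ Φ, y ∈ Ψ, u ∈ Id_Ψ(f(x), y)) j(x, y, u) ∈ Φ`
  ∃ j : Fin n → Expr S (n + m + m), T.IsMor (pathCtx f) Φ.ctx j ∧
    -- `(x ∈ Φ, y ∈ Ψ, u ∈ Id_Ψ(f(x), y)) f(j(x, y, u)) = y ∈ Ψ`
    T.MorEq (pathCtx f) Ψ.ctx (fun i => (f.tm i).subst j)
      (fun i => .var (Fin.castAdd m (Fin.natAdd n i))) ∧
    -- `(x ∈ Φ) j(x, f(x), 1_{f(x)}) = x ∈ Φ`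
    T.MorEq Φ.ctx Φ.ctx
      (fun i => (j i).subst
        (Fin.append (Fin.append (fun k => .var k) f.tm) (reflAt Ψ.ctx f.tm)))
      (fun i => .var i)

end TypeTheory

end DTT

/-! A lifting problem of `f : Φ → Ψ` against a display map can be pulled back along its bottom map.
It then asks that an element `c ∈ B(f(x))` given over `Φ`, for a type `B` over `Ψ`, be the
restriction along `f` of an element of `B` over `Ψ`. Hence membership in `𝒜` is the extension
property `LiftProp` (`classA_iff_liftProp`). By induction on length, this property for types gives
the same for dependent contexts and for context morphisms (`LiftProp.tel`, `LiftProp.ctx`).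

The technical base is `ctxElim`: identity contexts satisfy formation, introduction, elimination with
parameters, and computation. All four are proved in one induction on the length, because forming
`Id_Ψ` already uses transport along the identity context of the shorter context. In particular
transport `u_!` is well-typed and `(1_a)_!(z) = z` holds definitionally.

For (i), suppose `f` has the extension property. Extending the identity of `Φ` along `f` gives `s`
with `s(f(x)) = x`. Then `1_{f(x)}` is an element of `Id_Ψ(f(s(f(x))), f(x))`, and extending it
along `f` gives `ε`. Conversely, given `s` and `ε`, an element `c` over `Φ` is extended by `d(y) =
(ε_y)_!(c(s(y)))`, and `d(f(x)) = (1_{f(x)})_!(c(x)) = c(x)`.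

For (ii), let `P = (x ∈ Φ, y ∈ Ψ, u ∈ Id_Ψ(f(x), y))`. The main point is that `i(x) = (x, f(x),
1_{f(x)})` is in `𝒜` (`liftProp_pathOver`). If `f` is in `ℬ`, the structure `j` is then a filler of
the square with top the identity of `Φ`, left `i`, right `f` and bottom the projection `P → Ψ`.
Conversely, let `a, b` form a square from `g ∈ 𝒜` to `f`. Extend `a` along `g` to `k`, then extend
`1_{f(a)}` along `g` to `u ∈ Id_Ψ(f(k), b)`; the filler is `j(k, b, u)`.

That `i` is in `𝒜` is proved by induction on the length of `Ψ`: adding one type to `Ψ` enlarges `P`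
by a based path space, so the step is based path induction (`liftProp_basedPath`). There are no
Π-types to derive it with. The parameters `Θ` of the elimination rule take their place: an element
is transported along composition with a path, and the result is then corrected along the unit law
for composition. Both steps compute strictly at reflexivity, which is what makes the extension
restrict to the given element definitionally. -/

open CategoryTheory

namespace DTT
variable {S : Signature.{u}}
open Judgement

/-! ## Types of variables in contexts -/

/-- The type of the variable `i`, weakened to the whole context. -/
def Ctx.typ {n : ℕ} (Γ : Ctx S n) (i : Fin n) : Expr S n :=
  (Γ i).rename (fun j => ⟨j, j.2.trans i.2⟩)

/-- The type of the variable `i` of a dependent context, weakened to the whole context. -/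
def Tel.typ {n m : ℕ} (Θ : Tel S n m) (i : Fin m) : Expr S (n + m) :=
  (Θ i).rename (Fin.castLE (Nat.add_le_add_left i.2.le n))

/-- The context without its last declaration. -/
def Ctx.init {n : ℕ} (Γ : Ctx S (n + 1)) : Ctx S n := fun i => Γ i.castSucc

/-- The dependent context without its last declaration. -/
def Tel.init {n m : ℕ} (Θ : Tel S n (m + 1)) : Tel S n m := fun i => Θ i.castSucc

/-- `(Θ, x ∈ A)`. -/
def Tel.snoc {n m : ℕ} (Θ : Tel S n m) (A : Expr S (n + m)) : Tel S n (m + 1) :=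
  Fin.snoc (α := fun i : Fin (m + 1) => Expr S (n + i)) Θ A

section
variable {n m : ℕ}

@[simp] theorem Ctx.snoc_last (Γ : Ctx S n) (A : Expr S n) : (Γ.snoc A) (Fin.last n) = A :=
  Fin.snoc_last (α := fun i : Fin (n + 1) => Expr S i) A Γ

@[simp] theorem Ctx.snoc_castSucc (Γ : Ctx S n) (A : Expr S n) (i : Fin n) :
    (Γ.snoc A) i.castSucc = Γ i :=
  Fin.snoc_castSucc (α := fun i : Fin (n + 1) => Expr S i) A Γ i

@[simp] theorem Tel.snoc_last (Θ : Tel S n m) (A : Expr S (n + m)) :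
    (Θ.snoc A) (Fin.last m) = A :=
  Fin.snoc_last (α := fun i : Fin (m + 1) => Expr S (n + i)) A Θ

@[simp] theorem Tel.snoc_castSucc (Θ : Tel S n m) (A : Expr S (n + m)) (i : Fin m) :
    (Θ.snoc A) i.castSucc = Θ i :=
  Fin.snoc_castSucc (α := fun i : Fin (m + 1) => Expr S (n + i)) A Θ i

@[simp] theorem Ctx.init_snoc (Γ : Ctx S n) (A : Expr S n) : (Γ.snoc A).init = Γ :=
  funext fun i => Ctx.snoc_castSucc Γ A i

@[simp] theorem Ctx.snoc_init (Γ : Ctx S (n + 1)) : Γ.init.snoc (Γ (Fin.last n)) = Γ := by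
  funext i
  refine Fin.lastCases ?_ (fun i => ?_) i
  · exact Ctx.snoc_last _ _
  · exact Ctx.snoc_castSucc _ _ i

@[simp] theorem Tel.snoc_init (Θ : Tel S n (m + 1)) : Θ.init.snoc (Θ (Fin.last m)) = Θ := by
  funext i
  refine Fin.lastCases ?_ (fun i => ?_) i
  · exact Tel.snoc_last _ _
  · exact Tel.snoc_castSucc _ _ i

@[simp] theorem Ctx.append_castAdd (Γ : Ctx S n) (Θ : Tel S n m) (i : Fin n) :
    Γ.append Θ (Fin.castAdd m i) = Γ i :=
  Fin.addCases_left (motive := fun i : Fin (n + m) => Expr S i) i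

@[simp] theorem Ctx.append_natAdd (Γ : Ctx S n) (Θ : Tel S n m) (i : Fin m) :
    Γ.append Θ (Fin.natAdd n i) = Θ i :=
  Fin.addCases_right (motive := fun i : Fin (n + m) => Expr S i) i

@[simp] theorem Ctx.append_zero (Γ : Ctx S n) (Θ : Tel S n 0) : Γ.append Θ = Γ :=
  funext fun i => Ctx.append_castAdd Γ Θ i

theorem Ctx.append_snoc (Γ : Ctx S n) (Θ : Tel S n m) (A : Expr S (n + m)) :
    Γ.append (Θ.snoc A) = (Γ.append Θ).snoc A := by
  funext i
  refine Fin.lastCases ?_ (fun i => ?_) i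
  · refine (Ctx.append_natAdd Γ (Θ.snoc A) (Fin.last m)).trans ?_
    rw [Tel.snoc_last]; exact (Ctx.snoc_last _ _).symm
  · refine Eq.trans ?_ (Ctx.snoc_castSucc _ _ i).symm
    refine Fin.addCases (fun i => ?_) (fun i => ?_) i
    · exact (Ctx.append_castAdd Γ (Θ.snoc A) i).trans (Ctx.append_castAdd Γ Θ i).symm
    · exact (Ctx.append_natAdd Γ (Θ.snoc A) i.castSucc).trans
        ((Tel.snoc_castSucc _ _ i).trans (Ctx.append_natAdd Γ Θ i).symm)

theorem Ctx.append_succ (Γ : Ctx S n) (Θ : Tel S n (m + 1)) :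
    Γ.append Θ = (Γ.append Θ.init).snoc (Θ (Fin.last m)) := by
  rw [← Ctx.append_snoc, Tel.snoc_init]

/-! ### Substitutions -/

theorem Expr.rename_id (e : Expr S n) : e.rename (fun i => i) = e := by
  rw [TypeTheory.rename_eq_subst, Expr.subst_var]

theorem Expr.subst_congr (e : Expr S n) {σ τ : Fin n → Expr S m} (h : ∀ i, σ i = τ i) :
    e.subst σ = e.subst τ := by
  rw [funext h]

theorem Expr.rename_congr (e : Expr S n) {σ τ : Fin n → Fin m} (h : ∀ i, σ i = τ i) :
    e.rename σ = e.rename τ := by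
  rw [funext h]

@[simp] theorem Expr.subst_mk_var (i : Fin n) (σ : Fin n → Expr S m) :
    (Expr.var i : Expr S n).subst σ = σ i := rfl

@[simp] theorem Expr.rename_mk_var (i : Fin n) (σ : Fin n → Fin m) :
    (Expr.var i : Expr S n).rename σ = .var (σ i) := rfl

@[simp] theorem Expr.subst_mk_Id (A a b : Expr S n) (σ : Fin n → Expr S m) :
    (Expr.Id A a b).subst σ = .Id (A.subst σ) (a.subst σ) (b.subst σ) := rfl

@[simp] theorem Expr.rename_mk_Id (A a b : Expr S n) (σ : Fin n → Fin m) :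
    (Expr.Id A a b).rename σ = .Id (A.rename σ) (a.rename σ) (b.rename σ) := rfl

@[simp] theorem Expr.subst_mk_refl (A a : Expr S n) (σ : Fin n → Expr S m) :
    (Expr.refl A a).subst σ = .refl (A.subst σ) (a.subst σ) := rfl

@[simp] theorem Expr.rename_mk_refl (A a : Expr S n) (σ : Fin n → Fin m) :
    (Expr.refl A a).rename σ = .refl (A.rename σ) (a.rename σ) := rfl

@[simp] theorem liftSub_castAdd {n' : ℕ} (σ : Fin n → Expr S n') (k : ℕ) (i : Fin n) :
    liftSub σ k (Fin.castAdd k i) = (σ i).rename (Fin.castAdd k) := by simp [liftSub]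

@[simp] theorem liftSub_natAdd {n' : ℕ} (σ : Fin n → Expr S n') (k : ℕ) (i : Fin k) :
    liftSub σ k (Fin.natAdd n i) = .var (Fin.natAdd n' i) := by simp [liftSub]

@[simp] theorem liftRen_castAdd {n' : ℕ} (σ : Fin n → Fin n') (k : ℕ) (i : Fin n) :
    liftRen σ k (Fin.castAdd k i) = Fin.castAdd k (σ i) := by simp [liftRen]

@[simp] theorem liftRen_natAdd {n' : ℕ} (σ : Fin n → Fin n') (k : ℕ) (i : Fin k) :
    liftRen σ k (Fin.natAdd n i) = Fin.natAdd n' i := by simp [liftRen]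

theorem liftSub_zero {n' : ℕ} (σ : Fin n → Expr S n') : liftSub σ 0 = σ := by
  funext i
  refine (liftSub_castAdd σ 0 i).trans ?_
  exact Expr.rename_id _

theorem liftSub_mk_var {n' : ℕ} (ρ : Fin n → Fin n') (k : ℕ) :
    liftSub (fun i => (.var (ρ i) : Expr S n')) k = fun i => .var (liftRen ρ k i) := by
  funext i
  refine Fin.addCases (fun i => ?_) (fun i => ?_) i <;> simp

/-- Since `Γ i` mentions only the first `i` variables, the later components of `σ` are irrelevant
once its variables are weakened. This replaces expressions over varying numbers of variables by ones
over the whole context. -/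
theorem subst_initSeg {k : ℕ} (Γ : Ctx S n) (σ : Fin n → Expr S k) (i : Fin n) :
    (Γ i).subst (initSeg σ i) = (Γ.typ i).subst σ := by
  rw [Ctx.typ, Expr.subst_rename]; rfl

@[simp] theorem Ctx.typ_snoc_last (Γ : Ctx S n) (A : Expr S n) :
    (Γ.snoc A).typ (Fin.last n) = A.rename Fin.castSucc := by
  unfold Ctx.typ
  rw [Ctx.snoc_last]; rfl

@[simp] theorem Ctx.typ_snoc_castSucc (Γ : Ctx S n) (A : Expr S n) (i : Fin n) :
    (Γ.snoc A).typ i.castSucc = (Γ.typ i).rename Fin.castSucc := by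
  unfold Ctx.typ
  rw [Ctx.snoc_castSucc, Expr.rename_rename]; rfl

@[simp] theorem Ctx.typ_append_castAdd (Γ : Ctx S n) (Θ : Tel S n m) (i : Fin n) :
    (Γ.append Θ).typ (Fin.castAdd m i) = (Γ.typ i).rename (Fin.castAdd m) := by
  unfold Ctx.typ
  rw [Ctx.append_castAdd, Expr.rename_rename]; rfl

@[simp] theorem Ctx.typ_append_natAdd (Γ : Ctx S n) (Θ : Tel S n m) (i : Fin m) :
    (Γ.append Θ).typ (Fin.natAdd n i) = Θ.typ i := by
  unfold Ctx.typ Tel.typ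
  rw [Ctx.append_natAdd]; rfl

@[simp] theorem Ctx.typ_castSucc (Γ : Ctx S (n + 1)) (i : Fin n) :
    Γ.typ i.castSucc = (Γ.init.typ i).rename Fin.castSucc := by
  unfold Ctx.typ Ctx.init
  rw [Expr.rename_rename]; rfl

@[simp] theorem Ctx.typ_last (Γ : Ctx S (n + 1)) :
    Γ.typ (Fin.last n) = (Γ (Fin.last n)).rename Fin.castSucc := rfl

theorem Tel.typ_snoc_castSucc (Θ : Tel S n m) (A : Expr S (n + m)) (i : Fin m) :
    (Θ.snoc A).typ i.castSucc = (Θ.typ i).rename Fin.castSucc := by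
  unfold Tel.typ
  rw [Tel.snoc_castSucc, Expr.rename_rename]; rfl

theorem Ctx.typ_toTel (Γ : Ctx S n) (k : ℕ) (i : Fin n) :
    (Γ.toTel k).typ i = (Γ.typ i).rename (Fin.natAdd k) := by
  unfold Tel.typ Ctx.typ Ctx.toTel
  rw [Expr.rename_rename, Expr.rename_rename]; rfl

theorem Tel.typ_subst {n' : ℕ} (Θ : Tel S n m) (σ : Fin n → Expr S n') (i : Fin m) :
    (Θ.subst σ).typ i = (Θ.typ i).subst (liftSub σ m) := by
  unfold Tel.typ Tel.subst
  rw [Expr.rename_subst, Expr.subst_rename]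
  refine Expr.subst_congr _ fun j => ?_
  refine Fin.addCases (fun j => ?_) (fun j => ?_) j
  · have : Fin.castLE (Nat.add_le_add_left i.2.le n) (Fin.castAdd i j) = Fin.castAdd m j := rfl
    rw [this, liftSub_castAdd, liftSub_castAdd, Expr.rename_rename]; rfl
  · have : Fin.castLE (Nat.add_le_add_left i.2.le n) (Fin.natAdd n j)
      = Fin.natAdd n (Fin.castLE i.2.le j) := rfl
    rw [this, liftSub_natAdd, liftSub_natAdd]; rfl

theorem Tel.subst_snoc {n' : ℕ} (Θ : Tel S n m) (A : Expr S (n + m)) (σ : Fin n → Expr S n') :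
    (Θ.snoc A).subst σ = (Θ.subst σ).snoc (A.subst (liftSub σ m)) := by
  funext i
  refine Fin.lastCases ?_ (fun i => ?_) i
  · rw [Tel.snoc_last, Tel.subst, Tel.snoc_last]; rfl
  · rw [Tel.snoc_castSucc]; unfold Tel.subst; rw [Tel.snoc_castSucc]; rfl

theorem Tel.subst_subst {n' n'' : ℕ} (Θ : Tel S n m) (σ : Fin n → Expr S n')
    (τ : Fin n' → Expr S n'') :
    (Θ.subst σ).subst τ = Θ.subst (fun i => (σ i).subst τ) := by
  funext i
  simp only [Tel.subst, Expr.subst_subst, liftSub_liftSub]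

theorem append_liftSub {n' k : ℕ} (σ : Fin n → Expr S n') (τ : Fin n' → Expr S k)
    (z : Fin m → Expr S k) :
    (fun i => (liftSub σ m i).subst (Fin.append τ z))
      = Fin.append (fun i => (σ i).subst τ) z := by
  funext i
  refine Fin.addCases (fun i => ?_) (fun i => ?_) i
  · rw [liftSub_castAdd, Expr.subst_rename, Fin.append_left]; simp
  · simp

/-- The analogue of `subst_initSeg` for dependent contexts, with the substitution into the base
absorbed into a single tuple `(σ, z)`. It lets elements of dependent contexts be handled as the
tails of context morphisms. -/
theorem Tel.at_eq {k : ℕ} (Θ : Tel S n m) (σ : Fin n → Expr S k) (z : Fin m → Expr S k)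
    (i : Fin m) : (Θ.subst σ).at z i = (Θ.typ i).subst (Fin.append σ z) := by
  unfold Tel.at Tel.typ Tel.subst
  rw [Expr.subst_subst, append_liftSub, Expr.subst_rename]
  refine Expr.subst_congr _ fun j => ?_
  refine Fin.addCases (fun j => ?_) (fun j => ?_) j
  · have : Fin.castLE (Nat.add_le_add_left i.2.le n) (Fin.castAdd i j) = Fin.castAdd m j := rfl
    rw [this]; simp [Expr.subst_var]
  · have : Fin.castLE (Nat.add_le_add_left i.2.le n) (Fin.natAdd n j)
      = Fin.natAdd n (Fin.castLE i.2.le j) := rfl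
    rw [this]; simp; rfl

theorem Tel.subst_id (Θ : Tel S n m) : Θ.subst (fun i => .var i) = Θ := by
  funext i
  simp only [Tel.subst, liftSub_var, Expr.subst_var]

end

/-! ### Context morphisms by components, and pullback of dependent contexts -/

namespace TypeTheory
variable {T : TypeTheory S} {n m k l : ℕ}

theorem isMor_iff {Φ : Ctx S n} {Ψ : Ctx S m} {σ : Fin m → Expr S n} :
    T.IsMor Φ Ψ σ ↔ ∀ i, T.Der Φ (isElem (σ i) ((Ψ.typ i).subst σ)) := by
  simp only [PreTheory.IsMor, subst_initSeg]

theorem morEq_iff {Φ : Ctx S n} {Ψ : Ctx S m} {σ τ : Fin m → Expr S n} :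
    T.MorEq Φ Ψ σ τ ↔ ∀ i, T.Der Φ (eqElem (σ i) (τ i) ((Ψ.typ i).subst σ)) := by
  simp only [PreTheory.MorEq, subst_initSeg]

theorem der_var {Γ : Ctx S n} (h : T.Wf Γ) (i : Fin n) : T.Der Γ (isElem (.var i) (Γ.typ i)) :=
  T.var h i

/-- A renaming under which the types of variables agree is a context morphism. -/
theorem isMor_ren {Φ : Ctx S n} {Ψ : Ctx S m} (hΦ : T.Wf Φ) (ρ : Fin m → Fin n)
    (h : ∀ i, (Ψ.typ i).rename ρ = Φ.typ (ρ i)) : T.IsMor Φ Ψ (fun i => .var (ρ i)) := by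
  rw [isMor_iff]
  intro i
  rw [← rename_eq_subst, h]
  exact der_var hΦ _

theorem wf_succ {Γ : Ctx S (n + 1)} :
    T.Wf Γ ↔ T.Wf Γ.init ∧ T.Der Γ.init (isType (Γ (Fin.last n))) :=
  Fin.forall_fin_succ'

theorem wf_snoc_iff {Γ : Ctx S n} {A : Expr S n} :
    T.Wf (Γ.snoc A) ↔ T.Wf Γ ∧ T.Der Γ (isType A) := by
  rw [wf_succ, Ctx.init_snoc, Ctx.snoc_last]

theorem wf_append_left {Γ : Ctx S n} {Θ : Tel S n m} (h : T.Wf (Γ.append Θ)) : T.Wf Γ := by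
  induction m with
  | zero => rwa [Ctx.append_zero] at h
  | succ m ih => rw [Ctx.append_succ, wf_snoc_iff] at h; exact ih h.1

theorem isMor_append_iff {Φ : Ctx S k} {Γ : Ctx S n} {Θ : Tel S n m} {σ : Fin n → Expr S k}
    {z : Fin m → Expr S k} :
    T.IsMor Φ (Γ.append Θ) (Fin.append σ z) ↔
      T.IsMor Φ Γ σ ∧ ∀ i, T.Der Φ (isElem (z i) ((Θ.typ i).subst (Fin.append σ z))) := by
  rw [isMor_iff, isMor_iff]
  have key : ∀ i : Fin n, ((Γ.typ i).rename (Fin.castAdd m)).subst (Fin.append σ z)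
      = (Γ.typ i).subst σ := fun i => by
    rw [Expr.subst_rename]; simp
  constructor
  · intro h
    refine ⟨fun i => ?_, fun i => ?_⟩
    · have := h (Fin.castAdd m i)
      rwa [Ctx.typ_append_castAdd, Fin.append_left, key] at this
    · have := h (Fin.natAdd n i)
      rwa [Ctx.typ_append_natAdd, Fin.append_right] at this
  · rintro ⟨h1, h2⟩ i
    refine Fin.addCases (fun i => ?_) (fun i => ?_) i
    · rw [Ctx.typ_append_castAdd, Fin.append_left, key]; exact h1 i
    · rw [Ctx.typ_append_natAdd, Fin.append_right]; exact h2 i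

theorem isMor_append {Φ : Ctx S k} {Γ : Ctx S n} {Θ : Tel S n m} {σ : Fin n → Expr S k}
    {z : Fin m → Expr S k} :
    T.IsMor Φ (Γ.append Θ) (Fin.append σ z) ↔ T.IsMor Φ Γ σ ∧ T.IsElemTel Φ (Θ.subst σ) z := by
  rw [isMor_append_iff]
  simp only [PreTheory.IsElemTel, Tel.at_eq]

theorem isMor_snoc {Φ : Ctx S k} {Γ : Ctx S n} {A : Expr S n} {σ : Fin n → Expr S k}
    {a : Expr S k} :
    T.IsMor Φ (Γ.snoc A) (Fin.snoc (α := fun _ => Expr S k) σ a) ↔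
      T.IsMor Φ Γ σ ∧ T.Der Φ (isElem a (A.subst σ)) := by
  rw [isMor_iff, isMor_iff, Fin.forall_fin_succ']
  simp only [Ctx.typ_snoc_castSucc, Ctx.typ_snoc_last, Expr.subst_rename, Fin.snoc_castSucc,
    Fin.snoc_last]

theorem morEq_snoc {Φ : Ctx S k} {Γ : Ctx S n} {A : Expr S n} {σ τ : Fin n → Expr S k}
    {a b : Expr S k} :
    T.MorEq Φ (Γ.snoc A) (Fin.snoc (α := fun _ => Expr S k) σ a)
        (Fin.snoc (α := fun _ => Expr S k) τ b) ↔
      T.MorEq Φ Γ σ τ ∧ T.Der Φ (eqElem a b (A.subst σ)) := by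
  rw [morEq_iff, morEq_iff, Fin.forall_fin_succ']
  simp only [Ctx.typ_snoc_castSucc, Ctx.typ_snoc_last, Expr.subst_rename, Fin.snoc_castSucc,
    Fin.snoc_last]

theorem morEq_append {Φ : Ctx S k} {Γ : Ctx S n} {Θ : Tel S n m} {σ τ : Fin n → Expr S k}
    {z w : Fin m → Expr S k} :
    T.MorEq Φ (Γ.append Θ) (Fin.append σ z) (Fin.append τ w) ↔
      T.MorEq Φ Γ σ τ ∧ T.EqElemTel Φ (Θ.subst σ) z w := by
  simp only [morEq_iff, PreTheory.EqElemTel, Tel.at_eq]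
  have key : ∀ i : Fin n, ((Γ.typ i).rename (Fin.castAdd m)).subst (Fin.append σ z)
      = (Γ.typ i).subst σ := fun i => by
    rw [Expr.subst_rename]; simp
  constructor
  · intro h
    refine ⟨fun i => ?_, fun i => ?_⟩
    · have := h (Fin.castAdd m i)
      rwa [Ctx.typ_append_castAdd, Fin.append_left, Fin.append_left, key] at this
    · have := h (Fin.natAdd n i)
      rwa [Ctx.typ_append_natAdd, Fin.append_right, Fin.append_right] at this
  · rintro ⟨h1, h2⟩ i
    refine Fin.addCases (fun i => ?_) (fun i => ?_) i
    · rw [Ctx.typ_append_castAdd, Fin.append_left, Fin.append_left, key]; exact h1 i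
    · rw [Ctx.typ_append_natAdd, Fin.append_right, Fin.append_right]; exact h2 i

theorem isMor_castAdd {Γ : Ctx S n} {Θ : Tel S n m} (h : T.Wf (Γ.append Θ)) :
    T.IsMor (Γ.append Θ) Γ (fun i => .var (Fin.castAdd m i)) :=
  isMor_ren h _ fun i => (Ctx.typ_append_castAdd Γ Θ i).symm

theorem isMor_castSucc {Γ : Ctx S n} {A : Expr S n} (h : T.Wf (Γ.snoc A)) :
    T.IsMor (Γ.snoc A) Γ (fun i => .var i.castSucc) :=
  isMor_ren h _ fun i => (Ctx.typ_snoc_castSucc Γ A i).symm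

theorem liftSub_one {σ : Fin m → Expr S n} :
    liftSub σ 1 = Fin.snoc (α := fun _ => Expr S (n + 1)) (fun i => (σ i).rename Fin.castSucc)
      (.var (Fin.last n)) := by
  funext i
  refine Fin.lastCases ?_ (fun i => ?_) i
  · rw [Fin.snoc_last]; exact liftSub_natAdd σ 1 0
  · rw [Fin.snoc_castSucc]; exact liftSub_castAdd σ 1 i

theorem liftSub_succ {σ : Fin m → Expr S n} :
    liftSub σ (k + 1) = liftSub (liftSub σ k) 1 := by
  rw [liftSub_one]
  funext i
  refine Fin.lastCases ?_ (fun i => ?_) i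
  · exact (liftSub_natAdd σ (k + 1) (Fin.last k)).trans
      (Fin.snoc_last (α := fun _ => Expr S (n + k + 1)) (.var (Fin.last (n + k))) _).symm
  · refine Eq.trans ?_ (Fin.snoc_castSucc (α := fun _ => Expr S (n + k + 1)) _ _ i).symm
    refine Fin.addCases (fun i => ?_) (fun i => ?_) i
    · rw [liftSub_castAdd, Expr.rename_rename]; exact liftSub_castAdd σ (k + 1) i
    · rw [liftSub_natAdd]; exact liftSub_natAdd σ (k + 1) i.castSucc

theorem isMor_liftSub_one {Δ : Ctx S n} {Γ : Ctx S m} {σ : Fin m → Expr S n} (hΔ : T.Wf Δ)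
    (hσ : T.IsMor Δ Γ σ) {A : Expr S m} (hΓA : T.Wf (Γ.snoc A)) :
    T.Wf (Δ.snoc (A.subst σ)) ∧ T.IsMor (Δ.snoc (A.subst σ)) (Γ.snoc A) (liftSub σ 1) := by
  rw [wf_snoc_iff] at hΓA
  have h1 : T.Wf (Δ.snoc (A.subst σ)) := wf_snoc_iff.2 ⟨hΔ, T.subst hΔ hΓA.1 hσ hΓA.2⟩
  refine ⟨h1, ?_⟩
  rw [liftSub_one, isMor_snoc]
  refine ⟨?_, ?_⟩
  · have := isMor_comp h1 hΔ (isMor_castSucc h1) hσ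
    simpa only [← rename_eq_subst] using this
  · have := der_var h1 (Fin.last n)
    rwa [Ctx.typ_snoc_last, Expr.rename_subst] at this

/-- Well-formedness and the lifted morphism are proved together: each further declaration of `Θ` is
substituted along the morphism already obtained for the earlier ones. -/
theorem wf_append_subst {Δ : Ctx S n} {Γ : Ctx S m} {σ : Fin m → Expr S n} (hΔ : T.Wf Δ)
    (hσ : T.IsMor Δ Γ σ) {Θ : Tel S m k} (hΓΘ : T.Wf (Γ.append Θ)) :
    T.Wf (Δ.append (Θ.subst σ)) ∧
      T.IsMor (Δ.append (Θ.subst σ)) (Γ.append Θ) (liftSub σ k) := by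
  induction k with
  | zero => rw [liftSub_zero]; simpa using ⟨hΔ, hσ⟩
  | succ k ih =>
    rw [Ctx.append_succ] at hΓΘ
    have h := ih (wf_snoc_iff.1 hΓΘ).1
    have h2 := isMor_liftSub_one h.1 h.2 hΓΘ
    rw [← liftSub_succ] at h2
    rw [Ctx.append_succ, Ctx.append_succ Γ]
    exact h2

theorem der_wk_one {Γ : Ctx S n} {A : Expr S n} (h : T.Wf (Γ.snoc A)) {j : Judgement S n}
    (hj : T.Der Γ j) : T.Der (Γ.snoc A) (j.subst (fun i => .var i.castSucc)) :=
  T.subst h (wf_snoc_iff.1 h).1 (isMor_castSucc h) hj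

theorem wf_toTel {Φ : Ctx S n} {Ψ : Ctx S m} (hΦ : T.Wf Φ) (hΨ : T.Wf Ψ) :
    T.Wf (Φ.append (Ψ.toTel n)) ∧
      T.IsMor (Φ.append (Ψ.toTel n)) Ψ (fun i => .var (Fin.natAdd n i)) := by
  have key : T.Wf (Φ.append (Ψ.toTel n)) := by
    induction m with
    | zero => rwa [Ctx.append_zero]
    | succ m ih =>
      rw [wf_succ] at hΨ
      have h := ih hΨ.1
      have h2 : T.IsMor (Φ.append (Ψ.init.toTel n)) Ψ.init (fun i => .var (Fin.natAdd n i)) :=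
        isMor_ren h _ fun i => by rw [Ctx.typ_append_natAdd, Ctx.typ_toTel]
      rw [Ctx.append_succ, wf_snoc_iff]
      refine ⟨h, ?_⟩
      have := T.subst h hΨ.1 h2 hΨ.2
      rw [Judgement.subst, ← rename_eq_subst] at this
      exact this
  exact ⟨key, isMor_ren key _ fun i => by rw [Ctx.typ_append_natAdd, Ctx.typ_toTel]⟩

/-- Identity types respect equality of elements. -/
theorem eqType_Id {Γ : Ctx S n} {A a a' b b' : Expr S n} (hΓ : T.Wf Γ)
    (ha : T.Der Γ (eqElem a a' A)) (hb : T.Der Γ (eqElem b b' A)) :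
    T.Der Γ (eqType (.Id A a b) (.Id A a' b')) := by
  have ha1 := T.presup_eqElem hΓ ha
  have hb1 := T.presup_eqElem hΓ hb
  have hA := T.presup_elem hΓ ha1.1
  have h1 := wf_snoc hΓ hA
  have hA1 := der_wk_one h1 hA
  have h2 := wf_snoc h1 hA1
  have hA2 := der_wk_one h2 hA1
  have hv1 := der_var h2 (Fin.last n).castSucc
  have hv2 := der_var h2 (Fin.last (n + 1))
  simp only [Judgement.subst, ← rename_eq_subst, Ctx.typ_snoc_last, Ctx.typ_snoc_castSucc] at *
  -- The generic identity type over `(Γ, x ∈ A, y ∈ A)`. Congruence is not among the rules for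
  -- identity types; it follows by substituting two equal tuples into this one type.
  have hI := T.id_form h2 hA2 hv1 hv2
  have hid := isMor_id hΓ
  have hrid := morEq_refl hΓ hid
  have hm : ∀ {x y}, T.Der Γ (isElem x A) → T.Der Γ (isElem y A) →
      T.IsMor Γ ((Γ.snoc A).snoc (A.rename Fin.castSucc))
        (Fin.snoc (α := fun _ => Expr S n)
          (Fin.snoc (α := fun _ => Expr S n) (fun i => .var i) x) y) := by
    intro x y hx hy
    rw [isMor_snoc, isMor_snoc, Expr.subst_rename]
    simpa only [Fin.snoc_castSucc, Expr.subst_var] using ⟨⟨hid, hx⟩, hy⟩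
  have he : T.MorEq Γ ((Γ.snoc A).snoc (A.rename Fin.castSucc))
        (Fin.snoc (α := fun _ => Expr S n)
          (Fin.snoc (α := fun _ => Expr S n) (fun i => .var i) a) b)
        (Fin.snoc (α := fun _ => Expr S n)
          (Fin.snoc (α := fun _ => Expr S n) (fun i => .var i) a') b') := by
    rw [morEq_snoc, morEq_snoc, Expr.subst_rename]
    simpa only [Fin.snoc_castSucc, Expr.subst_var] using ⟨⟨hrid, ha⟩, hb⟩
  have := T.subst_eqType hΓ h2 (hm ha1.1 hb1.1) (hm ha1.2 hb1.2) he hI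
  simpa only [Expr.subst_mk_Id, Expr.subst_rename, Fin.snoc_castSucc, Fin.snoc_last,
    Expr.subst_mk_var, Expr.subst_var] using this

end TypeTheory

/-! ## The eliminator at arbitrary elements -/

section
variable {n m k : ℕ}

theorem append_three {α : Type*} (σ : Fin n → α) (a b p : α) :
    Fin.append σ ![a, b, p] = Fin.snoc (α := fun _ => α)
      (Fin.snoc (α := fun _ => α) (Fin.snoc (α := fun _ => α) σ a) b) p := by
  funext i
  refine Fin.lastCases ?_ (fun i => Fin.lastCases ?_ (fun i => Fin.lastCases ?_ (fun i => ?_) i) i) i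
  · rw [Fin.snoc_last]; exact Fin.append_right σ ![a, b, p] 2
  · rw [Fin.snoc_castSucc, Fin.snoc_last]; exact Fin.append_right σ ![a, b, p] 1
  · rw [Fin.snoc_castSucc, Fin.snoc_castSucc, Fin.snoc_last]
    exact Fin.append_right σ ![a, b, p] 0
  · rw [Fin.snoc_castSucc, Fin.snoc_castSucc, Fin.snoc_castSucc]
    exact Fin.append_left σ ![a, b, p] i

theorem append_one {α : Type*} (σ : Fin n → α) (a : α) :
    Fin.append σ ![a] = Fin.snoc (α := fun _ => α) σ a := by
  funext i
  refine Fin.lastCases ?_ (fun i => ?_) i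
  · rw [Fin.snoc_last]; exact Fin.append_right σ ![a] 0
  · rw [Fin.snoc_castSucc]; exact Fin.append_left σ ![a] i

theorem forall_fin_add_three {P : Fin (n + 3) → Prop} :
    (∀ i, P i) ↔ (∀ i : Fin n, P (Fin.castAdd 3 i)) ∧ P (Fin.natAdd n 0) ∧ P (Fin.natAdd n 1) ∧
      P (Fin.natAdd n 2) := by
  constructor
  · exact fun h => ⟨fun i => h _, h _, h _, h _⟩
  · rintro ⟨h0, h1, h2, h3⟩ i
    refine Fin.addCases h0 (fun i => ?_) i
    fin_cases i
    exacts [h1, h2, h3]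

theorem forall_fin_add {P : Fin (n + m) → Prop} :
    (∀ i, P i) ↔ (∀ i : Fin n, P (Fin.castAdd m i)) ∧ ∀ i : Fin m, P (Fin.natAdd n i) :=
  ⟨fun h => ⟨fun _ => h _, fun _ => h _⟩, fun h i => Fin.addCases h.1 h.2 i⟩

theorem append_subst {l : ℕ} (σ : Fin n → Expr S k) (z : Fin m → Expr S k) (τ : Fin k → Expr S l) :
    (fun i => (Fin.append σ z i).subst τ)
      = Fin.append (fun i => (σ i).subst τ) (fun i => (z i).subst τ) := by
  funext i
  refine Fin.addCases (fun i => ?_) (fun i => ?_) i <;> simp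

/-- Naturality of the diagonal `(x, x, r(x))` in the ambient context, needed to pull back the
premise on `d`, which lives over the diagonal. -/
theorem diag_liftSub (A : Expr S n) (σ : Fin n → Expr S k) :
    (fun i => (diag A i).subst (liftSub σ 1))
      = fun i => (liftSub σ 3 i).subst (diag (A.subst σ)) := by
  have h : liftSub σ 1 (Fin.natAdd n 0) = .var (Fin.natAdd k 0) := liftSub_natAdd σ 1 0
  funext i
  revert i
  rw [forall_fin_add_three]
  refine ⟨fun i => ?_, ?_, ?_, ?_⟩
  · rw [liftSub_castAdd, diag, Fin.append_left, Expr.subst_rename, Expr.subst_mk_var,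
      liftSub_castAdd, TypeTheory.rename_eq_subst]
    simp [diag]
  all_goals
    rw [liftSub_natAdd, diag, Fin.append_right, Expr.subst_mk_var, diag, Fin.append_right]
  · exact h
  · exact h
  · simp only [Matrix.cons_val, Expr.subst_mk_refl, Expr.subst_mk_var, h, Expr.subst_rename,
      Expr.rename_subst, liftSub_castAdd]

end

namespace TypeTheory
variable {T : TypeTheory S} {n m k l : ℕ}

variable (T) in
/-- The premises of the elimination rule that do not concern the elements that it is applied to. -/
structure ElimData (Γ : Ctx S n) (A : Expr S n) (Θ : Tel S (n + 3) m) (C : Expr S (n + 3 + m))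
    (d : Expr S (n + 1 + m)) : Prop where
  wf : T.Wf Γ
  isType : T.Der Γ (isType A)
  wfTel : T.Wf ((Γ.idExt A).append Θ)
  isTypeC : T.Der ((Γ.idExt A).append Θ) (.isType C)
  isElem : T.Der ((Γ.snoc A).append (Θ.subst (diag A))) (isElem d (C.subst (liftSub (diag A) m)))

theorem isMor_triple {Γ : Ctx S n} {Δ : Ctx S k} {A : Expr S n} {σ : Fin n → Expr S k}
    {a b p : Expr S k} : T.IsMor Δ (Γ.idExt A) (Fin.append σ ![a, b, p]) ↔
      T.IsMor Δ Γ σ ∧ T.Der Δ (isElem a (A.subst σ)) ∧ T.Der Δ (isElem b (A.subst σ)) ∧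
        T.Der Δ (isElem p (.Id (A.subst σ) a b)) := by
  rw [append_three, Ctx.idExt, isMor_snoc, isMor_snoc, isMor_snoc, Expr.subst_mk_Id,
    Expr.subst_rename, Expr.subst_rename, and_assoc, and_assoc]
  have h1 : (fun i => Fin.snoc (α := fun _ => Expr S k) σ a (Fin.castAdd 1 i)) = σ :=
    funext fun i => Fin.snoc_castSucc (α := fun _ => Expr S k) a σ i
  have h2 : (fun i => Fin.snoc (α := fun _ => Expr S k)
      (Fin.snoc (α := fun _ => Expr S k) σ a) b (Fin.castAdd 2 i)) = σ := by
    funext i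
    refine (Fin.snoc_castSucc (α := fun _ => Expr S k) b _ i.castSucc).trans ?_
    exact Fin.snoc_castSucc (α := fun _ => Expr S k) a σ i
  have h3 : Fin.snoc (α := fun _ => Expr S k) (Fin.snoc (α := fun _ => Expr S k) σ a) b
      (Fin.natAdd n (0 : Fin 2)) = a :=
    (Fin.snoc_castSucc (α := fun _ => Expr S k) b _ (Fin.last n)).trans
      (Fin.snoc_last (α := fun _ => Expr S k) a σ)
  have h4 : Fin.snoc (α := fun _ => Expr S k) (Fin.snoc (α := fun _ => Expr S k) σ a) b
      (Fin.natAdd n (1 : Fin 2)) = b :=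
    Fin.snoc_last (α := fun _ => Expr S k) b _
  rw [h1, h2, Expr.subst_mk_var, Expr.subst_mk_var, h3, h4]

theorem wf_idExt {Γ : Ctx S n} {A : Expr S n} (hΓ : T.Wf Γ) (hA : T.Der Γ (isType A)) :
    T.Wf (Γ.idExt A) := by
  have h1 := wf_snoc hΓ hA
  have h2 := wf_snoc h1 (by simpa only [Judgement.subst, ← rename_eq_subst] using der_wk_one h1 hA)
  refine wf_snoc h2 (T.id_form h2 ?_ ?_ ?_)
  · have := der_wk_one h2 (der_wk_one h1 hA)
    simp only [Judgement.subst, ← rename_eq_subst, Expr.rename_rename] at this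
    exact this
  · have := der_var h2 (Fin.last n).castSucc
    simp only [Ctx.typ_snoc_last, Ctx.typ_snoc_castSucc, Expr.rename_rename] at this
    exact this
  · have := der_var h2 (Fin.last (n + 1))
    simp only [Ctx.typ_snoc_last, Expr.rename_rename] at this
    exact this

theorem isMor_idExt {Γ : Ctx S n} {Δ : Ctx S k} {A : Expr S n} {σ : Fin n → Expr S k}
    (hΔ : T.Wf Δ) (hΓ : T.Wf Γ) (hA : T.Der Γ (isType A)) (hσ : T.IsMor Δ Γ σ) :
    T.Wf (Δ.idExt (A.subst σ)) ∧
      T.IsMor (Δ.idExt (A.subst σ)) (Γ.idExt A) (liftSub σ 3) := by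
  have hA' := T.subst hΔ hΓ hσ hA
  have hw := wf_idExt hΔ hA'
  refine ⟨hw, ?_⟩
  have h : liftSub σ 3 = Fin.append (fun i => (σ i).rename (Fin.castAdd 3))
      ![.var (Fin.natAdd k 0), .var (Fin.natAdd k 1), .var (Fin.natAdd k 2)] := by
    funext i
    revert i
    rw [forall_fin_add_three]
    refine ⟨fun i => ?_, ?_, ?_, ?_⟩
    · rw [liftSub_castAdd, Fin.append_left]
    all_goals rw [liftSub_natAdd, Fin.append_right]; rfl
  have hid := isMor_id hw
  have h' : (fun i => .var i : Fin (k + 3) → Expr S (k + 3))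
      = Fin.append (fun i => .var (Fin.castAdd 3 i))
        ![.var (Fin.natAdd k 0), .var (Fin.natAdd k 1), .var (Fin.natAdd k 2)] := by
    funext i
    revert i
    rw [forall_fin_add_three]
    refine ⟨fun i => ?_, ?_, ?_, ?_⟩
    · rw [Fin.append_left]
    all_goals rw [Fin.append_right]; rfl
  rw [h', isMor_triple] at hid
  rw [h, isMor_triple]
  have e : A.subst (fun i => (σ i).rename (Fin.castAdd 3))
      = (A.subst σ).subst (fun i => .var (Fin.castAdd 3 i)) := by
    rw [Expr.subst_subst]; simp only [rename_eq_subst]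
  rw [e]
  refine ⟨?_, hid.2⟩
  have := isMor_comp hw hΔ hid.1 hσ
  simpa only [← rename_eq_subst] using this

theorem isMor_diag {Γ : Ctx S n} {A : Expr S n} (hΓ : T.Wf Γ) (hA : T.Der Γ (isType A)) :
    T.IsMor (Γ.snoc A) (Γ.idExt A) (diag A) := by
  have h1 := wf_snoc hΓ hA
  have hv := der_var h1 (Fin.last n)
  rw [Ctx.typ_snoc_last, rename_eq_subst] at hv
  rw [diag, isMor_triple]
  refine ⟨isMor_castSucc h1, hv, hv, ?_⟩
  have := T.id_intro h1 hv
  rw [rename_eq_subst]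
  exact this

/-- The rules take the type, the motive and the elements over one and the same context. Pulling the
premises back along `σ` allows `A`, `Θ`, `C`, `d` to stay over `Γ` while they are applied to
elements over any `Δ`, as `ElimData.elim` and `ElimData.comp` do. -/
theorem ElimData.subst {Γ : Ctx S n} {A : Expr S n} {Θ : Tel S (n + 3) m} {C : Expr S (n + 3 + m)}
    {d : Expr S (n + 1 + m)} (h : T.ElimData Γ A Θ C d) {Δ : Ctx S k} {σ : Fin n → Expr S k}
    (hΔ : T.Wf Δ) (hσ : T.IsMor Δ Γ σ) :
    T.ElimData Δ (A.subst σ) (Θ.subst (liftSub σ 3)) (C.subst (liftSub (liftSub σ 3) m))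
      (d.subst (liftSub (liftSub σ 1) m)) := by
  have h1 := isMor_idExt hΔ h.wf h.isType hσ
  have h2 := wf_append_subst h1.1 h1.2 h.wfTel
  have h3 := isMor_liftSub_one hΔ hσ (wf_snoc h.wf h.isType)
  have h4 := wf_append_subst h3.1 h3.2
    (wf_append_subst (wf_snoc h.wf h.isType) (isMor_diag h.wf h.isType) h.wfTel).1
  refine ⟨hΔ, T.subst hΔ h.wf hσ h.isType, h2.1, T.subst h2.1 h.wfTel h2.2 h.isTypeC, ?_⟩
  have h5 := T.subst h4.1 (wf_append_subst (wf_snoc h.wf h.isType)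
    (isMor_diag h.wf h.isType) h.wfTel).1 h4.2 h.isElem
  simp only [Judgement.subst, Tel.subst_subst, Expr.subst_subst, liftSub_liftSub, diag_liftSub]
    at h5 ⊢
  exact h5

section
variable {Γ : Ctx S n} {A : Expr S n} {Θ : Tel S (n + 3) m} {C : Expr S (n + 3 + m)}
    {d : Expr S (n + 1 + m)} {Δ : Ctx S k} {σ : Fin n → Expr S k}

theorem liftSub_triple (σ : Fin n → Expr S k) (a b p : Expr S k) :
    (fun i => (liftSub σ 3 i).subst (triple a b p)) = Fin.append σ ![a, b, p] := by
  rw [triple, append_liftSub]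
  simp only [Expr.subst_var]

theorem ElimData.elim (h : T.ElimData Γ A Θ C d) (hΔ : T.Wf Δ) (hσ : T.IsMor Δ Γ σ)
    {a b p : Expr S k} {z : Fin m → Expr S k} (ha : T.Der Δ (.isElem a (A.subst σ)))
    (hb : T.Der Δ (.isElem b (A.subst σ))) (hp : T.Der Δ (.isElem p (.Id (A.subst σ) a b)))
    (hz : T.IsElemTel Δ (Θ.subst (Fin.append σ ![a, b, p])) z) :
    T.Der Δ (.isElem ((Expr.J (A.subst σ) (Θ.subst (liftSub σ 3))
      (C.subst (liftSub (liftSub σ 3) m)) (d.subst (liftSub (liftSub σ 1) m)) a b p z))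
      (C.subst (Fin.append (Fin.append σ ![a, b, p]) z))) := by
  have h' := h.subst hΔ hσ
  have := T.id_elim hΔ h'.isType h'.wfTel h'.isTypeC h'.isElem ha hb hp (z := z)
    (by rwa [Tel.subst_subst, liftSub_triple])
  rwa [Expr.subst_subst, append_liftSub, liftSub_triple] at this

theorem ElimData.comp (h : T.ElimData Γ A Θ C d) (hΔ : T.Wf Δ) (hσ : T.IsMor Δ Γ σ)
    {a : Expr S k} {z : Fin m → Expr S k} (ha : T.Der Δ (.isElem a (A.subst σ)))
    (hz : T.IsElemTel Δ (Θ.subst (Fin.append σ ![a, a, .refl (A.subst σ) a])) z) :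
    T.Der Δ (.eqElem ((Expr.J (A.subst σ) (Θ.subst (liftSub σ 3))
      (C.subst (liftSub (liftSub σ 3) m)) (d.subst (liftSub (liftSub σ 1) m)) a a
        (.refl (A.subst σ) a) z))
      (d.subst (Fin.append (Fin.append σ ![a]) z))
      (C.subst (Fin.append (Fin.append σ ![a, a, .refl (A.subst σ) a]) z))) := by
  have h' := h.subst hΔ hσ
  have := T.id_comp hΔ h'.isType h'.wfTel h'.isTypeC h'.isElem ha (z := z)
    (by rwa [Tel.subst_subst, liftSub_triple])
  simpa only [Expr.subst_subst, append_liftSub, liftSub_triple, Expr.subst_var] using this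

end
end TypeTheory

/-! ## Identity contexts: variables and types -/

section
variable {n m k : ℕ}

/-- The variables `x` among `x, y, u`. -/
def PX (i : Fin n) : Fin (n + n + n) := Fin.castAdd n (Fin.castAdd n i)
/-- The variables `y` among `x, y, u`. -/
def PY (i : Fin n) : Fin (n + n + n) := Fin.castAdd n (Fin.natAdd n i)
/-- The variables `u` among `x, y, u`. -/
def PU (i : Fin n) : Fin (n + n + n) := Fin.natAdd (n + n) i

/-- Three tuples taken together. -/
def tri {α : Type*} (a b u : Fin n → α) : Fin (n + n + n) → α := Fin.append (Fin.append a b) u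

section
variable {α β : Type*} (a b u : Fin n → α) (z : Fin m → α)

@[simp] theorem tri_PX (i : Fin n) : tri a b u (PX i) = a i := by simp [tri, PX]
@[simp] theorem tri_PY (i : Fin n) : tri a b u (PY i) = b i := by
  rw [tri, PY, Fin.append_left, Fin.append_right]
@[simp] theorem tri_PU (i : Fin n) : tri a b u (PU i) = u i := by simp [tri, PU]

theorem forall_tri {P : Fin (n + n + n) → Prop} :
    (∀ i, P i) ↔ (∀ i, P (PX i)) ∧ (∀ i, P (PY i)) ∧ ∀ i, P (PU i) := by
  rw [forall_fin_add, forall_fin_add, and_assoc]; rfl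

theorem comp_tri (f : α → β) :
    (fun i => f (tri a b u i)) = tri (fun i => f (a i)) (fun i => f (b i)) (fun i => f (u i)) := by
  funext i; revert i; rw [forall_tri]; simp

theorem blocks_eq (x y : Fin n → α) : blocks x y u z = Fin.append (tri x y u) z := rfl

end

theorem X_eq (i : Fin n) : (X i : Fin (n + n + n + m)) = Fin.castAdd m (PX i) := rfl
theorem Y_eq (i : Fin n) : (Y i : Fin (n + n + n + m)) = Fin.castAdd m (PY i) := rfl
theorem U_eq (i : Fin n) : (U i : Fin (n + n + n + m)) = Fin.castAdd m (PU i) := rfl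
theorem Z_eq (i : Fin m) : (Z i : Fin (n + n + n + m)) = Fin.natAdd (n + n + n) i := rfl

/-- `(x ∈ Ψ, y ∈ Ψ, u ∈ Id_Ψ(x, y))`. -/
def Ctx.path (Ψ : Ctx S n) : Ctx S (n + n + n) := (Ψ.append (Ψ.toTel n)).append (idCtx Ψ)

/-- The substitution `(x, x, r(x))`. -/
def diagCtx (Ψ : Ctx S n) : Fin (n + n + n) → Expr S n :=
  tri (fun i => .var i) (fun i => .var i) (reflCtx Ψ)

@[simp] theorem Ctx.typ_path_PX (Ψ : Ctx S n) (i : Fin n) :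
    Ψ.path.typ (PX i) = (Ψ.typ i).rename PX := by
  rw [PX, Ctx.path, Ctx.typ_append_castAdd, Ctx.typ_append_castAdd, Expr.rename_rename]; rfl

@[simp] theorem Ctx.typ_path_PY (Ψ : Ctx S n) (i : Fin n) :
    Ψ.path.typ (PY i) = (Ψ.typ i).rename PY := by
  rw [PY, Ctx.path, Ctx.typ_append_castAdd, Ctx.typ_append_natAdd, Ctx.typ_toTel,
    Expr.rename_rename]; rfl

@[simp] theorem Ctx.typ_path_PU (Ψ : Ctx S n) (i : Fin n) :
    Ψ.path.typ (PU i) = (idCtx Ψ).typ i := by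
  rw [PU, Ctx.path, Ctx.typ_append_natAdd]

/-- The renaming that omits the last variables `x', y', v` of `(x, x'), (y, y'), (u, v)`. -/
def pathWk (n : ℕ) : Fin (n + n + n) → Fin (n + 1 + (n + 1) + (n + 1)) :=
  tri (fun i => PX i.castSucc) (fun i => PY i.castSucc) (fun i => PU i.castSucc)

/-- The `i`-th declaration of an identity context is built from the first `i + 1` declarations of
`Ψ` alone, so dropping the last type of `Ψ` changes the earlier declarations only by weakening. -/
theorem idCtx_init (Ψ : Ctx S (n + 1)) :
    (idCtx Ψ).init = (idCtx Ψ.init).subst (Fin.append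
      (fun i => .var (Fin.castAdd (n + 1) i.castSucc)) (fun i => .var (Fin.natAdd (n + 1) i.castSucc)))
      := by
  have e : Fin.append (fun i => (.var (Fin.castAdd (n + 1) i.castSucc) : Expr S (n + 1 + (n + 1))))
      (fun i => .var (Fin.natAdd (n + 1) i.castSucc)) = fun i => .var (Fin.append
        (fun i : Fin n => Fin.castAdd (n + 1) i.castSucc)
        (fun i : Fin n => Fin.natAdd (n + 1) i.castSucc) i) := by
    funext i; revert i; simp only [forall_fin_add, Fin.append_left, Fin.append_right, implies_true, and_self]
  funext i
  rw [e]
  simp only [Tel.init, Tel.subst, idCtx, liftSub_mk_var, Expr.subst_mk_Id, Expr.subst_rename,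
    Expr.subst_mk_var]
  congr 1
  · rw [TypeTheory.rename_eq_subst]
    refine Expr.subst_congr _ fun j => ?_
    rw [liftRen_castAdd, Fin.append_right]; rfl
  · rw [TypeTheory.rename_eq_subst]
    refine Expr.subst_congr _ fun j => ?_
    revert j
    change ∀ j : Fin (↑i + ↑i + ↑i + 1), _
    simp only [forall_fin_add, blocks, Fin.append_left, Fin.append_right, liftRen_castAdd,
      liftRen_natAdd]
    exact ⟨⟨⟨fun x => congrArg Expr.var ((Fin.append_left _ _ _).trans (Fin.append_left _ _ x)),
      fun x => congrArg Expr.var ((Fin.append_left _ _ _).trans (Fin.append_right _ _ x))⟩,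
      fun x => congrArg Expr.var (Fin.append_right _ _ x)⟩,
      fun x => congrArg Expr.var (Fin.append_right _ _ x)⟩
  · rw [liftRen_castAdd, Fin.append_right]; rfl

theorem idCtx_last (Ψ : Ctx S (n + 1)) :
    idCtx Ψ (Fin.last n) = .Id
      ((Ψ (Fin.last n)).rename (fun i => Fin.castAdd n (Fin.natAdd (n + 1) i.castSucc)))
      ((transport Ψ.init (Ψ (Fin.last n))).rename (Fin.snoc (α := fun _ => Fin (n + 1 + (n + 1) + n))
        (tri (fun i => Fin.castAdd n (Fin.castAdd (n + 1) i.castSucc))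
          (fun i => Fin.castAdd n (Fin.natAdd (n + 1) i.castSucc))
          (fun i => Fin.natAdd (n + 1 + (n + 1)) i))
        (Fin.castAdd n (Fin.castAdd (n + 1) (Fin.last n)))))
      (.var (Fin.castAdd n (Fin.natAdd (n + 1) (Fin.last n)))) := by
  rw [← append_one]
  have : (![Fin.castAdd n (Fin.castAdd (n + 1) (Fin.last n))]) =
    fun _ => Fin.castAdd n (Fin.castAdd (n + 1) (Fin.last n)) := by
    funext i; fin_cases i; rfl
  rw [this]; rfl

theorem typ_idCtx_castSucc (Ψ : Ctx S (n + 1)) (i : Fin n) :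
    (idCtx Ψ).typ i.castSucc = ((idCtx Ψ.init).typ i).rename (pathWk n) := by
  rw [← Tel.snoc_init (idCtx Ψ), Tel.typ_snoc_castSucc, idCtx_init, Tel.typ_subst, TypeTheory.rename_eq_subst,
    TypeTheory.rename_eq_subst, Expr.subst_subst]
  refine Expr.subst_congr _ fun j => ?_
  revert j
  simp only [pathWk, forall_tri, tri_PX, tri_PY, tri_PU]
  simp only [PX, PY, PU, liftSub_castAdd, liftSub_natAdd, Fin.append_left, Fin.append_right,
    Expr.rename_mk_var, Expr.subst_mk_var]
  exact ⟨fun _ => rfl, fun _ => rfl, fun _ => rfl⟩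

theorem typ_idCtx_last (Ψ : Ctx S (n + 1)) :
    (idCtx Ψ).typ (Fin.last n) = .Id
      ((Ψ (Fin.last n)).rename (fun i => PY i.castSucc))
      ((transport Ψ.init (Ψ (Fin.last n))).rename
        (Fin.snoc (α := fun _ => Fin (n + 1 + (n + 1) + (n + 1))) (pathWk n) (PX (Fin.last n))))
      (.var (PY (Fin.last n))) := by
  rw [Tel.typ, idCtx_last, Expr.rename_mk_Id, Expr.rename_rename, Expr.rename_rename]
  congr 1
  refine Expr.rename_congr _ fun j => ?_
  refine Fin.lastCases ?_ (fun j => ?_) j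
  · rw [Fin.snoc_last, Fin.snoc_last]; rfl
  · rw [Fin.snoc_castSucc, Fin.snoc_castSucc]
    revert j
    simp only [pathWk, forall_tri, tri_PX, tri_PY, tri_PU]
    exact ⟨fun _ => rfl, fun _ => rfl, fun _ => rfl⟩

end

/-! ### Paths in a context, and the rules for identity contexts -/

namespace TypeTheory
variable {T : TypeTheory S} {n m k l : ℕ}

theorem isMor_path_iff {Ψ : Ctx S n} {Δ : Ctx S k} {a b u : Fin n → Expr S k} :
    T.IsMor Δ Ψ.path (tri a b u) ↔ T.IsMor Δ Ψ a ∧ T.IsMor Δ Ψ b ∧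
      ∀ i, T.Der Δ (isElem (u i) (((idCtx Ψ).typ i).subst (tri a b u))) := by
  rw [isMor_iff, forall_tri]
  simp only [tri_PX, tri_PY, tri_PU, Ctx.typ_path_PX, Ctx.typ_path_PY, Ctx.typ_path_PU,
    Expr.subst_rename, isMor_iff]

theorem isMor_path_iff' {Ψ : Ctx S n} {Δ : Ctx S k} {a b u : Fin n → Expr S k} :
    T.IsMor Δ Ψ.path (tri a b u) ↔ T.IsMor Δ Ψ a ∧ T.IsMor Δ Ψ b ∧
      T.IsElemTel Δ (idCtxAt Ψ a b) u := by
  rw [isMor_path_iff]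
  simp only [PreTheory.IsElemTel, idCtxAt, Tel.at_eq]; rfl

theorem isMor_succ {Φ : Ctx S k} {Γ : Ctx S (n + 1)} {σ : Fin n → Expr S k}
    {a : Expr S k} :
    T.IsMor Φ Γ (Fin.snoc (α := fun _ => Expr S k) σ a) ↔
      T.IsMor Φ Γ.init σ ∧ T.Der Φ (isElem a ((Γ (Fin.last n)).subst σ)) := by
  rw [← isMor_snoc, Ctx.snoc_init]

theorem tri_snoc_pathWk {α : Type*} (a b u : Fin n → α) (x y v : α) :
    (fun i => tri (Fin.snoc (α := fun _ => α) a x) (Fin.snoc (α := fun _ => α) b y)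
      (Fin.snoc (α := fun _ => α) u v) (pathWk n i)) = tri a b u := by
  rw [pathWk, comp_tri]; simp

/-- The recursive clause for identity contexts, at arbitrary elements: a path between `(a, x)` and
`(b, y)` is a path `u` from `a` to `b` together with an identity from `u_!(x)` to `y`. -/
theorem isMor_path_succ {Ψ : Ctx S (n + 1)} {Δ : Ctx S k} {a b u : Fin n → Expr S k}
    {x y v : Expr S k} :
    T.IsMor Δ Ψ.path (tri (Fin.snoc (α := fun _ => Expr S k) a x)
      (Fin.snoc (α := fun _ => Expr S k) b y) (Fin.snoc (α := fun _ => Expr S k) u v)) ↔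
      T.IsMor Δ Ψ.init.path (tri a b u) ∧ T.Der Δ (isElem x ((Ψ (Fin.last n)).subst a)) ∧
      T.Der Δ (isElem y ((Ψ (Fin.last n)).subst b)) ∧
      T.Der Δ (isElem v (.Id ((Ψ (Fin.last n)).subst b)
        ((transport Ψ.init (Ψ (Fin.last n))).subst
          (Fin.snoc (α := fun _ => Expr S k) (tri a b u) x)) y)) := by
  rw [isMor_path_iff, isMor_path_iff, isMor_succ, isMor_succ, Fin.forall_fin_succ']
  simp only [Fin.snoc_castSucc, Fin.snoc_last, typ_idCtx_castSucc, typ_idCtx_last,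
    Expr.subst_rename, Expr.subst_mk_Id, Expr.subst_mk_var, tri_PY, tri_snoc_pathWk]
  have e : (fun i => tri (Fin.snoc (α := fun _ => Expr S k) a x)
      (Fin.snoc (α := fun _ => Expr S k) b y) (Fin.snoc (α := fun _ => Expr S k) u v)
      (Fin.snoc (α := fun _ => Fin (n + 1 + (n + 1) + (n + 1))) (pathWk n) (PX (Fin.last n)) i))
      = Fin.snoc (α := fun _ => Expr S k) (tri a b u) x := by
    funext i
    refine Fin.lastCases ?_ (fun i => ?_) i
    · simp
    · simp only [Fin.snoc_castSucc]
      exact congrFun (tri_snoc_pathWk a b u x y v) i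
  rw [e]
  tauto

variable (T) in
/-- The rules for identity contexts. -/
structure CtxElim (Ψ : Ctx S n) : Prop where
  wf : T.Wf Ψ.path
  diag : T.IsMor Ψ Ψ.path (diagCtx Ψ)
  elim {m : ℕ} {Θ : Tel S (n + n + n) m} {C : Expr S (n + n + n + m)} {d : Expr S (n + m)}
    (hΘ : T.Wf (Ψ.path.append Θ)) (hC : T.Der (Ψ.path.append Θ) (isType C))
    (hd : T.Der (Ψ.append (Θ.subst (diagCtx Ψ))) (isElem d (C.subst (liftSub (diagCtx Ψ) m)))) :
    T.Der (Ψ.path.append Θ) (isElem (ctxJ n Ψ Θ C d) C)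
  comp {m : ℕ} {Θ : Tel S (n + n + n) m} {C : Expr S (n + n + n + m)} {d : Expr S (n + m)}
    (hΘ : T.Wf (Ψ.path.append Θ)) (hC : T.Der (Ψ.path.append Θ) (isType C))
    (hd : T.Der (Ψ.append (Θ.subst (diagCtx Ψ))) (isElem d (C.subst (liftSub (diagCtx Ψ) m)))) :
    T.Der (Ψ.append (Θ.subst (diagCtx Ψ)))
      (eqElem ((ctxJ n Ψ Θ C d).subst (liftSub (diagCtx Ψ) m)) d (C.subst (liftSub (diagCtx Ψ) m)))

theorem liftSub_one_snoc (σ : Fin n → Expr S m) (τ : Fin m → Expr S k) (z : Expr S k) :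
    (fun i => (liftSub σ 1 i).subst (Fin.snoc (α := fun _ => Expr S k) τ z))
      = Fin.snoc (α := fun _ => Expr S k) (fun i => (σ i).subst τ) z := by
  rw [← append_one, append_liftSub, append_one]

/-! ### Transport along identity contexts -/

section transport
variable {Ψ : Ctx S n} {A : Expr S n}

theorem isMor_PX {Ψ : Ctx S n} (h : T.Wf Ψ.path) : T.IsMor Ψ.path Ψ (fun i => .var (PX i)) :=
  isMor_ren h _ fun i => by simp

theorem isMor_PY {Ψ : Ctx S n} (h : T.Wf Ψ.path) : T.IsMor Ψ.path Ψ (fun i => .var (PY i)) :=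
  isMor_ren h _ fun i => by simp

theorem CtxElim.wf_base (h : T.CtxElim Ψ) : T.Wf Ψ := wf_append_left (wf_append_left h.wf)

/-- The eliminator with one parameter `z ∈ A(x)`, motive `A(y)` and branch `z`. The branch is
well-typed because `A(x)` and `A(y)` both become `A` on the diagonal. All other facts on transport
are substitution instances of these generic ones. -/
theorem CtxElim.transport_aux (h : T.CtxElim Ψ) (hA : T.Der Ψ (isType A)) :
    T.Wf (Ψ.path.snoc (A.rename PX)) ∧
    T.Der (Ψ.path.snoc (A.rename PX)) (isElem (transport Ψ A) (A.rename Y)) ∧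
    T.Der (Ψ.snoc A) (eqElem ((transport Ψ A).subst (liftSub (diagCtx Ψ) 1)) (.var (Fin.last n))
      (A.rename Fin.castSucc)) := by
  have hΨ := h.wf_base
  have hX := T.subst h.wf hΨ (isMor_PX h.wf) hA
  rw [Judgement.subst, ← rename_eq_subst] at hX
  have hw := wf_snoc h.wf hX
  have hY := der_wk_one hw (T.subst h.wf hΨ (isMor_PY h.wf) hA)
  have e1 : Ψ.path.append (fun _ => A.rename X : Tel S (n + n + n) 1)
      = Ψ.path.snoc (A.rename PX) := by
    rw [Ctx.append_succ, Ctx.append_zero]; rfl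
  have e2 : Ψ.append (Tel.subst (fun _ => A.rename X : Tel S (n + n + n) 1) (diagCtx Ψ))
      = Ψ.snoc A := by
    rw [Ctx.append_succ, Ctx.append_zero]
    congr 1
    refine (Expr.subst_rename _ _ _).trans ?_
    conv_rhs => rw [← Expr.subst_var A]
    refine Expr.subst_congr _ fun i => ?_
    exact (congrFun (liftSub_zero (diagCtx Ψ)) (PX i)).trans (tri_PX _ _ _ i)
  have e3 : (A.rename Y).subst (liftSub (diagCtx Ψ) 1) = A.rename Fin.castSucc := by
    rw [Expr.subst_rename, rename_eq_subst]
    refine Expr.subst_congr _ fun i => ?_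
    rw [Y_eq, liftSub_castAdd, diagCtx, tri_PY]; rfl
  have hd := der_var (wf_snoc hΨ hA) (Fin.last n)
  rw [Ctx.typ_snoc_last, ← e3] at hd
  simp only [Judgement.subst, ← rename_eq_subst, Expr.rename_rename] at hY
  have h1 := h.elim (Θ := fun _ => A.rename X) (C := A.rename Y) (d := .var (Fin.natAdd n 0))
    (by rwa [e1]) (by rw [e1]; exact hY) (by rw [e2]; exact hd)
  have h2 := h.comp (Θ := fun _ => A.rename X) (C := A.rename Y) (d := .var (Fin.natAdd n 0))
    (by rwa [e1]) (by rw [e1]; exact hY) (by rw [e2]; exact hd)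
  rw [e1] at h1
  rw [e2, e3] at h2
  exact ⟨hw, h1, h2⟩

theorem CtxElim.transport_elem (h : T.CtxElim Ψ) (hA : T.Der Ψ (isType A)) {Δ : Ctx S k}
    (hΔ : T.Wf Δ) {a b u : Fin n → Expr S k} (hσ : T.IsMor Δ Ψ.path (tri a b u)) {z : Expr S k}
    (hz : T.Der Δ (isElem z (A.subst a))) :
    T.Der Δ (isElem ((transport Ψ A).subst (Fin.snoc (α := fun _ => Expr S k) (tri a b u) z))
      (A.subst b)) := by
  obtain ⟨h1, h2, -⟩ := h.transport_aux hA
  have h3 : T.IsMor Δ (Ψ.path.snoc (A.rename PX))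
      (Fin.snoc (α := fun _ => Expr S k) (tri a b u) z) := by
    rw [isMor_snoc, Expr.subst_rename]
    simpa only [tri_PX] using ⟨hσ, hz⟩
  have h4 := T.subst hΔ h1 h3 h2
  rw [Judgement.subst, Expr.subst_rename] at h4
  have e : (fun i => Fin.snoc (α := fun _ => Expr S k) (tri a b u) z (Y i)) = b := by
    funext i
    exact (Fin.snoc_castSucc (α := fun _ => Expr S k) _ _ (PY i)).trans (tri_PY _ _ _ i)
  rwa [e] at h4

theorem CtxElim.transport_refl (h : T.CtxElim Ψ) (hA : T.Der Ψ (isType A)) {Δ : Ctx S k}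
    (hΔ : T.Wf Δ) {a : Fin n → Expr S k} (ha : T.IsMor Δ Ψ a) {z : Expr S k}
    (hz : T.Der Δ (isElem z (A.subst a))) :
    T.Der Δ (eqElem ((transport Ψ A).subst (Fin.snoc (α := fun _ => Expr S k)
      (tri a a (reflAt Ψ a)) z)) z (A.subst a)) := by
  obtain ⟨-, -, h1⟩ := h.transport_aux hA
  have h2 := T.subst hΔ (wf_snoc h.wf_base hA) (isMor_snoc.2 ⟨ha, hz⟩) h1
  simp only [Judgement.subst, Expr.subst_rename, Fin.snoc_castSucc, Expr.subst_subst,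
    Expr.subst_mk_var, Fin.snoc_last, liftSub_one_snoc] at h2
  rw [diagCtx, comp_tri (f := fun e : Expr S n => e.subst a)] at h2
  exact h2

end transport

end TypeTheory

/-! ## The rules for identity contexts -/

section
variable {n m k l : ℕ}

theorem snoc_eta {α : Type*} (σ : Fin (n + 1) → α) :
    Fin.snoc (α := fun _ => α) (fun i => σ i.castSucc) (σ (Fin.last n)) = σ := by
  funext i
  refine Fin.lastCases ?_ (fun i => ?_) i <;> simp

theorem comp_snoc {α β : Type*} (f : α → β) (σ : Fin n → α) (a : α) :
    (fun i => f (Fin.snoc (α := fun _ => α) σ a i))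
      = Fin.snoc (α := fun _ => β) (fun i => f (σ i)) (f a) := by
  funext i
  refine Fin.lastCases ?_ (fun i => ?_) i <;> simp

theorem comp_append {α β : Type*} (f : α → β) (σ : Fin n → α) (τ : Fin m → α) :
    (fun i => f (Fin.append σ τ i)) = Fin.append (fun i => f (σ i)) (fun i => f (τ i)) := by
  funext i
  refine Fin.addCases (fun i => ?_) (fun i => ?_) i <;> simp

/-- `(a, x), (a, y), (1_a, v)`. -/
def nearDiag (Ψ : Ctx S n) (a : Fin n → Expr S k) (x y v : Expr S k) :
    Fin (n + 1 + (n + 1) + (n + 1)) → Expr S k :=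
  tri (Fin.snoc (α := fun _ => Expr S k) a x) (Fin.snoc (α := fun _ => Expr S k) a y)
    (Fin.snoc (α := fun _ => Expr S k) (reflAt Ψ a) v)

theorem reflAt_subst (Ψ : Ctx S n) (a : Fin n → Expr S k) (τ : Fin k → Expr S l) (i : Fin n) :
    (reflAt Ψ a i).subst τ = reflAt Ψ (fun i => (a i).subst τ) i := by
  rw [reflAt, Expr.subst_subst]; rfl

theorem nearDiag_subst (Ψ : Ctx S n) (a : Fin n → Expr S k) (x y v : Expr S k)
    (τ : Fin k → Expr S l) :
    (fun i => (nearDiag Ψ a x y v i).subst τ) =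
      nearDiag Ψ (fun i => (a i).subst τ) (x.subst τ) (y.subst τ) (v.subst τ) := by
  unfold nearDiag
  rw [comp_tri (f := fun e : Expr S k => e.subst τ), comp_snoc (f := fun e : Expr S k => e.subst τ),
    comp_snoc (f := fun e : Expr S k => e.subst τ), comp_snoc (f := fun e : Expr S k => e.subst τ)]
  simp only [reflAt_subst]

theorem reflCtx_last (Ψ : Ctx S (n + 1)) : reflCtx Ψ (Fin.last n) =
    .refl ((Ψ (Fin.last n)).rename Fin.castSucc) (.var (Fin.last n)) := rfl

theorem reflCtx_castSucc (Ψ : Ctx S (n + 1)) (i : Fin n) : reflCtx Ψ i.castSucc =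
    reflAt Ψ.init (fun j => .var j.castSucc) i := by
  rw [reflAt, ← TypeTheory.rename_eq_subst]
  simp only [reflCtx, Expr.rename_mk_refl, Expr.rename_rename]; rfl

/-- The diagonal is reached in two stages: setting `u` to `1` leaves `x', y'` and an identity `v`
free, and then `y' = x'`, `v = r(x')`. The two stages match the two nested eliminations in `ctxJ`.
-/
theorem diagCtx_succ (Ψ : Ctx S (n + 1)) : diagCtx Ψ = nearDiag Ψ.init (fun i => .var i.castSucc)
    (.var (Fin.last n)) (.var (Fin.last n))
    (.refl ((Ψ (Fin.last n)).rename Fin.castSucc) (.var (Fin.last n))) := by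
  rw [diagCtx, nearDiag]
  rw [← snoc_eta (reflCtx Ψ), ← snoc_eta (fun i : Fin (n + 1) => (.var i : Expr S (n + 1)))]
  simp only [reflCtx_castSucc, reflCtx_last]

theorem diagCtx_subst (Ψ : Ctx S n) (a : Fin n → Expr S k) :
    (fun i => (diagCtx Ψ i).subst a) = tri a a (reflAt Ψ a) := by
  rw [diagCtx, comp_tri (f := fun e : Expr S n => e.subst a)]; rfl

/-- The dependent context `(x' ∈ A(x), y' ∈ A(y), v ∈ Id_{A(y)}(u_!(x'), y'), z ∈ Θ)`. -/
def ctxJTel (Ψ : Ctx S (n + 1)) (Θ : Tel S (n + 1 + (n + 1) + (n + 1)) m) :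
    Tel S (n + n + n) (3 + m) :=
  Fin.addCases (motive := fun i : Fin (3 + m) => Expr S (n + n + n + i))
    (fun i : Fin 3 => match i with
      | 0 => (Ψ (Fin.last n)).rename (X (m := 0))
      | 1 => (Ψ (Fin.last n)).rename (Y (m := 1))
      | 2 => .Id ((Ψ (Fin.last n)).rename (Y (m := 2)))
          ((transport Ψ.init (Ψ (Fin.last n))).rename (Fin.castAdd 1)) (.var (Z (m := 2) 1)))
    (fun i => (Θ i).rename (shuffle n i))

/-- `(x, x', y', v)` as a substitution for `(x, x'), (y, y'), (u, v)`. -/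
def elimSub (Ψ : Ctx S n) : Fin (n + 1 + (n + 1) + (n + 1)) → Expr S (n + 3) :=
  nearDiag Ψ (fun i => .var (Fin.castAdd 3 i)) (.var (Fin.natAdd n 0)) (.var (Fin.natAdd n 1))
    (.var (Fin.natAdd n 2))

/-- The eliminating family in the recursive definition of the eliminator of identity contexts. -/
def ctxJBranch (Ψ : Ctx S (n + 1)) (Θ : Tel S (n + 1 + (n + 1) + (n + 1)) m)
    (C : Expr S (n + 1 + (n + 1) + (n + 1) + m)) (d : Expr S (n + 1 + m)) :
    Expr S (n + (3 + m)) :=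
  let σ : Fin n → Expr S (n + (3 + m)) := fun i => .var (Fin.castAdd (3 + m) i)
  .J ((Ψ (Fin.last n)).subst σ) ((Θ.subst (elimSub Ψ.init)).subst (liftSub σ 3))
    ((C.subst (liftSub (elimSub Ψ.init) m)).subst (liftSub (liftSub σ 3) m))
    (d.subst (liftSub (liftSub σ 1) m))
    (.var (Fin.natAdd n (Fin.castAdd m 0))) (.var (Fin.natAdd n (Fin.castAdd m 1)))
    (.var (Fin.natAdd n (Fin.castAdd m 2))) (fun t => .var (Fin.natAdd n (Fin.natAdd 3 t)))

/-- The definition writes the eliminating family out in variables. Here it becomes an instance of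
`J` for data over `Ψ.init`, pulled back along a weakening, which is the shape produced by
`ElimData.elim`. -/
theorem ctxJ_succ (Ψ : Ctx S (n + 1)) (Θ : Tel S (n + 1 + (n + 1) + (n + 1)) m)
    (C : Expr S (n + 1 + (n + 1) + (n + 1) + m)) (d : Expr S (n + 1 + m)) :
    ctxJ (n + 1) Ψ Θ C d = (ctxJ n Ψ.init (ctxJTel Ψ Θ) (C.rename (shuffle n m))
      (ctxJBranch Ψ Θ C d)).rename (unshuffle n m) := by
  -- The explicit substitution `at'` in the definition of `ctxJ` is `elimSub`, weakened and lifted.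
  -- The number `j` is free because the `j`-th declaration of `Θ` lies over `j` earlier parameters.
  have key : ∀ j, liftSub (fun i => (elimSub Ψ.init i).subst
      (liftSub (fun i : Fin n => (.var (Fin.castAdd (3 + m) i) : Expr S (n + (3 + m)))) 3)) j
      = blocks
        (Fin.snoc (α := fun _ => Expr S (n + (3 + m) + 3 + j))
          (fun i => .var (Fin.castAdd j (Fin.castAdd 3 (Fin.castAdd (3 + m) i))))
            (.var (Fin.castAdd j (Fin.natAdd _ 0))))
        (Fin.snoc (α := fun _ => Expr S (n + (3 + m) + 3 + j))
          (fun i => .var (Fin.castAdd j (Fin.castAdd 3 (Fin.castAdd (3 + m) i))))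
            (.var (Fin.castAdd j (Fin.natAdd _ 1))))
        (Fin.snoc (α := fun _ => Expr S (n + (3 + m) + 3 + j))
          (fun i => (reflCtx Ψ.init i).rename
            (fun t => Fin.castAdd j (Fin.castAdd 3 (Fin.castAdd (3 + m) t))))
          (.var (Fin.castAdd j (Fin.natAdd _ 2))))
        (fun t => .var (Fin.natAdd _ t)) := by
    intro j
    rw [elimSub, nearDiag_subst, blocks_eq]
    funext i
    revert i
    simp only [forall_fin_add (n := n + 1 + (n + 1) + (n + 1)), forall_tri (n := n + 1),
      Fin.forall_fin_succ' (n := n), nearDiag, liftSub_castAdd,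
      liftSub_natAdd, Fin.append_left, Fin.append_right, tri_PX, tri_PY, tri_PU,
      Fin.snoc_castSucc, Fin.snoc_last, Expr.subst_mk_var, Expr.rename_mk_var, implies_true,
      and_true, true_and, reflAt, Expr.rename_subst]
    intro i
    rw [TypeTheory.rename_eq_subst]
  have kd : liftSub (liftSub
      (fun i : Fin n => (.var (Fin.castAdd (3 + m) i) : Expr S (n + (3 + m)))) 1) m =
      fun i => .var (Fin.append
          (Fin.snoc (α := fun _ => Fin (n + (3 + m) + 1 + m))
            (fun i : Fin n => Fin.castAdd m (Fin.castAdd 1 (Fin.castAdd (3 + m) i)))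
              (Fin.castAdd m (Fin.natAdd _ 0)))
          (fun t => Fin.natAdd _ t) i) := by
    rw [TypeTheory.liftSub_one]
    funext i
    revert i
    simp only [forall_fin_add (n := n + 1), Fin.forall_fin_succ' (n := n), liftSub_castAdd,
      liftSub_natAdd, Fin.append_left, Fin.append_right, Fin.snoc_castSucc, Fin.snoc_last,
      Expr.rename_mk_var, implies_true, and_true]
    exact ⟨fun _ => rfl, rfl⟩
  have kT : Θ.subst (fun i => (elimSub Ψ.init i).subst
      (liftSub (fun i : Fin n => (.var (Fin.castAdd (3 + m) i) : Expr S (n + (3 + m)))) 3)) =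
      fun i => _ := funext fun i => congrArg (Θ i).subst (key i)
  have kA : (Ψ (Fin.last n)).subst
      (fun i : Fin n => (.var (Fin.castAdd (3 + m) i) : Expr S (n + (3 + m)))) =
      (Ψ (Fin.last n)).rename (Fin.castAdd (3 + m)) := (TypeTheory.rename_eq_subst _ _).symm
  unfold ctxJBranch
  simp only [Tel.subst_subst, Expr.subst_subst, liftSub_liftSub, kd, kT, key, kA]
  simp only [← TypeTheory.rename_eq_subst]
  rfl

end

/-! ### The reordering of variables respects types -/

section
variable {n m k l : ℕ}

theorem shuffle_eq (n m : ℕ) : shuffle n m = Fin.append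
    (tri (Fin.snoc (α := fun _ => Fin (n + n + n + (3 + m))) X (Z (Fin.castAdd m 0)))
      (Fin.snoc (α := fun _ => Fin (n + n + n + (3 + m))) Y (Z (Fin.castAdd m 1)))
      (Fin.snoc (α := fun _ => Fin (n + n + n + (3 + m))) U (Z (Fin.castAdd m 2))))
    (fun t => Z (Fin.natAdd 3 t)) := rfl

theorem unshuffle_eq (n m : ℕ) : unshuffle n m = Fin.append
    (fun i => Fin.castAdd m (pathWk n i))
    (Fin.append ![X (Fin.last n), Y (Fin.last n), U (Fin.last n)] Z) := by
  rw [pathWk, comp_tri]; rfl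

theorem forall_fin_three {P : Fin 3 → Prop} : (∀ i, P i) ↔ P 0 ∧ P 1 ∧ P 2 :=
  ⟨fun h => ⟨h _, h _, h _⟩, fun h i => by fin_cases i; exacts [h.1, h.2.1, h.2.2]⟩

theorem forall_path_succ {P : Fin (n + 1 + (n + 1) + (n + 1) + m) → Prop} :
    (∀ i, P i) ↔ (∀ i, P (Fin.castAdd m (pathWk n i))) ∧
      (P (X (Fin.last n)) ∧ P (Y (Fin.last n)) ∧ P (U (Fin.last n))) ∧ ∀ i, P (Z i) := by
  simp only [forall_fin_add (n := n + 1 + (n + 1) + (n + 1)), forall_tri (n := n + 1),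
    forall_tri (n := n), Fin.forall_fin_succ' (n := n), pathWk, tri_PX, tri_PY, tri_PU, X_eq, Y_eq,
    U_eq, Z_eq]
  tauto

theorem forall_ctxJTel {P : Fin (n + n + n + (3 + m)) → Prop} :
    (∀ i, P i) ↔ (∀ i, P (Fin.castAdd (3 + m) i)) ∧
      (P (Z (Fin.castAdd m 0)) ∧ P (Z (Fin.castAdd m 1)) ∧ P (Z (Fin.castAdd m 2))) ∧
      ∀ i, P (Z (Fin.natAdd 3 i)) := by
  simp only [forall_fin_add (n := n + n + n), forall_fin_add (n := 3), forall_fin_three, Z_eq]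

@[simp] theorem shuffle_pathWk (i : Fin (n + n + n)) :
    shuffle n m (Fin.castAdd m (pathWk n i)) = Fin.castAdd (3 + m) i := by
  rw [shuffle_eq, Fin.append_left]
  revert i
  simp only [forall_tri, pathWk, tri_PX, tri_PY, tri_PU, Fin.snoc_castSucc]
  exact ⟨fun _ => rfl, fun _ => rfl, fun _ => rfl⟩

@[simp] theorem shuffle_X : shuffle n m (X (Fin.last n)) = Z (Fin.castAdd m 0) := by
  rw [shuffle_eq, X_eq, Fin.append_left, tri_PX, Fin.snoc_last]

@[simp] theorem shuffle_Y : shuffle n m (Y (Fin.last n)) = Z (Fin.castAdd m 1) := by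
  rw [shuffle_eq, Y_eq, Fin.append_left, tri_PY, Fin.snoc_last]

@[simp] theorem shuffle_U : shuffle n m (U (Fin.last n)) = Z (Fin.castAdd m 2) := by
  rw [shuffle_eq, U_eq, Fin.append_left, tri_PU, Fin.snoc_last]

@[simp] theorem shuffle_Z (i : Fin m) : shuffle n m (Z i) = Z (Fin.natAdd 3 i) := by
  rw [shuffle_eq]
  exact Fin.append_right _ _ i

@[simp] theorem unshuffle_castAdd (i : Fin (n + n + n)) :
    unshuffle n m (Fin.castAdd (3 + m) i) = Fin.castAdd m (pathWk n i) := by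
  rw [unshuffle_eq, Fin.append_left]

@[simp] theorem unshuffle_Z_zero : unshuffle n m (Z (Fin.castAdd m 0)) = X (Fin.last n) := by
  rw [unshuffle_eq, Z_eq, Fin.append_right, Fin.append_left]; rfl

@[simp] theorem unshuffle_Z_one : unshuffle n m (Z (Fin.castAdd m 1)) = Y (Fin.last n) := by
  rw [unshuffle_eq, Z_eq, Fin.append_right, Fin.append_left]; rfl

@[simp] theorem unshuffle_Z_two : unshuffle n m (Z (Fin.castAdd m 2)) = U (Fin.last n) := by
  rw [unshuffle_eq, Z_eq, Fin.append_right, Fin.append_left]; rfl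

@[simp] theorem unshuffle_Z_natAdd (i : Fin m) : unshuffle n m (Z (Fin.natAdd 3 i)) = Z i := by
  rw [unshuffle_eq, Z_eq, Fin.append_right, Fin.append_right]

@[simp] theorem unshuffle_shuffle (i : Fin (n + 1 + (n + 1) + (n + 1) + m)) :
    unshuffle n m (shuffle n m i) = i := by
  revert i
  simp [forall_path_succ]

@[simp] theorem shuffle_unshuffle (i : Fin (n + n + n + (3 + m))) :
    shuffle n m (unshuffle n m i) = i := by
  revert i
  simp only [forall_ctxJTel, unshuffle_castAdd, unshuffle_Z_zero, unshuffle_Z_one,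
    unshuffle_Z_two, unshuffle_Z_natAdd, shuffle_pathWk, shuffle_X, shuffle_Y, shuffle_U,
    shuffle_Z, implies_true, and_self]

variable (Ψ : Ctx S (n + 1)) (Θ : Tel S (n + 1 + (n + 1) + (n + 1)) m)

theorem typ_ctxJTel_zero :
    (ctxJTel Ψ Θ).typ (Fin.castAdd m 0) = Expr.rename (n := n) (Ψ (Fin.last n)) X := by
  unfold Tel.typ ctxJTel
  rw [Fin.addCases_left]
  exact Expr.rename_rename _ _ _

theorem typ_ctxJTel_one :
    (ctxJTel Ψ Θ).typ (Fin.castAdd m 1) = Expr.rename (n := n) (Ψ (Fin.last n)) Y := by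
  unfold Tel.typ ctxJTel
  rw [Fin.addCases_left]
  exact Expr.rename_rename _ _ _

theorem typ_ctxJTel_two :
    (ctxJTel Ψ Θ).typ (Fin.castAdd m 2) = .Id (Expr.rename (n := n) (Ψ (Fin.last n)) Y)
      ((transport Ψ.init (Ψ (Fin.last n))).rename
        (Fin.snoc (α := fun _ => Fin (n + n + n + (3 + m))) (Fin.castAdd (3 + m))
          (Z (Fin.castAdd m 0)))) (.var (Z (Fin.castAdd m 1))) := by
  unfold Tel.typ ctxJTel
  rw [Fin.addCases_left]
  refine (Expr.rename_mk_Id _ _ _ _).trans ?_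
  rw [Expr.rename_rename, Expr.rename_rename]
  congr 1
  refine Expr.rename_congr _ fun i => ?_
  refine Fin.lastCases ?_ (fun i => ?_) i
  · rw [Fin.snoc_last]; rfl
  · rw [Fin.snoc_castSucc]; rfl

theorem typ_ctxJTel_natAdd (i : Fin m) :
    (ctxJTel Ψ Θ).typ (Fin.natAdd 3 i) = (Θ.typ i).rename (shuffle n m) := by
  unfold Tel.typ ctxJTel
  rw [Fin.addCases_right]
  refine (Expr.rename_rename _ _ _).trans ?_
  rw [Expr.rename_rename]
  refine Expr.rename_congr _ fun j => ?_
  revert j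
  simp only [forall_path_succ, shuffle_pathWk, shuffle_X, shuffle_Y, shuffle_U, shuffle_Z]
  exact ⟨fun j => (shuffle_pathWk (m := m) j).symm,
    ⟨(shuffle_X (m := m)).symm, (shuffle_Y (m := m)).symm, (shuffle_U (m := m)).symm⟩,
    fun j => (shuffle_Z (n := n) (Fin.castLE i.2.le j)).symm⟩

theorem ctxJTel_init (Θ : Tel S (n + 1 + (n + 1) + (n + 1)) (m + 1)) :
    (ctxJTel Ψ Θ).init = ctxJTel Ψ Θ.init := by
  funext i
  refine Fin.addCases (fun i => ?_) (fun i => ?_) i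
  · change ctxJTel Ψ Θ (Fin.castAdd (m + 1) i) = _
    unfold ctxJTel
    rw [Fin.addCases_left, Fin.addCases_left]; rfl
  · change ctxJTel Ψ Θ (Fin.natAdd 3 i.castSucc) = _
    unfold ctxJTel
    rw [Fin.addCases_right, Fin.addCases_right]; rfl

theorem ctxJTel_last (Θ : Tel S (n + 1 + (n + 1) + (n + 1)) (m + 1)) :
    ctxJTel Ψ Θ (Fin.last (3 + m)) = (Θ (Fin.last m)).rename (shuffle n m) :=
  Fin.addCases_right (motive := fun i : Fin (3 + (m + 1)) => Expr S (n + n + n + i)) (Fin.last m)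

theorem typ_path_succ (i : Fin (n + n + n)) :
    Ψ.path.typ (pathWk n i) = (Ψ.init.path.typ i).rename (pathWk n) := by
  revert i
  simp only [forall_tri, Ctx.typ_path_PX, Ctx.typ_path_PY, Ctx.typ_path_PU, Expr.rename_rename]
  simp only [pathWk, tri_PX, tri_PY, tri_PU, Ctx.typ_path_PX, Ctx.typ_path_PY, Ctx.typ_path_PU,
    Ctx.typ_castSucc, Expr.rename_rename, typ_idCtx_castSucc, implies_true, and_self]

/-- The contexts `(Ψ.path, Θ)` and `(Ψ.init.path, ctxJTel Ψ Θ)` declare the same types in a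
different order. Compatibility with types makes the two renamings mutually inverse context
morphisms, so judgements pass freely between them. -/
theorem typ_shuffle (i : Fin (n + 1 + (n + 1) + (n + 1) + m)) :
    ((Ψ.path.append Θ).typ i).rename (shuffle n m)
      = (Ψ.init.path.append (ctxJTel Ψ Θ)).typ (shuffle n m i) := by
  have hX : ∀ i : Fin n, shuffle n m (Fin.castAdd m (PX i.castSucc)) = X i := fun i => by
    have := shuffle_pathWk (m := m) (PX i)
    rwa [pathWk, tri_PX] at this
  have hY : ∀ i : Fin n, shuffle n m (Fin.castAdd m (PY i.castSucc)) = Y i := fun i => by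
    have := shuffle_pathWk (m := m) (PY i)
    rwa [pathWk, tri_PY] at this
  revert i
  rw [forall_path_succ]
  refine ⟨fun i => ?_, ⟨?_, ?_, ?_⟩, fun i => ?_⟩
  · rw [Ctx.typ_append_castAdd, typ_path_succ, shuffle_pathWk, Ctx.typ_append_castAdd,
      Expr.rename_rename, Expr.rename_rename]
    simp only [shuffle_pathWk]
  · rw [shuffle_X, Z_eq, Ctx.typ_append_natAdd, typ_ctxJTel_zero, X_eq, Ctx.typ_append_castAdd,
      Ctx.typ_path_PX, Ctx.typ_last, Expr.rename_rename, Expr.rename_rename, Expr.rename_rename]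
    exact Expr.rename_congr _ hX
  · rw [shuffle_Y, Z_eq, Ctx.typ_append_natAdd, typ_ctxJTel_one, Y_eq, Ctx.typ_append_castAdd,
      Ctx.typ_path_PY, Ctx.typ_last, Expr.rename_rename, Expr.rename_rename, Expr.rename_rename]
    exact Expr.rename_congr _ hY
  · rw [shuffle_U, Z_eq, Ctx.typ_append_natAdd, typ_ctxJTel_two, U_eq, Ctx.typ_append_castAdd,
      Ctx.typ_path_PU, typ_idCtx_last]
    simp only [Expr.rename_mk_Id, Expr.rename_rename, Expr.rename_mk_var]
    congr 1
    · exact Expr.rename_congr _ hY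
    · refine Expr.rename_congr _ fun i => ?_
      refine Fin.lastCases ?_ (fun i => ?_) i
      · simp only [Fin.snoc_last]; exact shuffle_X
      · simp only [Fin.snoc_castSucc, shuffle_pathWk]
    · exact congrArg _ shuffle_Y
  · rw [shuffle_Z, Z_eq, Z_eq, Ctx.typ_append_natAdd, Ctx.typ_append_natAdd, typ_ctxJTel_natAdd]

theorem typ_unshuffle (i : Fin (n + n + n + (3 + m))) :
    ((Ψ.init.path.append (ctxJTel Ψ Θ)).typ i).rename (unshuffle n m)
      = (Ψ.path.append Θ).typ (unshuffle n m i) := by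
  obtain ⟨i, rfl⟩ : ∃ j, i = shuffle n m j := ⟨_, (shuffle_unshuffle i).symm⟩
  rw [← typ_shuffle, Expr.rename_rename, unshuffle_shuffle]
  simp only [unshuffle_shuffle, Expr.rename_id]

end

/-! ### The induction step for the rules of identity contexts -/

namespace TypeTheory
variable {T : TypeTheory S} {n m k l : ℕ}

theorem isMor_init {Ψ : Ctx S (n + 1)} (h : T.Wf Ψ) :
    T.IsMor Ψ Ψ.init (fun i => .var i.castSucc) :=
  isMor_ren h _ fun i => (Ctx.typ_castSucc Ψ i).symm

/-- All declarations of `Id_Ψ` but the last are pulled back along the map forgetting the last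
components. The last one is an identity type in `A(y)`; it makes sense because `u_!(x') ∈ A(y)`,
which is where the elimination rule for the shorter context enters. -/
theorem wf_path_succ {Ψ : Ctx S (n + 1)} (h : T.CtxElim Ψ.init) (hΨ : T.Wf Ψ) :
    T.Wf Ψ.path := by
  have hΨ' := wf_succ.1 hΨ
  have hb := wf_toTel hΨ hΨ
  have e : Fin.append (fun i => (.var (Fin.castAdd (n + 1) i.castSucc) : Expr S (n + 1 + (n + 1))))
      (fun i => .var (Fin.natAdd (n + 1) i.castSucc)) = fun i => .var (Fin.append
        (fun i : Fin n => Fin.castAdd (n + 1) i.castSucc)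
        (fun i : Fin n => Fin.natAdd (n + 1) i.castSucc) i) :=
    (comp_append (f := fun i => (.var i : Expr S (n + 1 + (n + 1)))) _ _).symm
  have h1 : T.IsMor (Ψ.append (Ψ.toTel (n + 1))) (Ψ.init.append (Ψ.init.toTel n))
      (Fin.append (fun i => .var (Fin.castAdd (n + 1) i.castSucc))
        (fun i => .var (Fin.natAdd (n + 1) i.castSucc))) := by
    rw [e]
    refine isMor_ren hb.1 _ ?_
    rw [forall_fin_add]
    simp only [Fin.append_left, Fin.append_right, Ctx.typ_append_castAdd, Ctx.typ_append_natAdd,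
      Ctx.typ_toTel, Expr.rename_rename, Ctx.typ_castSucc, implies_true, and_self]
  have h2 := wf_append_subst hb.1 h1 (Θ := idCtx Ψ.init) h.wf
  rw [← idCtx_init] at h2
  rw [Ctx.path, Ctx.append_succ, wf_snoc_iff, idCtx_last]
  refine ⟨h2.1, ?_⟩
  have hb2 := isMor_comp h2.1 hb.1 (isMor_castAdd h2.1) hb.2
  have hA := T.subst h2.1 hΨ'.1 (isMor_comp h2.1 hΨ hb2 (isMor_init hΨ)) hΨ'.2
  have hy := T.subst h2.1 hΨ hb2 (der_var hΨ (Fin.last n))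
  have hx := T.subst h2.1 hΨ (isMor_comp h2.1 hb.1 (isMor_castAdd h2.1) (isMor_castAdd hb.1))
    (der_var hΨ (Fin.last n))
  simp only [Judgement.subst, Ctx.typ_last, ← rename_eq_subst, Expr.rename_rename,
    Expr.rename_mk_var] at hA hy hx
  have ht := h.transport_elem (n := n) (A := Ψ (Fin.last n)) hΨ'.2 h2.1
    (a := fun i => .var (Fin.castAdd n (Fin.castAdd (n + 1) i.castSucc)))
    (b := fun i => .var (Fin.castAdd n (Fin.natAdd (n + 1) i.castSucc)))
    (u := fun i => .var (Fin.natAdd (n + 1 + (n + 1)) i))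
    (z := .var (Fin.castAdd n (Fin.castAdd (n + 1) (Fin.last n)))) (by
      refine (congrArg (T.IsMor _ Ψ.init.path) ?_).mpr h2.2
      funext i
      revert i
      simp only [forall_tri, tri_PX, tri_PY, tri_PU]
      simp only [PX, PY, PU, liftSub_castAdd, liftSub_natAdd, Fin.append_left, Fin.append_right,
        Expr.rename_mk_var, implies_true, and_self]) (by
      rw [← rename_eq_subst]; exact hx)
  refine T.id_form h2.1 ?_ ?_ hy
  · exact hA
  · rw [← rename_eq_subst] at ht
    rw [rename_eq_subst (transport _ _), comp_snoc (f := fun i => (.var i : Expr S _)),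
      comp_tri (f := fun i => (.var i : Expr S _))]
    exact ht

/-- Over `u = 1` transport computes, so an identity between `x` and `y` has the type `Id(1_!(x), y)`
that the path context asks for, by conversion. -/
theorem isMor_nearDiag {Ψ : Ctx S (n + 1)} (h : T.CtxElim Ψ.init) (hΨ : T.Wf Ψ) {Δ : Ctx S k}
    (hΔ : T.Wf Δ) {a : Fin n → Expr S k} {x y v : Expr S k} (ha : T.IsMor Δ Ψ.init a)
    (hx : T.Der Δ (isElem x ((Ψ (Fin.last n)).subst a)))
    (hy : T.Der Δ (isElem y ((Ψ (Fin.last n)).subst a)))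
    (hv : T.Der Δ (isElem v (.Id ((Ψ (Fin.last n)).subst a) x y))) :
    T.IsMor Δ Ψ.path (nearDiag Ψ.init a x y v) := by
  rw [nearDiag, isMor_path_succ]
  have hΨ' := wf_succ.1 hΨ
  refine ⟨?_, hx, hy, ?_⟩
  · have := isMor_comp hΔ hΨ'.1 ha h.diag
    rwa [diagCtx_subst] at this
  · refine T.conv_elem hΔ hv (eqType_Id hΔ ?_ (T.eqElem_refl hΔ hy))
    exact T.eqElem_symm hΔ (h.transport_refl hΨ'.2 hΔ ha hx)

theorem isMor_diagCtx_succ {Ψ : Ctx S (n + 1)} (h : T.CtxElim Ψ.init) (hΨ : T.Wf Ψ) :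
    T.IsMor Ψ Ψ.path (diagCtx Ψ) := by
  rw [diagCtx_succ]
  have hx := der_var hΨ (Fin.last n)
  rw [Ctx.typ_last] at hx
  have hr := T.id_intro hΨ hx
  rw [rename_eq_subst] at hx hr ⊢
  exact isMor_nearDiag h hΨ hΨ (isMor_init hΨ) hx hx hr

theorem isMor_elimSub {Ψ : Ctx S (n + 1)} (h : T.CtxElim Ψ.init) (hΨ : T.Wf Ψ) :
    T.IsMor (Ψ.init.idExt (Ψ (Fin.last n))) Ψ.path (elimSub Ψ.init) := by
  have hΨ' := wf_succ.1 hΨ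
  have hw := wf_idExt hΨ'.1 hΨ'.2
  have hid := isMor_id hw
  have e : (fun i => .var i : Fin (n + 3) → Expr S (n + 3))
      = Fin.append (fun i => .var (Fin.castAdd 3 i))
        ![.var (Fin.natAdd n 0), .var (Fin.natAdd n 1), .var (Fin.natAdd n 2)] := by
    funext i
    revert i
    rw [forall_fin_add_three]
    refine ⟨fun i => ?_, ?_, ?_, ?_⟩
    · rw [Fin.append_left]
    all_goals rw [Fin.append_right]; rfl
  rw [e, isMor_triple] at hid
  exact isMor_nearDiag h hΨ hw hid.1 hid.2.1 hid.2.2.1 hid.2.2.2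

theorem elimSub_subst (Ψ : Ctx S n) (σ : Fin n → Expr S k) (a b p : Expr S k) :
    (fun i => (elimSub Ψ i).subst (Fin.append σ ![a, b, p])) = nearDiag Ψ σ a b p := by
  rw [elimSub, nearDiag_subst]
  simp

theorem elimSub_diag (Ψ : Ctx S (n + 1)) :
    (fun i => (elimSub Ψ.init i).subst (diag (Ψ (Fin.last n)))) = diagCtx Ψ := by
  rw [diag, elimSub_subst, diagCtx_succ]; rfl

/-- The premises of the elimination rule for the last component of an identity context. -/
theorem elimData_succ {Ψ : Ctx S (n + 1)} (h : T.CtxElim Ψ.init) (hΨ : T.Wf Ψ)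
    {Θ : Tel S (n + 1 + (n + 1) + (n + 1)) m} {C : Expr S (n + 1 + (n + 1) + (n + 1) + m)}
    {d : Expr S (n + 1 + m)}
    (hΘ : T.Wf (Ψ.path.append Θ)) (hC : T.Der (Ψ.path.append Θ) (isType C))
    (hd : T.Der (Ψ.append (Θ.subst (diagCtx Ψ))) (isElem d (C.subst (liftSub (diagCtx Ψ) m)))) :
    T.ElimData Ψ.init (Ψ (Fin.last n)) (Θ.subst (elimSub Ψ.init))
      (C.subst (liftSub (elimSub Ψ.init) m)) d := by
  have hΨ' := wf_succ.1 hΨ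
  have hw := wf_append_subst (wf_idExt hΨ'.1 hΨ'.2) (isMor_elimSub h hΨ) hΘ
  refine ⟨hΨ'.1, hΨ'.2, hw.1, T.subst hw.1 hΘ hw.2 hC, ?_⟩
  rw [Tel.subst_subst, Expr.subst_subst, liftSub_liftSub, elimSub_diag, Ctx.snoc_init]
  exact hd

theorem wf_ctxJTel {Ψ : Ctx S (n + 1)} (h : T.CtxElim Ψ.init) (hΨ : T.Wf Ψ)
    {Θ : Tel S (n + 1 + (n + 1) + (n + 1)) m} (hΘ : T.Wf (Ψ.path.append Θ)) :
    T.Wf (Ψ.init.path.append (ctxJTel Ψ Θ)) := by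
  have hΨ' := wf_succ.1 hΨ
  induction m with
  | zero =>
    have e : Ψ.init.path.append (ctxJTel Ψ Θ : Tel S (n + n + n) 3) =
        ((Ψ.init.path.snoc ((Ψ (Fin.last n)).rename PX)).snoc
          ((Ψ (Fin.last n)).rename (Y (m := 1)))).snoc
          (.Id ((Ψ (Fin.last n)).rename (Y (m := 2)))
          ((transport Ψ.init (Ψ (Fin.last n))).rename (Fin.castAdd 1)) (.var (Z (m := 2) 1))) := by
      rw [Ctx.append_succ, Ctx.append_succ, Ctx.append_succ, Ctx.append_zero]; rfl
    have hA := hΨ'.2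
    obtain ⟨h1, ht, -⟩ := h.transport_aux hA
    have hY := T.subst h.wf hΨ'.1 (isMor_PY h.wf) hA
    have hY1 := der_wk_one h1 hY
    have h2 := wf_snoc h1 hY1
    have hY2 := der_wk_one h2 hY1
    have ht2 := der_wk_one h2 ht
    have hy := der_var h2 (Fin.last _)
    simp only [Judgement.subst, ← rename_eq_subst, Expr.rename_rename, Ctx.typ_snoc_last]
      at h2 hY2 ht2 hy
    exact e ▸ wf_snoc h2 (T.id_form h2 hY2 ht2 hy)
  | succ m ih =>
    rw [Ctx.append_succ, wf_snoc_iff] at hΘ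
    have hw := ih hΘ.1
    have h1 := T.subst hw hΘ.1 (isMor_ren hw _ (typ_shuffle Ψ Θ.init)) hΘ.2
    rw [Judgement.subst, ← rename_eq_subst] at h1
    have h2 := wf_snoc hw h1
    rw [← ctxJTel_last, ← ctxJTel_init] at h2
    exact (Ctx.append_succ (m := 3 + m) Ψ.init.path (ctxJTel Ψ Θ)).symm ▸ h2

/-- Pulling the reordered context back to `u = 1` gives `(x, x', y', v, z)`, the variables of the
branch. This identifies the type required of the branch with the one that eliminating `v` produces.
-/
theorem diagCtx_shuffle (Ψ : Ctx S n) :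
    (fun i => liftSub (diagCtx Ψ) (3 + m) (shuffle n m i)) = Fin.append
      (nearDiag Ψ (fun i => .var (Fin.castAdd (3 + m) i)) (.var (Fin.natAdd n (Fin.castAdd m 0)))
        (.var (Fin.natAdd n (Fin.castAdd m 1))) (.var (Fin.natAdd n (Fin.castAdd m 2))))
      (fun t => .var (Fin.natAdd n (Fin.natAdd 3 t))) := by
  funext i
  revert i
  rw [forall_path_succ]
  refine ⟨fun i => ?_, ⟨?_, ?_, ?_⟩, fun i => ?_⟩
  · rw [shuffle_pathWk, Fin.append_left, liftSub_castAdd]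
    revert i
    simp only [forall_tri, pathWk, tri_PX, tri_PY, tri_PU, Fin.snoc_castSucc, diagCtx, reflAt,
      nearDiag, rename_eq_subst, Expr.subst_mk_var, implies_true, and_true]
  · rw [shuffle_X, X_eq, Z_eq, liftSub_natAdd, Fin.append_left, nearDiag, tri_PX, Fin.snoc_last]
  · rw [shuffle_Y, Y_eq, Z_eq, liftSub_natAdd, Fin.append_left, nearDiag, tri_PY, Fin.snoc_last]
  · rw [shuffle_U, U_eq, Z_eq, liftSub_natAdd, Fin.append_left, nearDiag, tri_PU, Fin.snoc_last]
  · rw [shuffle_Z, Z_eq, Z_eq, liftSub_natAdd, Fin.append_right]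

theorem _root_.DTT.Expr.subst_mk_J (A : Expr S n) (Θ : Tel S (n + 3) m) (C : Expr S (n + 3 + m))
    (d : Expr S (n + 1 + m)) (a b p : Expr S n) (z : Fin m → Expr S n) (σ : Fin n → Expr S k) :
    (Expr.J A Θ C d a b p z).subst σ = .J (A.subst σ) (Θ.subst (liftSub σ 3))
      (C.subst (liftSub (liftSub σ 3) m)) (d.subst (liftSub (liftSub σ 1) m)) (a.subst σ)
      (b.subst σ) (p.subst σ) (fun i => (z i).subst σ) := rfl

section succ
variable {Ψ : Ctx S (n + 1)} (h : T.CtxElim Ψ.init) (hΨ : T.Wf Ψ)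
  {Θ : Tel S (n + 1 + (n + 1) + (n + 1)) m} {C : Expr S (n + 1 + (n + 1) + (n + 1) + m)}
  {d : Expr S (n + 1 + m)}
  (hΘ : T.Wf (Ψ.path.append Θ)) (hC : T.Der (Ψ.path.append Θ) (isType C))
  (hd : T.Der (Ψ.append (Θ.subst (diagCtx Ψ))) (isElem d (C.subst (liftSub (diagCtx Ψ) m))))
include h hΨ hΘ

theorem wf_branch :
    T.Wf (Ψ.init.append ((ctxJTel Ψ Θ).subst (diagCtx Ψ.init))) ∧
      T.IsMor (Ψ.init.append ((ctxJTel Ψ Θ).subst (diagCtx Ψ.init)))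
        (Ψ.init.path.append (ctxJTel Ψ Θ)) (liftSub (diagCtx Ψ.init) (3 + m)) :=
  wf_append_subst h.wf_base h.diag (wf_ctxJTel h hΨ hΘ)

include hC hd

/-- The branch for `u` is itself an elimination, of the remaining identity `v` between `x'` and
`y'`, with `d` as its branch. -/
theorem isElem_branch :
    T.Der (Ψ.init.append ((ctxJTel Ψ Θ).subst (diagCtx Ψ.init)))
      (isElem (ctxJBranch Ψ Θ C d)
        ((C.rename (shuffle n m)).subst (liftSub (diagCtx Ψ.init) (3 + m)))) := by
  have hΨ' := wf_succ.1 hΨ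
  have hD := elimData_succ h hΨ hΘ hC hd
  obtain ⟨hw, hm⟩ := wf_branch h hΨ hΘ
  have hσ := isMor_castAdd hw
  have hv : ∀ i, T.Der (Ψ.init.append ((ctxJTel Ψ Θ).subst (diagCtx Ψ.init)))
      (isElem (.var (Fin.natAdd n i))
        (((ctxJTel Ψ Θ).typ i).subst (liftSub (diagCtx Ψ.init) (3 + m)))) := fun i => by
    have := der_var hw (Fin.natAdd n i)
    rwa [Ctx.typ_append_natAdd, Tel.typ_subst] at this
  have eX : ∀ i : Fin n, liftSub (diagCtx Ψ.init) (3 + m) (X i)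
      = .var (Fin.castAdd (3 + m) i) := fun i => by
    rw [X_eq, liftSub_castAdd, diagCtx, tri_PX]; rfl
  have eY : ∀ i : Fin n, liftSub (diagCtx Ψ.init) (3 + m) (Y i)
      = .var (Fin.castAdd (3 + m) i) := fun i => by
    rw [Y_eq, liftSub_castAdd, diagCtx, tri_PY]; rfl
  have ha := hv (Fin.castAdd m 0)
  have hb := hv (Fin.castAdd m 1)
  have hp := hv (Fin.castAdd m 2)
  rw [typ_ctxJTel_zero, Expr.subst_rename, funext eX] at ha
  rw [typ_ctxJTel_one, Expr.subst_rename, funext eY] at hb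
  rw [typ_ctxJTel_two, Expr.subst_mk_Id, Expr.subst_rename, funext eY, Expr.subst_mk_var, Z_eq, Z_eq,
    liftSub_natAdd, Expr.subst_rename, comp_snoc, liftSub_natAdd] at hp
  have et : (fun i => liftSub (diagCtx Ψ.init) (3 + m) (Fin.castAdd (3 + m) i)) =
      tri (fun i => .var (Fin.castAdd (3 + m) i)) (fun i => .var (Fin.castAdd (3 + m) i))
        (reflAt Ψ.init (fun i => .var (Fin.castAdd (3 + m) i))) := by
    rw [← diagCtx_subst]
    simp only [liftSub_castAdd, rename_eq_subst]
  rw [et] at hp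
  -- The variable `v` is declared in `Id(1_!(x'), y')`, whereas `J` needs an element of `Id(x',
  -- y')`; the computation rule for transport identifies the two types.
  have hp' := T.conv_elem hw hp (eqType_Id hw
    (h.transport_refl hΨ'.2 hw hσ ha) (T.eqElem_refl hw hb))
  have := hD.elim hw hσ ha hb hp' (z := fun t => .var (Fin.natAdd n (Fin.natAdd 3 t))) (fun i => by
    rw [Tel.subst_subst, elimSub_subst, Tel.at_eq, ← diagCtx_shuffle, ← Expr.subst_rename,
      ← typ_ctxJTel_natAdd]
    exact hv _)
  rw [Expr.subst_subst _ (liftSub (elimSub Ψ.init) m) (Fin.append _ _), append_liftSub,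
    elimSub_subst, ← diagCtx_shuffle] at this
  rw [Expr.subst_rename]
  exact this

theorem ctxElim_elim_succ :
    T.Der (Ψ.path.append Θ) (isElem (ctxJ (n + 1) Ψ Θ C d) C) := by
  have hw := wf_ctxJTel h hΨ hΘ
  have hC' := T.subst hw hΘ (isMor_ren hw _ (typ_shuffle Ψ Θ)) hC
  rw [Judgement.subst, ← rename_eq_subst] at hC'
  have h1 := h.elim hw hC' (isElem_branch h hΨ hΘ hC hd)
  have h2 := T.subst hΘ hw (isMor_ren hΘ _ (typ_unshuffle Ψ Θ)) h1
  rw [Judgement.subst, ← rename_eq_subst, ← rename_eq_subst, Expr.rename_rename] at h2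
  simp only [unshuffle_shuffle, Expr.rename_id] at h2
  rwa [ctxJ_succ]

/-- Two computations in a row: at `u = 1` the outer eliminator becomes its branch, and at `v =
r(x')` this branch, a `J`, becomes `d`. -/
theorem ctxElim_comp_succ :
    T.Der (Ψ.append (Θ.subst (diagCtx Ψ)))
      (eqElem ((ctxJ (n + 1) Ψ Θ C d).subst (liftSub (diagCtx Ψ) m)) d
        (C.subst (liftSub (diagCtx Ψ) m))) := by
  have hΨ' := wf_succ.1 hΨ
  have hD := elimData_succ h hΨ hΘ hC hd
  have hw := wf_ctxJTel h hΨ hΘ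
  obtain ⟨hw', hm⟩ := wf_branch h hΨ hΘ
  have hC' := T.subst hw hΘ (isMor_ren hw _ (typ_shuffle Ψ Θ)) hC
  rw [Judgement.subst, ← rename_eq_subst] at hC'
  have h1 := h.comp hw hC' (isElem_branch h hΨ hΘ hC hd)
  obtain ⟨hw0, hm0⟩ := wf_append_subst hΨ (isMor_diagCtx_succ h hΨ) hΘ
  have hm1 := isMor_comp hw0 hΘ hm0 (isMor_ren hΘ _ (typ_unshuffle Ψ Θ))
  simp only [Expr.subst_mk_var] at hm1
  -- the substitution `(x, (x', x', r(x'), z))`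
  let x : Fin n → Expr S (n + 1 + m) := fun i => .var (Fin.castAdd m i.castSucc)
  let x' : Expr S (n + 1 + m) := .var (Fin.castAdd m (Fin.last n))
  let κ : Fin (n + (3 + m)) → Expr S (n + 1 + m) := Fin.append x
    (Fin.append ![x', x', .refl ((Ψ (Fin.last n)).subst x) x'] (fun t => .var (Fin.natAdd _ t)))
  -- The two stages of the diagonal compose to the full diagonal: first `u = 1`, then `κ`, agrees
  -- with the diagonal of `Ψ` up to the reordering. Hence the outer computation rule, substituted
  -- along `κ`, speaks about the wanted instance of `ctxJ`.
  have hκ : (fun i => (liftSub (diagCtx Ψ.init) (3 + m) i).subst κ) =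
      fun i => liftSub (diagCtx Ψ) m (unshuffle n m i) := by
    funext i
    revert i
    rw [forall_ctxJTel]
    refine ⟨fun i => ?_, ⟨?_, ?_, ?_⟩, fun i => ?_⟩
    · rw [unshuffle_castAdd, liftSub_castAdd, liftSub_castAdd, Expr.subst_rename, diagCtx_succ]
      have e : (fun i => κ (Fin.castAdd (3 + m) i)) = x := funext fun i => Fin.append_left _ _ i
      rw [e]
      revert i
      simp only [forall_tri, pathWk, tri_PX, tri_PY, tri_PU, Fin.snoc_castSucc, diagCtx, reflAt,
        nearDiag, rename_eq_subst, Expr.subst_subst, Expr.subst_mk_var]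
      exact ⟨fun _ => rfl, fun _ => rfl, fun _ => rfl⟩
    · rw [unshuffle_Z_zero, X_eq, Z_eq, liftSub_natAdd, liftSub_castAdd, diagCtx, tri_PX,
        Expr.subst_mk_var]
      exact (Fin.append_right _ _ _).trans (Fin.append_left _ _ _)
    · rw [unshuffle_Z_one, Y_eq, Z_eq, liftSub_natAdd, liftSub_castAdd, diagCtx, tri_PY,
        Expr.subst_mk_var]
      exact (Fin.append_right _ _ _).trans (Fin.append_left _ _ _)
    · rw [unshuffle_Z_two, U_eq, Z_eq, liftSub_natAdd, liftSub_castAdd, diagCtx, tri_PU,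
        Expr.subst_mk_var, reflCtx_last, Expr.rename_mk_refl, Expr.rename_rename, rename_eq_subst]
      exact (Fin.append_right _ _ _).trans (Fin.append_left _ _ _)
    · rw [unshuffle_Z_natAdd, Z_eq, Z_eq, liftSub_natAdd, liftSub_natAdd, Expr.subst_mk_var]
      exact (Fin.append_right _ _ _).trans (Fin.append_right _ _ _)
  have hκi : ∀ i, liftSub (diagCtx Ψ) m (unshuffle n m (Fin.natAdd _ i)) = κ (Fin.natAdd n i) :=
    fun i => by rw [← congrFun hκ, liftSub_natAdd]; rfl
  have hx : T.IsMor (Ψ.append (Θ.subst (diagCtx Ψ))) Ψ.init x :=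
    isMor_comp hw0 hΨ (isMor_castAdd hw0) (isMor_init hΨ)
  have hκm : T.IsMor (Ψ.append (Θ.subst (diagCtx Ψ)))
      (Ψ.init.append ((ctxJTel Ψ Θ).subst (diagCtx Ψ.init))) κ := by
    refine isMor_append_iff.2 ⟨hx, fun i => ?_⟩
    have := isMor_iff.1 hm1 (Fin.natAdd _ i)
    rw [Ctx.typ_append_natAdd, ← hκ, ← Expr.subst_subst, ← Tel.typ_subst, hκi] at this
    convert this using 2
    exact (Fin.append_right _ _ i).symm
  have hs : (fun i => (liftSub (diagCtx Ψ.init) (3 + m) (shuffle n m i)).subst κ) =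
      liftSub (diagCtx Ψ) m := funext fun i => by
    rw [congrFun hκ, unshuffle_shuffle]
  have h2 := T.subst hw0 hw' hκm h1
  simp only [Judgement.subst, Expr.subst_subst, Expr.subst_rename] at h2
  rw [hκ, hs, ← Expr.subst_rename, ← ctxJ_succ] at h2
  refine T.eqElem_trans hw0 h2 ?_
  have hx' := der_var hw0 (Fin.castAdd m (Fin.last n))
  rw [Ctx.typ_append_castAdd, Ctx.typ_last, Expr.rename_rename, rename_eq_subst] at hx'
  have e : Fin.append (nearDiag Ψ.init x x' x' (.refl ((Ψ (Fin.last n)).subst x) x'))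
      (fun t => .var (Fin.natAdd _ t)) = liftSub (diagCtx Ψ) m := by
    funext i
    refine Fin.addCases (fun i => ?_) (fun i => ?_) i
    · rw [Fin.append_left, liftSub_castAdd, diagCtx_succ, rename_eq_subst,
        congrFun (nearDiag_subst Ψ.init _ _ _ _ _) i, Expr.subst_mk_refl, rename_eq_subst,
        Expr.subst_subst]
      rfl
    · rw [Fin.append_right, liftSub_natAdd]
  have h3 := hD.comp hw0 hx hx' (z := fun t => .var (Fin.natAdd _ t)) (fun i => by
    rw [Tel.subst_subst, elimSub_subst, Tel.at_eq]
    have := isMor_iff.1 hm0 (Fin.natAdd _ i)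
    rw [liftSub_natAdd, Ctx.typ_append_natAdd, ← e] at this
    exact this)
  rw [Expr.subst_subst _ (liftSub (elimSub Ψ.init) m) (Fin.append _ _), append_liftSub,
    elimSub_subst] at h3
  erw [e] at h3
  have ed : d.subst (Fin.append (Fin.append x ![x']) (fun t => .var (Fin.natAdd _ t))) = d := by
    conv_rhs => rw [← Expr.subst_var d]
    refine Expr.subst_congr _ fun i => ?_
    rw [append_one]
    refine Fin.addCases (fun i => ?_) (fun i => ?_) i
    · rw [Fin.append_left]
      refine Fin.lastCases ?_ (fun i => ?_) i
      · rw [Fin.snoc_last]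
      · rw [Fin.snoc_castSucc]
    · rw [Fin.append_right]
  rw [ed] at h3
  have ex : (fun i : Fin n => (Expr.var (Fin.castAdd (3 + m) i) : Expr S (n + (3 + m))).subst κ)
      = x := funext fun i => Fin.append_left _ _ i
  -- Substituted along `κ`, the branch is exactly the reflexive instance of `J` to which the
  -- computation rule in `h3` applies.
  have eJ : (ctxJBranch Ψ Θ C d).subst κ = .J ((Ψ (Fin.last n)).subst x)
      ((Θ.subst (elimSub Ψ.init)).subst (liftSub x 3))
      ((C.subst (liftSub (elimSub Ψ.init) m)).subst (liftSub (liftSub x 3) m))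
      (d.subst (liftSub (liftSub x 1) m)) x' x' (.refl ((Ψ (Fin.last n)).subst x) x')
      (fun t => .var (Fin.natAdd _ t)) := by
    rw [ctxJBranch, Expr.subst_mk_J, Tel.subst_subst _ (liftSub _ 3), liftSub_liftSub, ex,
      Expr.subst_subst _ (liftSub (liftSub _ 3) m), liftSub_liftSub, liftSub_liftSub, ex,
      Expr.subst_subst _ (liftSub (liftSub _ 1) m), liftSub_liftSub, liftSub_liftSub, ex]
    congr 1
    · rw [Expr.subst_subst]; exact congrArg _ ex
    · exact (Fin.append_right _ _ _).trans (Fin.append_left _ _ _)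
    · exact (Fin.append_right _ _ _).trans (Fin.append_left _ _ _)
    · exact (Fin.append_right _ _ _).trans (Fin.append_left _ _ _)
    · funext t
      exact (Fin.append_right _ _ _).trans (Fin.append_right _ _ _)
  rw [eJ]
  exact h3

end succ

/-- For the empty context there is nothing to eliminate and the eliminator is `d`. In the step all
rules for the shorter context are needed at once, since formation and introduction for the longer
one already rest on elimination and computation for the shorter one. -/
theorem ctxElim {n : ℕ} {Ψ : Ctx S n} (hΨ : T.Wf Ψ) : T.CtxElim Ψ := by
  induction n with
  | zero =>
    have e0 : Ψ.path = Ψ := funext fun i => i.elim0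
    have e1 : diagCtx Ψ = fun i => .var i := funext fun i => i.elim0
    -- As `0 + 0 + 0` reduces to `0`, the cast of variables in the base case of `ctxJ` is the
    -- identity renaming.
    have e2 : ∀ {m : ℕ} (Θ : Tel S (0 + 0 + 0) m) C (d : Expr S (0 + m)), ctxJ 0 Ψ Θ C d = d :=
      fun Θ C d => Expr.rename_id d
    have hw : T.Wf Ψ.path := by rw [e0]; exact hΨ
    refine ⟨hw, fun i => i.elim0, fun {m Θ C d} hΘ hC hd => ?_, fun {m Θ C d} hΘ hC hd => ?_⟩
    · rw [e2]
      rw [e1, liftSub_var, Tel.subst_id, Expr.subst_var] at hd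
      rw [e0]
      exact hd
    · rw [e2]
      rw [e1, liftSub_var, Tel.subst_id, Expr.subst_var] at hd
      rw [e1, liftSub_var, Tel.subst_id, Expr.subst_var, Expr.subst_var]
      rw [e0] at hΘ
      exact T.eqElem_refl hΘ hd
  | succ n ih =>
    have h := ih (wf_succ.1 hΨ).1
    exact ⟨wf_path_succ h hΨ, isMor_diagCtx_succ h hΨ, ctxElim_elim_succ h hΨ,
      ctxElim_comp_succ h hΨ⟩

end TypeTheory

/-! ## Transport along a single identity -/

section
variable {n m k l : ℕ}

/-- The substitution `(σ, a)`. -/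
abbrev ext (σ : Fin n → Expr S k) (a : Expr S k) : Fin (n + 1) → Expr S k :=
  Fin.snoc (α := fun _ => Expr S k) σ a

theorem ext_subst (σ : Fin n → Expr S k) (a : Expr S k) (τ : Fin k → Expr S l) :
    (fun i => (ext σ a i).subst τ) = ext (fun i => (σ i).subst τ) (a.subst τ) :=
  comp_snoc (f := fun e : Expr S k => e.subst τ) σ a

theorem reflAt_snoc (Γ : Ctx S n) (A : Expr S n) (σ : Fin n → Expr S k) (x : Expr S k) :
    reflAt (Γ.snoc A) (ext σ x) = ext (reflAt Γ σ) (.refl (A.subst σ) x) := by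
  funext i
  refine Fin.lastCases ?_ (fun i => ?_) i
  · refine Eq.trans ?_ (Fin.snoc_last (α := fun _ => Expr S k) _ _).symm
    rw [reflAt, reflCtx_last, Expr.subst_mk_refl, Ctx.snoc_last,
      Expr.subst_rename, Expr.subst_mk_var]
    simp only [Fin.snoc_castSucc, Fin.snoc_last]
  · refine Eq.trans ?_ (Fin.snoc_castSucc (α := fun _ => Expr S k) _ _ i).symm
    rw [reflAt, reflCtx_castSucc, Ctx.init_snoc, reflAt_subst]
    simp only [Expr.subst_mk_var, Fin.snoc_castSucc]

/-- Transport of `e ∈ E(a)` to `E(b)` along `p ∈ Id_A(a, b)`. -/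
def transportOne (Γ : Ctx S n) (A : Expr S n) (E : Expr S (n + 1)) (σ : Fin n → Expr S k)
    (a b p e : Expr S k) : Expr S k :=
  (transport (Γ.snoc A) E).subst (ext (nearDiag Γ σ a b p) e)

theorem transportOne_subst (Γ : Ctx S n) (A : Expr S n) (E : Expr S (n + 1)) (σ : Fin n → Expr S k)
    (a b p e : Expr S k) (τ : Fin k → Expr S l) :
    (transportOne Γ A E σ a b p e).subst τ = transportOne Γ A E (fun i => (σ i).subst τ)
      (a.subst τ) (b.subst τ) (p.subst τ) (e.subst τ) := by
  rw [transportOne, Expr.subst_subst, ext_subst, nearDiag_subst]; rfl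

/-- The composite of `t ∈ Id_A(w, x)` and `p ∈ Id_A(x, y)`. -/
def pathComp (Γ : Ctx S n) (A : Expr S n) (σ : Fin n → Expr S k) (w x y p t : Expr S k) :
    Expr S k :=
  transportOne (Γ.snoc A) (A.rename Fin.castSucc)
    (.Id (A.rename (fun i => i.castSucc.castSucc)) (.var (Fin.last n).castSucc)
      (.var (Fin.last (n + 1)))) (ext σ w) x y p t

theorem pathComp_subst (Γ : Ctx S n) (A : Expr S n) (σ : Fin n → Expr S k)
    (w x y p t : Expr S k) (τ : Fin k → Expr S l) :
    (pathComp Γ A σ w x y p t).subst τ = pathComp Γ A (fun i => (σ i).subst τ)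
      (w.subst τ) (x.subst τ) (y.subst τ) (p.subst τ) (t.subst τ) := by
  rw [pathComp, transportOne_subst, ext_subst]; rfl

end

namespace TypeTheory
variable {T : TypeTheory S} {n m k l : ℕ}

theorem isMor_nearDiag_snoc {Γ : Ctx S n} {A : Expr S n} (hΓ : T.Wf Γ) (hA : T.Der Γ (isType A))
    {Δ : Ctx S k} (hΔ : T.Wf Δ) {σ : Fin n → Expr S k} {a b p : Expr S k} (hσ : T.IsMor Δ Γ σ)
    (ha : T.Der Δ (isElem a (A.subst σ))) (hb : T.Der Δ (isElem b (A.subst σ)))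
    (hp : T.Der Δ (isElem p (.Id (A.subst σ) a b))) :
    T.IsMor Δ (Γ.snoc A).path (nearDiag Γ σ a b p) := by
  have hw := wf_snoc hΓ hA
  have := isMor_nearDiag (Ψ := Γ.snoc A) (ctxElim (by rwa [Ctx.init_snoc])) hw hΔ (a := σ) (x := a)
    (y := b) (v := p)
  rw [Ctx.init_snoc, Ctx.snoc_last] at this
  exact this hσ ha hb hp

theorem pathComp_type {Γ : Ctx S n} {A : Expr S n} (hΓ : T.Wf Γ) (hA : T.Der Γ (isType A)) :
    T.Der ((Γ.snoc A).snoc (A.rename Fin.castSucc))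
    (isType (.Id (A.rename (fun i => i.castSucc.castSucc)) (.var (Fin.last n).castSucc)
      (.var (Fin.last (n + 1))))) := by
  have h1 := wf_snoc hΓ hA
  have hA1 := der_wk_one h1 hA
  have h2 := wf_snoc h1 hA1
  have hA2 := der_wk_one h2 hA1
  have hv1 := der_var h2 (Fin.last n).castSucc
  have hv2 := der_var h2 (Fin.last (n + 1))
  simp only [Judgement.subst, ← rename_eq_subst, Ctx.typ_snoc_last, Ctx.typ_snoc_castSucc,
    Expr.rename_rename] at *
  exact T.id_form h2 hA2 hv1 hv2

section
variable {Γ : Ctx S n} {A : Expr S n} (hΓ : T.Wf Γ) (hA : T.Der Γ (isType A))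
  {Δ : Ctx S k} (hΔ : T.Wf Δ) {σ : Fin n → Expr S k} (hσ : T.IsMor Δ Γ σ)
include hΓ hA hΔ hσ

/-- A single identity `p` is the path `(1_σ, p)` in the context `(Γ, x ∈ A)`, so the rules for
identity contexts specialise and no further elimination is needed. -/
theorem transportOne_elem {E : Expr S (n + 1)} (hE : T.Der (Γ.snoc A) (isType E))
    {a b p e : Expr S k}
    (ha : T.Der Δ (isElem a (A.subst σ))) (hb : T.Der Δ (isElem b (A.subst σ)))
    (hp : T.Der Δ (isElem p (.Id (A.subst σ) a b)))
    (he : T.Der Δ (isElem e (E.subst (ext σ a)))) :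
    T.Der Δ (isElem (transportOne Γ A E σ a b p e) (E.subst (ext σ b))) :=
  (ctxElim (wf_snoc hΓ hA)).transport_elem hE hΔ (isMor_nearDiag_snoc hΓ hA hΔ hσ ha hb hp) he

theorem transportOne_refl {E : Expr S (n + 1)} (hE : T.Der (Γ.snoc A) (isType E))
    {a e : Expr S k} (ha : T.Der Δ (isElem a (A.subst σ)))
    (he : T.Der Δ (isElem e (E.subst (ext σ a)))) :
    T.Der Δ (eqElem (transportOne Γ A E σ a a (.refl (A.subst σ) a) e) e
      (E.subst (ext σ a))) := by
  have := (ctxElim (wf_snoc hΓ hA)).transport_refl hE hΔ (isMor_snoc.2 ⟨hσ, ha⟩) he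
  rw [reflAt_snoc] at this
  exact this

theorem pathComp_elem {w x y p t : Expr S k} (hw : T.Der Δ (isElem w (A.subst σ)))
    (hx : T.Der Δ (isElem x (A.subst σ))) (hy : T.Der Δ (isElem y (A.subst σ)))
    (hp : T.Der Δ (isElem p (.Id (A.subst σ) x y)))
    (ht : T.Der Δ (isElem t (.Id (A.subst σ) w x))) :
    T.Der Δ (isElem (pathComp Γ A σ w x y p t) (.Id (A.subst σ) w y)) := by
  have h1 := wf_snoc hΓ hA
  have hA1 := der_wk_one h1 hA
  rw [Judgement.subst, ← rename_eq_subst] at hA1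
  have e : (A.rename Fin.castSucc).subst (ext σ w) = A.subst σ := by
    rw [Expr.subst_rename]; simp only [Fin.snoc_castSucc]
  have := transportOne_elem h1 hA1 hΔ (isMor_snoc.2 ⟨hσ, hw⟩) (pathComp_type hΓ hA)
    (a := x) (b := y) (p := p) (e := t) (by rwa [e]) (by rwa [e]) (by rwa [e])
  simp only [Expr.subst_mk_Id, Expr.subst_rename, Expr.subst_mk_var, Fin.snoc_castSucc,
    Fin.snoc_last] at this
  exact this ht

/-- Composition transports `t` along `p` in the family `Id_A(w, -)`, so it is strictly unital when
`p` is reflexivity. When `t` is reflexivity it is unital only up to an identity, which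
`exists_pathComp_unit` supplies. -/
theorem pathComp_refl {w x t : Expr S k} (hw : T.Der Δ (isElem w (A.subst σ)))
    (hx : T.Der Δ (isElem x (A.subst σ)))
    (ht : T.Der Δ (isElem t (.Id (A.subst σ) w x))) :
    T.Der Δ (eqElem (pathComp Γ A σ w x x (.refl (A.subst σ) x) t) t
      (.Id (A.subst σ) w x)) := by
  have h1 := wf_snoc hΓ hA
  have hA1 := der_wk_one h1 hA
  rw [Judgement.subst, ← rename_eq_subst] at hA1
  have e : (A.rename Fin.castSucc).subst (ext σ w) = A.subst σ := by
    rw [Expr.subst_rename]; simp only [Fin.snoc_castSucc]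
  have := transportOne_refl h1 hA1 hΔ (isMor_snoc.2 ⟨hσ, hw⟩) (pathComp_type hΓ hA)
    (a := x) (e := t) (by rwa [e])
  simp only [Expr.subst_mk_Id, Expr.subst_rename, Expr.subst_mk_var, Fin.snoc_castSucc,
    Fin.snoc_last] at this
  exact this ht

end

/-! ## Lifting elements -/

variable (T) in
/-- Every element of a type over `Ψ` that is given over `Φ` extends to `Ψ`. -/
def LiftProp (Φ : Ctx S n) (Ψ : Ctx S m) (f : Fin m → Expr S n) : Prop :=
  ∀ (B : Expr S m) (c : Expr S n), T.Der Ψ (isType B) → T.Der Φ (isElem c (B.subst f)) →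
    ∃ d, T.Der Ψ (isElem d B) ∧ T.Der Φ (eqElem (d.subst f) c (B.subst f))

theorem LiftProp.comp {Φ : Ctx S n} {Ψ : Ctx S m} {Ξ : Ctx S l} {f : Fin m → Expr S n}
    {g : Fin l → Expr S m} (hΦ : T.Wf Φ) (hΨ : T.Wf Ψ) (hΞ : T.Wf Ξ) (hf : T.IsMor Φ Ψ f)
    (hg : T.IsMor Ψ Ξ g) (Lf : T.LiftProp Φ Ψ f) (Lg : T.LiftProp Ψ Ξ g) :
    T.LiftProp Φ Ξ (fun i => (g i).subst f) := by
  intro B c hB hc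
  rw [← Expr.subst_subst] at hc ⊢
  obtain ⟨d, hd, hd'⟩ := Lf _ c (T.subst hΨ hΞ hg hB) hc
  obtain ⟨e, he, he'⟩ := Lg B d hB hd
  refine ⟨e, he, ?_⟩
  rw [← Expr.subst_subst]
  exact T.eqElem_trans hΦ (T.subst hΦ hΨ hf he') hd'

/-- Needed because computation rules identify raw context morphisms only up to definitional
equality; the types and elements restricted along them are then equal as well. -/
theorem LiftProp.congr {Φ : Ctx S n} {Ψ : Ctx S m} {f g : Fin m → Expr S n} (hΦ : T.Wf Φ)
    (hΨ : T.Wf Ψ) (hf : T.IsMor Φ Ψ f) (hg : T.IsMor Φ Ψ g) (h : T.MorEq Φ Ψ f g)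
    (Lf : T.LiftProp Φ Ψ f) : T.LiftProp Φ Ψ g := by
  intro B c hB hc
  have hE := T.subst_eqType hΦ hΨ hf hg h hB
  obtain ⟨d, hd, hd'⟩ := Lf B c hB (T.conv_elem hΦ hc (T.eqType_symm hΦ hE))
  refine ⟨d, hd, T.conv_eqElem hΦ (T.eqElem_trans hΦ (T.eqElem_symm hΦ ?_) hd') hE⟩
  exact T.subst_eqElem hΦ hΨ hf hg h hd

/-- Invariance under the isomorphisms of the target that permute its variables. -/
theorem LiftProp.ren {Φ : Ctx S n} {Ψ : Ctx S m} {Ξ : Ctx S l} {f : Fin m → Expr S n}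
    (hΨ : T.Wf Ψ) (hΞ : T.Wf Ξ) {ρ : Fin l → Fin m} {ρ' : Fin m → Fin l}
    (hρ : T.IsMor Ψ Ξ (fun i => .var (ρ i))) (hρ' : T.IsMor Ξ Ψ (fun i => .var (ρ' i)))
    (h : ∀ i, ρ (ρ' i) = i) (h' : ∀ i, ρ' (ρ i) = i) (Lf : T.LiftProp Φ Ψ f) :
    T.LiftProp Φ Ξ (fun i => f (ρ i)) := by
  intro B c hB hc
  have hB' := T.subst hΨ hΞ hρ hB
  rw [Judgement.subst, ← rename_eq_subst] at hB'
  obtain ⟨d, hd, hd'⟩ := Lf _ c hB' (by rwa [Expr.subst_rename])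
  refine ⟨d.rename ρ', ?_, ?_⟩
  · have := T.subst hΞ hΨ hρ' hd
    rw [Judgement.subst, ← rename_eq_subst, ← rename_eq_subst, Expr.rename_rename] at this
    simpa only [h', Expr.rename_id] using this
  · rw [Expr.subst_rename] at hd' ⊢
    simpa only [h] using hd'

theorem append_succ_eq {α : Type*} (f : Fin n → α) (c : Fin (m + 1) → α) :
    Fin.append f c = Fin.snoc (α := fun _ => α) (Fin.append f (fun i => c i.castSucc))
      (c (Fin.last m)) := by
  funext i
  refine Fin.addCases (fun i => ?_) (fun i => ?_) i
  · rw [Fin.append_left]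
    exact ((Fin.snoc_castSucc (α := fun _ => α) _ _ (Fin.castAdd m i)).trans
      (Fin.append_left _ _ i)).symm
  · rw [Fin.append_right]
    refine Fin.lastCases ?_ (fun i => ?_) i
    · exact (Fin.snoc_last (α := fun _ => α) _ _).symm
    · exact ((Fin.snoc_castSucc (α := fun _ => α) (c (Fin.last m))
        (Fin.append f (fun i => c i.castSucc)) (Fin.natAdd n i)).trans
        (Fin.append_right f (fun i => c i.castSucc) i)).symm

/-- Extension of elements of dependent contexts. -/
theorem LiftProp.tel {Φ : Ctx S n} {Ψ : Ctx S m} {f : Fin m → Expr S n} (hΦ : T.Wf Φ)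
    (hΨ : T.Wf Ψ) (hf : T.IsMor Φ Ψ f) (Lf : T.LiftProp Φ Ψ f) {Θ : Tel S m k}
    (hΘ : T.Wf (Ψ.append Θ)) {c : Fin k → Expr S n}
    (hc : T.IsMor Φ (Ψ.append Θ) (Fin.append f c)) :
    ∃ d : Fin k → Expr S m, T.IsMor Ψ (Ψ.append Θ) (Fin.append (fun i => .var i) d) ∧
      T.MorEq Φ (Ψ.append Θ) (Fin.append f (fun i => (d i).subst f)) (Fin.append f c) := by
  induction k with
  | zero =>
    refine ⟨fun i => i.elim0, ?_, ?_⟩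
    · exact isMor_append_iff.2 ⟨isMor_id hΨ, fun i => i.elim0⟩
    · exact morEq_append.2 ⟨morEq_refl hΦ hf, fun i => i.elim0⟩
  | succ k ih =>
    rw [Ctx.append_succ] at hΘ hc ⊢
    rw [append_succ_eq] at hc
    obtain ⟨hΘ1, hB⟩ := wf_snoc_iff.1 hΘ
    obtain ⟨hc1, hc2⟩ := isMor_snoc.1 hc
    obtain ⟨d, hd, hd'⟩ := ih hΘ1 hc1
    have hdf := isMor_comp hΦ hΨ hf hd
    rw [append_subst (τ := f)] at hdf
    have hE := T.subst_eqType hΦ hΘ1 hdf hc1 hd' hB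
    -- The type of the next component depends on the extension `d` chosen for the earlier ones.
    -- Since `d` restricts to the given components only definitionally, the given last component
    -- must first be converted.
    obtain ⟨e, he, he'⟩ := Lf ((Θ (Fin.last k)).subst (Fin.append (fun i => .var i) d))
      (c (Fin.last k)) (T.subst hΨ hΘ1 hd hB) (by
        rw [Expr.subst_subst, append_subst (τ := f)]
        exact T.conv_elem hΦ hc2 (T.eqType_symm hΦ hE))
    rw [Expr.subst_subst, append_subst (τ := f)] at he'
    refine ⟨Fin.snoc (α := fun _ => Expr S m) d e, ?_, ?_⟩
    · rw [append_succ_eq, isMor_snoc]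
      simp only [Fin.snoc_castSucc, Fin.snoc_last]
      exact ⟨hd, he⟩
    · rw [append_succ_eq, append_succ_eq, morEq_snoc]
      simp only [Fin.snoc_castSucc, Fin.snoc_last]
      exact ⟨hd', he'⟩

theorem isMor_append_toTel {Δ : Ctx S k} {Ψ : Ctx S m} {Ξ : Ctx S l} {f : Fin m → Expr S k}
    {c : Fin l → Expr S k} : T.IsMor Δ (Ψ.append (Ξ.toTel m)) (Fin.append f c) ↔
      T.IsMor Δ Ψ f ∧ T.IsMor Δ Ξ c := by
  rw [isMor_append_iff, isMor_iff (Ψ := Ξ)]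
  simp only [Ctx.typ_toTel, Expr.subst_rename, Fin.append_right]

theorem morEq_append_toTel {Δ : Ctx S k} {Ψ : Ctx S m} {Ξ : Ctx S l} {f f' : Fin m → Expr S k}
    {c c' : Fin l → Expr S k} :
    T.MorEq Δ (Ψ.append (Ξ.toTel m)) (Fin.append f c) (Fin.append f' c') ↔
      T.MorEq Δ Ψ f f' ∧ T.MorEq Δ Ξ c c' := by
  rw [morEq_append, morEq_iff (Ψ := Ξ)]
  simp only [PreTheory.EqElemTel, Tel.at_eq, Ctx.typ_toTel, Expr.subst_rename, Fin.append_right]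

/-- Extension of context morphisms. -/
theorem LiftProp.ctx {Φ : Ctx S n} {Ψ : Ctx S m} {f : Fin m → Expr S n} (hΦ : T.Wf Φ)
    (hΨ : T.Wf Ψ) (hf : T.IsMor Φ Ψ f) (Lf : T.LiftProp Φ Ψ f) {Ξ : Ctx S k}
    (hΞ : T.Wf Ξ) {c : Fin k → Expr S n} (hc : T.IsMor Φ Ξ c) :
    ∃ d : Fin k → Expr S m, T.IsMor Ψ Ξ d ∧ T.MorEq Φ Ξ (fun i => (d i).subst f) c := by
  -- A context morphism into `Ξ` is an element of `Ξ` regarded as a constant dependent context.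
  obtain ⟨d, hd, hd'⟩ := Lf.tel hΦ hΨ hf (wf_toTel hΨ hΞ).1 (isMor_append_toTel.2 ⟨hf, hc⟩)
  exact ⟨d, (isMor_append_toTel.1 hd).2, (morEq_append_toTel.1 hd').2⟩

end TypeTheory

namespace TypeTheory
variable {T : TypeTheory S} {n m k l : ℕ}

/-! ## Based path induction -/

theorem append_var (n m : ℕ) : (Fin.append (fun i : Fin n => .var (Fin.castAdd m i))
    (fun i : Fin m => .var (Fin.natAdd n i)) : Fin (n + m) → Expr S (n + m)) = fun i => .var i := by
  funext i
  refine Fin.addCases (fun i => ?_) (fun i => ?_) i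
  · rw [Fin.append_left]
  · rw [Fin.append_right]

theorem append_var_three (n : ℕ) : (Fin.append (fun i => .var (Fin.castAdd 3 i))
    ![.var (Fin.natAdd n 0), .var (Fin.natAdd n 1), .var (Fin.natAdd n 2)] :
      Fin (n + 3) → Expr S (n + 3)) = fun i => .var i := by
  funext i
  revert i
  rw [forall_fin_add_three]
  refine ⟨fun i => ?_, ?_, ?_, ?_⟩
  · rw [Fin.append_left]
  all_goals rw [Fin.append_right]; rfl

theorem ext_var (n : ℕ) : (ext (fun i => .var i.castSucc) (.var (Fin.last n)) :
    Fin (n + 1) → Expr S (n + 1)) = fun i => .var i :=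
  snoc_eta (fun i => (Expr.var i : Expr S (n + 1)))

theorem append_three_subst (σ : Fin n → Expr S k) (a b p : Expr S k) (τ : Fin k → Expr S l) :
    (fun i => (Fin.append σ ![a, b, p] i).subst τ) =
      Fin.append (fun i => (σ i).subst τ) ![a.subst τ, b.subst τ, p.subst τ] := by
  rw [append_subst]
  congr 1
  funext i
  fin_cases i <;> rfl

/-- The elimination rule, as an extension property. -/
theorem liftProp_diag {Γ : Ctx S n} {A : Expr S n} (hΓ : T.Wf Γ) (hA : T.Der Γ (isType A))
    {Θ : Tel S (n + 3) m} (hΘ : T.Wf ((Γ.idExt A).append Θ)) :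
    T.LiftProp ((Γ.snoc A).append (Θ.subst (diag A))) ((Γ.idExt A).append Θ)
      (liftSub (diag A) m) := by
  intro B c hB hc
  -- The extension problem is literally the list of premises: the type to be inhabited is the motive
  -- and the given element over the diagonal is the branch. The solution is `J` applied to the
  -- variables.
  have hD : T.ElimData Γ A Θ B c := ⟨hΓ, hA, hΘ, hB, hc⟩
  have h3 := wf_idExt hΓ hA
  have hid := isMor_id hΘ
  have e : (fun i => .var i : Fin (n + 3 + m) → Expr S (n + 3 + m)) =
      Fin.append (Fin.append (fun i => .var (Fin.castAdd m (Fin.castAdd 3 i)))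
        ![.var (Fin.castAdd m (Fin.natAdd n 0)), .var (Fin.castAdd m (Fin.natAdd n 1)),
          .var (Fin.castAdd m (Fin.natAdd n 2))]) (fun i => .var (Fin.natAdd (n + 3) i)) := by
    rw [← append_var]
    congr 1
    have := congrArg (fun f : Fin (n + 3) → Expr S (n + 3) =>
      fun i => (f i).subst (fun i => .var (Fin.castAdd m i))) (append_var_three (S := S) n)
    simp only [append_three_subst] at this
    exact this.symm
  rw [e, isMor_append, isMor_triple] at hid
  obtain ⟨⟨hσ, ha, hb, hp⟩, hz⟩ := hid
  have h1 := hD.elim hΘ hσ ha hb hp hz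
  rw [← e, Expr.subst_var] at h1
  refine ⟨_, h1, ?_⟩
  obtain ⟨hw, hm⟩ := wf_append_subst (wf_snoc hΓ hA) (isMor_diag hΓ hA) hΘ
  have e2 : liftSub (diag A) m = Fin.append (Fin.append
      (fun i => .var (Fin.castAdd m (Fin.castAdd 1 i)))
      ![.var (Fin.castAdd m (Fin.last n)), .var (Fin.castAdd m (Fin.last n)),
        .refl (A.subst (fun i => .var (Fin.castAdd m (Fin.castAdd 1 i))))
          (.var (Fin.castAdd m (Fin.last n)))]) (fun i => .var (Fin.natAdd (n + 1) i)) := by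
    funext i
    refine Fin.addCases (fun i => ?_) (fun i => ?_) i
    · rw [liftSub_castAdd, Fin.append_left]
      revert i
      rw [forall_fin_add_three]
      refine ⟨fun i => ?_, ?_, ?_, ?_⟩ <;> simp only [diag, Fin.append_left, Fin.append_right]
      · rfl
      · rfl
      · rfl
      · refine (Expr.rename_mk_refl _ _ _).trans ?_
        rw [Expr.rename_rename, rename_eq_subst]
        rfl
    · rw [liftSub_natAdd, Fin.append_right]
  have hm' := hm
  rw [e2, isMor_append, isMor_triple] at hm'
  obtain ⟨⟨hσ', ha', -, -⟩, hz'⟩ := hm'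
  have h2 := hD.comp hw hσ' ha' hz'
  rw [← e2] at h2
  have ec : (Fin.append (Fin.append (fun i => .var (Fin.castAdd m (Fin.castAdd 1 i)))
      ![.var (Fin.castAdd m (Fin.last n))]) (fun i => .var (Fin.natAdd (n + 1) i)) :
        Fin (n + 1 + m) → Expr S (n + 1 + m)) = fun i => .var i := by
    rw [← append_var, append_one]
    congr 1
    exact snoc_eta (fun i => (Expr.var (Fin.castAdd m i) : Expr S (n + 1 + m)))
  rw [ec, Expr.subst_var] at h2
  -- It remains to see that `J` at the generic variables, restricted along the diagonal, is `J` at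
  -- `(x, x, r(x))` as it stands in the computation rule.
  convert h2 using 2
  rw [Expr.subst_mk_J, Tel.subst_subst, Expr.subst_subst, Expr.subst_subst, Expr.subst_subst,
    liftSub_liftSub, liftSub_liftSub, liftSub_liftSub, liftSub_liftSub, liftSub_liftSub]
  have eσ : (fun i => (Expr.var (Fin.castAdd m (Fin.castAdd 3 i)) : Expr S (n + 3 + m)).subst
      (liftSub (diag A) m)) = fun i : Fin n => .var (Fin.castAdd m (Fin.castAdd 1 i)) := by
    funext i
    rw [Expr.subst_mk_var, e2, Fin.append_left, Fin.append_left]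
  rw [eσ]
  congr 1
  · rw [Expr.subst_mk_var, e2, Fin.append_left, Fin.append_right]; rfl
  · rw [Expr.subst_mk_var, e2, Fin.append_left, Fin.append_right]; rfl
  · rw [Expr.subst_mk_var, e2, Fin.append_left, Fin.append_right]; rfl
  · funext i
    rw [Expr.subst_mk_var, liftSub_natAdd]

theorem liftProp_diag_zero {Γ : Ctx S n} {A : Expr S n} (hΓ : T.Wf Γ) (hA : T.Der Γ (isType A)) :
    T.LiftProp (Γ.snoc A) (Γ.idExt A) (diag A) := by
  have := liftProp_diag hΓ hA (m := 0) (Θ := fun i => i.elim0)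
    (by rw [Ctx.append_zero]; exact wf_idExt hΓ hA)
  rwa [Ctx.append_zero, Ctx.append_zero, liftSub_zero] at this

/-- The instance with two parameters, which will be a path `t` and an element `e` lying over it. -/
theorem liftProp_diag_two {Γ : Ctx S n} {A : Expr S n} (hΓ : T.Wf Γ) (hA : T.Der Γ (isType A))
    {B : Expr S (n + 3)} {C : Expr S (n + 3 + 1)} (h : T.Wf (((Γ.idExt A).snoc B).snoc C)) :
    T.LiftProp (((Γ.snoc A).snoc (B.subst (diag A))).snoc (C.subst (liftSub (diag A) 1)))
      (((Γ.idExt A).snoc B).snoc C) (liftSub (liftSub (diag A) 1) 1) := by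
  have e : (Γ.idExt A).append (Tel.snoc (Tel.snoc (fun i => i.elim0 : Tel S (n + 3) 0) B) C) =
      ((Γ.idExt A).snoc B).snoc C := by
    rw [Ctx.append_snoc, Ctx.append_snoc, Ctx.append_zero]
  have e2 : (Γ.snoc A).append (Tel.subst
        (Tel.snoc (Tel.snoc (fun i => i.elim0 : Tel S (n + 3) 0) B) C) (diag A)) =
      ((Γ.snoc A).snoc (B.subst (diag A))).snoc (C.subst (liftSub (diag A) 1)) := by
    rw [Tel.subst_snoc, Tel.subst_snoc, Ctx.append_snoc, Ctx.append_snoc, Ctx.append_zero,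
      liftSub_zero]
  have := liftProp_diag hΓ hA (e.symm ▸ h)
  rw [e, e2] at this
  rw [← liftSub_succ (σ := diag A) (k := 1)]
  exact this

theorem morEq_triple {Γ : Ctx S n} {Δ : Ctx S k} {A : Expr S n} {σ τ : Fin n → Expr S k}
    {a b p a' b' p' : Expr S k} :
    T.MorEq Δ (Γ.idExt A) (Fin.append σ ![a, b, p]) (Fin.append τ ![a', b', p']) ↔
      T.MorEq Δ Γ σ τ ∧ T.Der Δ (eqElem a a' (A.subst σ)) ∧ T.Der Δ (eqElem b b' (A.subst σ)) ∧
        T.Der Δ (eqElem p p' (.Id (A.subst σ) a b)) := by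
  rw [append_three, append_three, Ctx.idExt, morEq_snoc, morEq_snoc, morEq_snoc, Expr.subst_mk_Id,
    Expr.subst_rename, Expr.subst_rename, and_assoc, and_assoc]
  have h1 : (fun i => Fin.snoc (α := fun _ => Expr S k) σ a (Fin.castAdd 1 i)) = σ :=
    funext fun i => Fin.snoc_castSucc (α := fun _ => Expr S k) a σ i
  have h2 : (fun i => Fin.snoc (α := fun _ => Expr S k)
      (Fin.snoc (α := fun _ => Expr S k) σ a) b (Fin.castAdd 2 i)) = σ := by
    funext i
    refine (Fin.snoc_castSucc (α := fun _ => Expr S k) b _ i.castSucc).trans ?_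
    exact Fin.snoc_castSucc (α := fun _ => Expr S k) a σ i
  have h3 : Fin.snoc (α := fun _ => Expr S k) (Fin.snoc (α := fun _ => Expr S k) σ a) b
      (Fin.natAdd n (0 : Fin 2)) = a :=
    (Fin.snoc_castSucc (α := fun _ => Expr S k) b _ (Fin.last n)).trans
      (Fin.snoc_last (α := fun _ => Expr S k) a σ)
  have h4 : Fin.snoc (α := fun _ => Expr S k) (Fin.snoc (α := fun _ => Expr S k) σ a) b
      (Fin.natAdd n (1 : Fin 2)) = b :=
    Fin.snoc_last (α := fun _ => Expr S k) b _
  rw [h1, h2, Expr.subst_mk_var, Expr.subst_mk_var, h3, h4]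

theorem idExt_var {Γ : Ctx S n} {A : Expr S n} (hΓ : T.Wf Γ) (hA : T.Der Γ (isType A)) :
    T.IsMor (Γ.idExt A) Γ (fun i => .var (Fin.castAdd 3 i)) ∧
    T.Der (Γ.idExt A) (isElem (.var (Fin.natAdd n 0)) (A.subst fun i => .var (Fin.castAdd 3 i))) ∧
    T.Der (Γ.idExt A) (isElem (.var (Fin.natAdd n 1)) (A.subst fun i => .var (Fin.castAdd 3 i))) ∧
    T.Der (Γ.idExt A) (isElem (.var (Fin.natAdd n 2)) (.Id (A.subst fun i => .var (Fin.castAdd 3 i))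
      (.var (Fin.natAdd n 0)) (.var (Fin.natAdd n 1)))) := by
  have hid := isMor_id (wf_idExt hΓ hA)
  rwa [← append_var_three, isMor_triple] at hid

/-- No congruence rule for `J` is assumed. Transport is a substitution instance of one term `hU`
over the context of generic `x, y, u` and an element of `E(x)`, so the claim is substitution of
definitionally equal elements. -/
theorem transportOne_congr {Γ : Ctx S n} {A : Expr S n} (hΓ : T.Wf Γ) (hA : T.Der Γ (isType A))
    {Δ : Ctx S k} (hΔ : T.Wf Δ) {σ : Fin n → Expr S k} (hσ : T.IsMor Δ Γ σ)
    {E : Expr S (n + 1)} (hE : T.Der (Γ.snoc A) (isType E)) {a b p e a' b' p' e' : Expr S k}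
    (ha : T.Der Δ (eqElem a a' (A.subst σ))) (hb : T.Der Δ (eqElem b b' (A.subst σ)))
    (hp : T.Der Δ (eqElem p p' (.Id (A.subst σ) a b)))
    (he : T.Der Δ (eqElem e e' (E.subst (ext σ a)))) :
    T.Der Δ (eqElem (transportOne Γ A E σ a b p e) (transportOne Γ A E σ a' b' p' e')
      (E.subst (ext σ b))) := by
  have hw := wf_snoc hΓ hA
  have h3 := wf_idExt hΓ hA
  obtain ⟨hv, hx, hy, hu⟩ := idExt_var hΓ hA
  have hEx := T.subst h3 hw (isMor_snoc.2 ⟨hv, hx⟩) hE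
  rw [Judgement.subst] at hEx
  have h4 := wf_snoc h3 hEx
  have hwk := isMor_castSucc h4
  have hv' := isMor_comp h4 h3 hwk hv
  have hx' := T.subst h4 h3 hwk hx
  have hy' := T.subst h4 h3 hwk hy
  have hu' := T.subst h4 h3 hwk hu
  have hc' := der_var h4 (Fin.last _)
  rw [Ctx.typ_snoc_last, rename_eq_subst, Expr.subst_subst, ext_subst] at hc'
  simp only [Judgement.subst, Expr.subst_subst, Expr.subst_mk_Id, Expr.subst_mk_var]
    at hv' hx' hy' hu' hc'
  have hU := transportOne_elem hΓ hA h4 hv' hE hx' hy' hu' hc'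
  have key : ∀ a b p e : Expr S k, (transportOne Γ A E
      (fun i => (.var (Fin.castAdd 3 i).castSucc : Expr S (n + 3 + 1)))
      (.var (Fin.natAdd n 0).castSucc) (.var (Fin.natAdd n 1).castSucc)
      (.var (Fin.natAdd n 2).castSucc) (.var (Fin.last _))).subst
        (ext (Fin.append σ ![a, b, p]) e) = transportOne Γ A E σ a b p e := fun a b p e => by
    rw [transportOne_subst]
    simp only [Expr.subst_mk_var, Fin.snoc_castSucc, Fin.snoc_last, Fin.append_left,
      Fin.append_right, Matrix.cons_val]
  have keyE : ∀ a b p e : Expr S k, (E.subst (ext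
      (fun i => (.var (Fin.castAdd 3 i).castSucc : Expr S (n + 3 + 1)))
      (.var (Fin.natAdd n 1).castSucc))).subst
        (ext (Fin.append σ ![a, b, p]) e) = E.subst (ext σ b) := fun a b p e => by
    rw [Expr.subst_subst, ext_subst]
    simp only [Expr.subst_mk_var, Fin.snoc_castSucc, Fin.append_left,
      Fin.append_right, Matrix.cons_val]
  have keyx : ∀ a b p : Expr S k, (E.subst (ext
      (fun i => (.var (Fin.castAdd 3 i) : Expr S (n + 3)))
      (.var (Fin.natAdd n 0)))).subst (Fin.append σ ![a, b, p]) = E.subst (ext σ a) :=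
    fun a b p => by
    rw [Expr.subst_subst, ext_subst]
    simp only [Expr.subst_mk_var, Fin.append_left, Fin.append_right, Matrix.cons_val]
  have ha1 := T.presup_eqElem hΔ ha
  have hb1 := T.presup_eqElem hΔ hb
  have hp1 := T.presup_eqElem hΔ hp
  have he1 := T.presup_eqElem hΔ he
  have hrσ := morEq_refl hΔ hσ
  have m1 := isMor_snoc.2 ⟨isMor_triple.2 ⟨hσ, ha1.1, hb1.1, hp1.1⟩, (keyx a b p).symm ▸ he1.1⟩
  have m2 := isMor_snoc.2 ⟨isMor_triple.2 ⟨hσ, ha1.2, hb1.2,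
    T.conv_elem hΔ hp1.2 (eqType_Id hΔ ha hb)⟩, (keyx a' b' p').symm ▸ T.conv_elem hΔ he1.2
      (T.subst_eqType hΔ hw (isMor_snoc.2 ⟨hσ, ha1.1⟩) (isMor_snoc.2 ⟨hσ, ha1.2⟩)
        (morEq_snoc.2 ⟨hrσ, ha⟩) hE)⟩
  have m3 := morEq_snoc.2 ⟨morEq_triple.2 ⟨hrσ, ha, hb, hp⟩, (keyx a b p).symm ▸ he⟩
  have := T.subst_eqElem hΔ h4 m1 m2 m3 hU
  rwa [key, key, keyE] at this

end TypeTheory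

namespace TypeTheory
variable {T : TypeTheory S} {n m k l : ℕ}

theorem diag_subst_ext (A : Expr S n) (σ : Fin n → Expr S k) (x : Expr S k) :
    (fun i => (diag A i).subst (ext σ x)) = Fin.append σ ![x, x, .refl (A.subst σ) x] := by
  have h : ∀ i : Fin n, ext σ x (Fin.castAdd 1 i) = σ i := fun i =>
    Fin.snoc_castSucc (α := fun _ => Expr S k) x σ i
  have h' : ext σ x (Fin.natAdd n (0 : Fin 1)) = x :=
    Fin.snoc_last (α := fun _ => Expr S k) x σ
  rw [diag, append_three_subst, Expr.subst_mk_refl, Expr.subst_rename, Expr.subst_mk_var]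
  simp only [Expr.subst_mk_var, h, h']

/-- Composition with an identity is the identity, up to an identity. -/
theorem exists_pathComp_unit {Γ : Ctx S n} {A : Expr S n} (hΓ : T.Wf Γ)
    (hA : T.Der Γ (isType A)) : ∃ t : Expr S (n + 3), ∀ {k : ℕ} {Δ : Ctx S k}
      {σ : Fin n → Expr S k}, T.Wf Δ → T.IsMor Δ Γ σ →
      (∀ {x y p : Expr S k}, T.Der Δ (isElem x (A.subst σ)) → T.Der Δ (isElem y (A.subst σ)) →
        T.Der Δ (isElem p (.Id (A.subst σ) x y)) →
        T.Der Δ (isElem (t.subst (Fin.append σ ![x, y, p])) (.Id (.Id (A.subst σ) x y)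
          (pathComp Γ A σ x x y p (.refl (A.subst σ) x)) p))) ∧
      ∀ {x : Expr S k}, T.Der Δ (isElem x (A.subst σ)) →
        T.Der Δ (eqElem (t.subst (Fin.append σ ![x, x, .refl (A.subst σ) x]))
          (.refl (.Id (A.subst σ) x x) (.refl (A.subst σ) x))
          (.Id (.Id (A.subst σ) x x) (pathComp Γ A σ x x x (.refl (A.subst σ) x)
            (.refl (A.subst σ) x)) (.refl (A.subst σ) x))) := by
  have h1 := wf_snoc hΓ hA
  have h3 := wf_idExt hΓ hA
  obtain ⟨hv, hx, hy, hu⟩ := idExt_var hΓ hA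
  have hA3 := T.presup_elem h3 hx
  have hr := T.id_intro h3 hx
  have hB := T.id_form h3 (T.id_form h3 hA3 hx hy) (pathComp_elem hΓ hA h3 hv hx hx hy hu hr) hu
  have key : ∀ {k : ℕ} (σ : Fin n → Expr S k) (x y p : Expr S k),
      (Expr.Id (.Id (A.subst fun i => .var (Fin.castAdd 3 i)) (.var (Fin.natAdd n 0))
          (.var (Fin.natAdd n 1)))
        (pathComp Γ A (fun i => .var (Fin.castAdd 3 i)) (.var (Fin.natAdd n 0))
          (.var (Fin.natAdd n 0)) (.var (Fin.natAdd n 1)) (.var (Fin.natAdd n 2))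
          (.refl (A.subst fun i => .var (Fin.castAdd 3 i)) (.var (Fin.natAdd n 0))))
        (.var (Fin.natAdd n 2))).subst (Fin.append σ ![x, y, p]) =
      .Id (.Id (A.subst σ) x y) (pathComp Γ A σ x x y p (.refl (A.subst σ) x)) p := by
    intro k σ x y p
    rw [Expr.subst_mk_Id, Expr.subst_mk_Id, pathComp_subst, Expr.subst_mk_refl, Expr.subst_subst]
    simp only [Expr.subst_mk_var, Fin.append_left, Fin.append_right, Matrix.cons_val]
  have hσ1 := isMor_castSucc h1
  have hx1 := der_var h1 (Fin.last n)
  rw [Ctx.typ_snoc_last, rename_eq_subst] at hx1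
  have hA1 := T.presup_elem h1 hx1
  have hr1 := T.id_intro h1 hx1
  have hp1 := pathComp_refl hΓ hA h1 hσ1 hx1 hx1 hr1
  have hE1 := eqType_Id h1 (A := .Id (A.subst fun i => .var i.castSucc) (.var (Fin.last n))
    (.var (Fin.last n))) hp1 (T.eqElem_refl h1 hr1)
  have ed : diag A = Fin.append (fun i => (.var i.castSucc : Expr S (n + 1)))
      ![.var (Fin.last n), .var (Fin.last n),
        .refl (A.subst fun i => .var i.castSucc) (.var (Fin.last n))] := by
    rw [← diag_subst_ext, ext_var]
    exact funext fun i => (Expr.subst_var _).symm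
  -- At `p = r(x)` the composite is `r(x)` definitionally, so `r(r(x))` is a valid branch after
  -- conversion. Keeping one raw term `t` makes both its typing and its value at reflexivity stable
  -- under all substitutions.
  obtain ⟨t, ht, ht'⟩ := liftProp_diag_zero hΓ hA _ _ hB (by
    rw [ed, key]
    exact T.conv_elem h1 (T.id_intro h1 hr1) (T.eqType_symm h1 hE1))
  refine ⟨t, fun {k Δ σ} hΔ hσ => ⟨fun {x y p} hx hy hp => ?_, fun {x} hx => ?_⟩⟩
  · have := T.subst hΔ h3 (isMor_triple.2 ⟨hσ, hx, hy, hp⟩) ht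
    rwa [Judgement.subst, key] at this
  · have := T.subst hΔ h1 (isMor_snoc.2 ⟨hσ, hx⟩) ht'
    rw [Judgement.subst, Expr.subst_subst, Expr.subst_subst, diag_subst_ext, key] at this
    simpa only [Expr.subst_mk_refl, Expr.subst_mk_Id, Expr.subst_subst, Expr.subst_mk_var,
      Fin.snoc_castSucc, Fin.snoc_last] using this

/-- Transport along composition with an identity in the based path space. -/
theorem exists_transport_pathComp {Γ : Ctx S n} {A a : Expr S n} (hΓ : T.Wf Γ)
    (ha : T.Der Γ (isElem a A)) {C : Expr S (n + 1 + 1)}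
    (hC : T.Der ((Γ.snoc A).snoc (.Id (A.rename Fin.castSucc) (a.rename Fin.castSucc)
      (.var (Fin.last n)))) (isType C)) :
    ∃ d : Expr S (n + 3 + 1 + 1), ∀ {k : ℕ} {Δ : Ctx S k}
      {σ : Fin n → Expr S k}, T.Wf Δ → T.IsMor Δ Γ σ →
      (∀ {x y p t e : Expr S k}, T.Der Δ (isElem x (A.subst σ)) →
        T.Der Δ (isElem y (A.subst σ)) → T.Der Δ (isElem p (.Id (A.subst σ) x y)) →
        T.Der Δ (isElem t (.Id (A.subst σ) (a.subst σ) x)) →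
        T.Der Δ (isElem e (C.subst (ext (ext σ x) t))) →
        T.Der Δ (isElem (d.subst (ext (ext (Fin.append σ ![x, y, p]) t) e))
          (C.subst (ext (ext σ y) (pathComp Γ A σ (a.subst σ) x y p t))))) ∧
      ∀ {x t e : Expr S k}, T.Der Δ (isElem x (A.subst σ)) →
        T.Der Δ (isElem t (.Id (A.subst σ) (a.subst σ) x)) →
        T.Der Δ (isElem e (C.subst (ext (ext σ x) t))) →
        T.Der Δ (eqElem (d.subst (ext (ext (Fin.append σ ![x, x, .refl (A.subst σ) x]) t) e)) e
          (C.subst (ext (ext σ x) (pathComp Γ A σ (a.subst σ) x x (.refl (A.subst σ) x) t)))) := by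
  have hA := T.presup_elem hΓ ha
  have h1 := wf_snoc hΓ hA
  have hP : T.Der (Γ.snoc A) (isType (.Id (A.rename Fin.castSucc) (a.rename Fin.castSucc)
      (.var (Fin.last n)))) := by
    have hx1 := der_var h1 (Fin.last n)
    rw [Ctx.typ_snoc_last] at hx1
    have ha1 := der_wk_one h1 ha
    simp only [Judgement.subst, ← rename_eq_subst] at ha1
    exact T.id_form h1 (T.presup_elem h1 hx1) ha1 hx1
  have hPw := wf_snoc h1 hP
  have h3 := wf_idExt hΓ hA
  obtain ⟨hv, hx, hy, hu⟩ := idExt_var hΓ hA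
  have hmP : ∀ {k : ℕ} {Δ : Ctx S k} {σ : Fin n → Expr S k} {x t : Expr S k}, T.IsMor Δ Γ σ →
      T.Der Δ (isElem x (A.subst σ)) → T.Der Δ (isElem t (.Id (A.subst σ) (a.subst σ) x)) →
      T.IsMor Δ ((Γ.snoc A).snoc (.Id (A.rename Fin.castSucc) (a.rename Fin.castSucc)
        (.var (Fin.last n)))) (ext (ext σ x) t) := by
    intro k Δ σ x t hσ hx ht
    refine isMor_snoc.2 ⟨isMor_snoc.2 ⟨hσ, hx⟩, ?_⟩
    simpa only [Expr.subst_mk_Id, Expr.subst_rename, Expr.subst_mk_var, Fin.snoc_castSucc,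
      Fin.snoc_last] using ht
  -- The parameters `Θ` of the elimination: first `t ∈ Id_A(a, x)`, then `e ∈ C(x, t)`. Both types
  -- vary with the endpoint `x`, so they must be generalised along with it; no function type could
  -- hold them instead.
  have hT1 := T.id_form h3 (T.presup_elem h3 hx) (T.subst h3 hΓ hv ha) hx
  have h4 := wf_snoc h3 hT1
  have hw4 := isMor_castSucc h4
  have ht4 := der_var h4 (Fin.last _)
  have hv4 := isMor_comp h4 h3 hw4 hv
  have hx4 := T.subst h4 h3 hw4 hx
  rw [Ctx.typ_snoc_last, rename_eq_subst] at ht4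
  simp only [Judgement.subst, Expr.subst_subst, Expr.subst_mk_Id, Expr.subst_mk_var]
    at hv4 hx4 ht4
  have hT2 := T.subst h4 hPw (hmP hv4 hx4 ht4) hC
  have h5 := wf_snoc h4 hT2
  have hw5 := isMor_castSucc h5
  have ht5 := T.subst h5 h4 hw5 ht4
  have hv5 := isMor_comp h5 h4 hw5 hv4
  have hx5 := T.subst h5 h4 hw5 hx4
  have hy5 := T.subst h5 h4 hw5 (T.subst h4 h3 hw4 hy)
  have hu5 := T.subst h5 h4 hw5 (T.subst h4 h3 hw4 hu)
  have he5 := der_var h5 (Fin.last _)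
  rw [Ctx.typ_snoc_last, rename_eq_subst] at he5
  simp only [Judgement.subst, Expr.subst_subst, Expr.subst_mk_Id, Expr.subst_mk_var]
    at hv5 hx5 ht5 hy5 hu5 he5
  have ha5 := T.subst h5 hΓ hv5 ha
  have hB := T.subst h5 hPw (hmP hv5 hy5 (pathComp_elem hΓ hA h5 hv5 ha5 hx5 hy5 hu5 ht5)) hC
  rw [Judgement.subst] at hB
  have key : ∀ {k : ℕ} (σ : Fin n → Expr S k) (x y p t e : Expr S k),
      (C.subst (ext (ext
        (fun i => (.var (Fin.castAdd 3 i).castSucc.castSucc : Expr S (n + 3 + 1 + 1)))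
        (.var (Fin.natAdd n 1).castSucc.castSucc))
        (pathComp Γ A (fun i => .var (Fin.castAdd 3 i).castSucc.castSucc)
          (a.subst fun i => .var (Fin.castAdd 3 i).castSucc.castSucc)
          (.var (Fin.natAdd n 0).castSucc.castSucc) (.var (Fin.natAdd n 1).castSucc.castSucc)
          (.var (Fin.natAdd n 2).castSucc.castSucc) (.var (Fin.last (n + 3)).castSucc)))).subst
        (ext (ext (Fin.append σ ![x, y, p]) t) e) =
      C.subst (ext (ext σ y) (pathComp Γ A σ (a.subst σ) x y p t)) := by
    intro k σ x y p t e
    rw [Expr.subst_subst, ext_subst, ext_subst, pathComp_subst, Expr.subst_subst]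
    simp only [Expr.subst_mk_var, Fin.snoc_castSucc, Fin.snoc_last, Fin.append_left,
      Fin.append_right, Matrix.cons_val]
  have hd1 := isMor_diag hΓ hA
  have keyd : ∀ {k : ℕ} (σ : Fin n → Expr S k) (x t e : Expr S k),
      (fun i => (liftSub (liftSub (diag A) 1) 1 i).subst (ext (ext (ext σ x) t) e)) =
        ext (ext (Fin.append σ ![x, x, .refl (A.subst σ) x]) t) e := by
    intro k σ x t e
    rw [liftSub_one_snoc, liftSub_one_snoc, diag_subst_ext]
  have keyT1 : ∀ {k : ℕ} (σ : Fin n → Expr S k) (x y p : Expr S k),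
      (Expr.Id (A.subst fun i => (.var (Fin.castAdd 3 i) : Expr S (n + 3)))
        (a.subst fun i => .var (Fin.castAdd 3 i)) (.var (Fin.natAdd n 0))).subst
        (Fin.append σ ![x, y, p]) = .Id (A.subst σ) (a.subst σ) x := by
    intro k σ x y p
    rw [Expr.subst_mk_Id, Expr.subst_subst, Expr.subst_subst]
    simp only [Expr.subst_mk_var, Fin.append_left, Fin.append_right, Matrix.cons_val]
  have keyT2 : ∀ {k : ℕ} (σ : Fin n → Expr S k) (x y p t : Expr S k),
      (C.subst (ext (ext (fun i => (.var (Fin.castAdd 3 i).castSucc : Expr S (n + 3 + 1)))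
        (.var (Fin.natAdd n 0).castSucc)) (.var (Fin.last (n + 3))))).subst
        (ext (Fin.append σ ![x, y, p]) t) = C.subst (ext (ext σ x) t) := by
    intro k σ x y p t
    rw [Expr.subst_subst, ext_subst, ext_subst]
    simp only [Expr.subst_mk_var, Fin.snoc_castSucc, Fin.snoc_last, Fin.append_left,
      Fin.append_right, Matrix.cons_val]
  have hmW : ∀ {k : ℕ} {Δ : Ctx S k} {σ : Fin n → Expr S k} {x y p t e : Expr S k},
      T.IsMor Δ (((Γ.idExt A).snoc
        (.Id (A.subst fun i => .var (Fin.castAdd 3 i)) (a.subst fun i => .var (Fin.castAdd 3 i))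
          (.var (Fin.natAdd n 0)))).snoc
        (C.subst (ext (ext (fun i => .var (Fin.castAdd 3 i).castSucc)
          (.var (Fin.natAdd n 0).castSucc)) (.var (Fin.last (n + 3)))))) (ext (ext (Fin.append σ ![x, y, p]) t) e) ↔
      (T.IsMor Δ (Γ.idExt A) (Fin.append σ ![x, y, p]) ∧
        T.Der Δ (isElem t (.Id (A.subst σ) (a.subst σ) x))) ∧
        T.Der Δ (isElem e (C.subst (ext (ext σ x) t))) := by
    intro k Δ σ x y p t e
    rw [← keyT1 σ x y p, ← keyT2 σ x y p t]
    exact isMor_snoc.trans (and_congr_left' isMor_snoc)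
  obtain ⟨g2, hm2⟩ := isMor_liftSub_one h1 hd1 h4
  obtain ⟨g3, hm3⟩ := isMor_liftSub_one g2 hm2 h5
  -- The lifted diagonal in components: `keyd` at the generic tuple `(x, t, e)`, which `eV`
  -- recognises as the identity substitution.
  have eW := keyd (fun i => (.var i.castSucc.castSucc.castSucc : Expr S (n + 1 + 1 + 1)))
    (.var (Fin.last n).castSucc.castSucc) (.var (Fin.last (n + 1)).castSucc)
    (.var (Fin.last (n + 2)))
  have eV : ext (ext (ext (fun i => (.var i.castSucc.castSucc.castSucc : Expr S (n + 1 + 1 + 1)))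
    (.var (Fin.last n).castSucc.castSucc)) (.var (Fin.last (n + 1)).castSucc))
    (.var (Fin.last (n + 2))) = fun i => .var i := by
    rw [← ext_var, ← snoc_eta (fun i : Fin (n + 1 + 1) => (.var i.castSucc : Expr S (n + 1 + 1 + 1))),
      ← snoc_eta (fun i : Fin (n + 1) => (.var i.castSucc.castSucc : Expr S (n + 1 + 1 + 1)))]
  rw [eV] at eW
  simp only [Expr.subst_var] at eW
  replace eW : liftSub (liftSub (diag A) 1) 1 = _ := eW
  -- Over the diagonal the composite of `t` with `r(x)` is `t` definitionally, so source and target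
  -- of the transport are equal types and the variable `e` can serve as the branch.
  have hconv : ∀ {k : ℕ} {Δ : Ctx S k} {σ : Fin n → Expr S k} {x t : Expr S k}, T.Wf Δ →
      T.IsMor Δ Γ σ → T.Der Δ (isElem x (A.subst σ)) →
      T.Der Δ (isElem t (.Id (A.subst σ) (a.subst σ) x)) →
      T.Der Δ (eqType (C.subst (ext (ext σ x) t))
        (C.subst (ext (ext σ x) (pathComp Γ A σ (a.subst σ) x x (.refl (A.subst σ) x) t)))) := by
    intro k Δ σ x t hΔ hσ hx ht
    have haσ := T.subst hΔ hΓ hσ ha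
    have hr := pathComp_refl hΓ hA hΔ hσ haσ hx ht
    refine T.eqType_symm hΔ (T.subst_eqType hΔ hPw
      (hmP hσ hx (T.presup_eqElem hΔ hr).1) (hmP hσ hx ht) ?_ hC)
    refine morEq_snoc.2 ⟨morEq_refl hΔ (isMor_snoc.2 ⟨hσ, hx⟩), ?_⟩
    simpa only [Expr.subst_mk_Id, Expr.subst_rename, Expr.subst_mk_var, Fin.snoc_castSucc,
      Fin.snoc_last] using hr
  have hm3' := hm3
  rw [eW] at hm3'
  obtain ⟨⟨hm4, htW⟩, heW⟩ := hmW.1 hm3'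
  obtain ⟨hσW, hxW, -, -⟩ := isMor_triple.1 hm4
  obtain ⟨d, hd, hd'⟩ := liftProp_diag_two hΓ hA h5 _ (.var (Fin.last (n + 2))) hB (by
    rw [eW, key]
    exact T.conv_elem g3 heW (hconv g3 hσW hxW htW))
  refine ⟨d, fun {k Δ σ} hΔ hσ => ⟨fun {x y p t e} hx hy hp ht he => ?_,
    fun {x t e} hx ht he => ?_⟩⟩
  · have := T.subst hΔ h5 (hmW.2 ⟨⟨isMor_triple.2 ⟨hσ, hx, hy, hp⟩, ht⟩, he⟩) hd
    rwa [Judgement.subst, key] at this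
  · have hm : T.IsMor Δ _ (ext (ext (ext σ x) t) e) :=
      isMor_snoc.2 ⟨isMor_snoc.2 ⟨isMor_snoc.2 ⟨hσ, hx⟩, by
        rw [Expr.subst_subst, diag_subst_ext A, keyT1]; exact ht⟩, by
        rw [Expr.subst_subst, liftSub_one_snoc, diag_subst_ext A, keyT2]; exact he⟩
    have := T.subst hΔ g3 hm hd'
    rw [Judgement.subst, Expr.subst_subst, Expr.subst_subst, keyd, key, Expr.subst_mk_var] at this
    simpa only [Fin.snoc_last] using this

/-- The based path space `(x ∈ A, u ∈ Id_A(a, x))` as an extension of a context. -/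
def basedPath (Γ : Ctx S n) (A a : Expr S n) : Ctx S (n + 1 + 1) :=
  (Γ.snoc A).snoc (.Id (A.rename Fin.castSucc) (a.rename Fin.castSucc) (.var (Fin.last n)))

theorem isMor_basedPath {Γ : Ctx S n} {Δ : Ctx S k} {A a : Expr S n} {σ : Fin n → Expr S k}
    {x t : Expr S k} : T.IsMor Δ (basedPath Γ A a) (ext (ext σ x) t) ↔ (T.IsMor Δ Γ σ ∧
      T.Der Δ (isElem x (A.subst σ))) ∧ T.Der Δ (isElem t (.Id (A.subst σ) (a.subst σ) x)) := by
  rw [basedPath, isMor_snoc, isMor_snoc]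
  simp only [Expr.subst_mk_Id, Expr.subst_rename, Expr.subst_mk_var, Fin.snoc_castSucc,
    Fin.snoc_last]

theorem wf_basedPath {Γ : Ctx S n} {A a : Expr S n} (hΓ : T.Wf Γ)
    (ha : T.Der Γ (isElem a A)) : T.Wf (basedPath Γ A a) := by
  have h1 := wf_snoc hΓ (T.presup_elem hΓ ha)
  have hx1 := der_var h1 (Fin.last n)
  rw [Ctx.typ_snoc_last] at hx1
  have ha1 := der_wk_one h1 ha
  simp only [Judgement.subst, ← rename_eq_subst] at ha1
  exact wf_snoc h1 (T.id_form h1 (T.presup_elem h1 hx1) ha1 hx1)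

/-- Based path induction. -/
theorem liftProp_basedPath {Γ : Ctx S n} {A a : Expr S n} (hΓ : T.Wf Γ)
    (ha : T.Der Γ (isElem a A)) :
    T.LiftProp Γ (basedPath Γ A a) (ext (ext (fun i => .var i) a) (.refl A a)) := by
  intro C c hC hc
  have hA := T.presup_elem hΓ ha
  have hP := wf_basedPath hΓ ha
  have h1 := (wf_snoc_iff.1 hP).1
  have hI := (wf_snoc_iff.1 hP).2
  -- For `u ∈ Id_A(a, x)`, `d` carries `c ∈ C(a, r(a))` to an element over the composite of `r(a)`
  -- and `u`. That composite need not equal `u` definitionally; `t` is an identity from it to `u`,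
  -- along which a second transport lands in `C(x, u)`.
  obtain ⟨t, ht⟩ := exists_pathComp_unit hΓ hA
  obtain ⟨d, hd⟩ := exists_transport_pathComp hΓ ha hC
  have eV : ext (ext (fun i => (.var i.castSucc.castSucc : Expr S (n + 1 + 1)))
      (.var (Fin.last n).castSucc)) (.var (Fin.last (n + 1))) = fun i => .var i := by
    rw [← ext_var, ← snoc_eta (fun i : Fin (n + 1) => (.var i.castSucc : Expr S (n + 1 + 1)))]
  have hid := isMor_id hP
  rw [← eV] at hid
  obtain ⟨⟨hσ, hx⟩, hu⟩ := isMor_basedPath.1 hid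
  have haσ := T.subst hP hΓ hσ ha
  have hcσ := T.subst hP hΓ hσ hc
  have hιτ : ∀ {k : ℕ} (τ : Fin n → Expr S k),
      (fun i => (ext (ext (fun i => .var i) a) (.refl A a) i).subst τ) =
        ext (ext τ (a.subst τ)) (.refl (A.subst τ) (a.subst τ)) := by
    intro k τ
    rw [ext_subst, ext_subst, Expr.subst_mk_refl]
    rfl
  rw [Judgement.subst, Expr.subst_subst, hιτ] at hcσ
  have hr := T.id_intro hP haσ
  have hq := pathComp_elem hΓ hA hP hσ haσ haσ hx hu hr
  have htσ := (ht hP hσ).1 haσ hx hu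
  have hdσ := (hd hP hσ).1 haσ hx hu hr hcσ
  have eI : ∀ {k : ℕ} (σ : Fin n → Expr S k) (x : Expr S k),
      (Expr.Id (A.rename Fin.castSucc) (a.rename Fin.castSucc) (.var (Fin.last n))).subst
        (ext σ x) = .Id (A.subst σ) (a.subst σ) x := by
    intro k σ x
    simp only [Expr.subst_mk_Id, Expr.subst_rename, Expr.subst_mk_var, Fin.snoc_castSucc,
      Fin.snoc_last]
  -- The correction takes place with `x` fixed: the endpoints of the identity `t` are two elements
  -- of the type `Id_A(a, x)`.
  have he := transportOne_elem h1 hI hP (isMor_snoc.2 ⟨hσ, hx⟩) hC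
    (b := .var (Fin.last (n + 1))) (by rwa [eI]) (by rwa [eI])
    (by rwa [eI]) hdσ
  rw [eV, Expr.subst_var] at he
  refine ⟨_, he, ?_⟩
  have hv := isMor_id hΓ
  have ha' : T.Der Γ (isElem a (A.subst fun i => .var i)) := by rwa [Expr.subst_var]
  have hc' : T.Der Γ (isElem c (C.subst (ext (ext (fun i => .var i) a)
      (.refl (A.subst fun i => .var i) a)))) := by rwa [Expr.subst_var]
  have hr' := T.id_intro hΓ ha'
  have ea := Expr.subst_var a
  -- At `x = a`, `u = r(a)` every ingredient computes: the composite to `r(a)`, `t` to `r(r(a))`,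
  -- and `d` to `c`. By congruence the extension equals the transport of `c` along `r(r(a))`, which
  -- is `c`.
  have h2 := pathComp_refl hΓ hA hΓ hv ha' ha' hr'
  have ht' := (ht hΓ hv).2 ha'
  have hd' := (hd hΓ hv).2 ha' (by rwa [ea]) hc'
  rw [ea] at hd'
  have hE := eqType_Id hΓ (A := .Id (A.subst fun i => .var i) a a) h2 (T.eqElem_refl hΓ hr')
  have hva := isMor_snoc.2 ⟨hv, ha'⟩
  have hcongr := transportOne_congr h1 hI hΓ hva hC (by rw [eI, ea]; exact h2)
    (T.eqElem_refl hΓ (by rw [eI, ea]; exact hr')) (by rw [eI, ea]; exact ht') hd'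
  have hrefl := transportOne_refl h1 hI hΓ hva hC (a := .refl (A.subst fun i => .var i) a)
    (by rw [eI, ea]; exact hr') hc'
  rw [eI, ea] at hrefl
  have := T.eqElem_trans hΓ hcongr hrefl
  convert this using 2
  · rw [transportOne_subst, ext_subst, pathComp_subst, Expr.subst_subst, Expr.subst_subst d,
      ext_subst, ext_subst, append_three_subst, Expr.subst_subst c, Expr.subst_mk_refl,
      Expr.subst_subst, Expr.subst_subst, Expr.subst_subst t, append_three_subst]
    simp only [Expr.subst_mk_var, Expr.subst_subst, Fin.snoc_castSucc, Fin.snoc_last,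
      Expr.subst_var]
  · rw [Expr.subst_var]

end TypeTheory

/-! ## Mapping path spaces -/

/-- The context `(x ∈ Φ, y ∈ Ψ, u ∈ Id_Ψ(f(x), y))`. -/
def pathOver {n m : ℕ} (Φ : Ctx S n) (Ψ : Ctx S m) (f : Fin m → Expr S n) : Ctx S (n + m + m) :=
  (Φ.append (Ψ.toTel n)).append
    (idCtxAt Ψ (fun i => (f i).rename (Fin.castAdd m)) (fun i => .var (Fin.natAdd n i)))

theorem idCtxAt_subst {n k l : ℕ} (Ψ : Ctx S n) (a b : Fin n → Expr S k) (τ : Fin k → Expr S l) :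
    (idCtxAt Ψ a b).subst τ = idCtxAt Ψ (fun i => (a i).subst τ) (fun i => (b i).subst τ) := by
  rw [idCtxAt, Tel.subst_subst, append_subst]; rfl

namespace TypeTheory
variable {T : TypeTheory S} {n m k l : ℕ}

theorem idCtxAt_pathOver_subst (Ψ : Ctx S m) (f : Fin m → Expr S n) (σ : Fin n → Expr S k)
    (y : Fin m → Expr S k) :
    (idCtxAt Ψ (fun i => (f i).rename (Fin.castAdd m))
      (fun i => .var (Fin.natAdd n i))).subst (Fin.append σ y) =
      idCtxAt Ψ (fun i => (f i).subst σ) y := by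
  rw [idCtxAt_subst]
  simp only [Expr.subst_rename, Expr.subst_mk_var, Fin.append_left, Fin.append_right]

theorem isMor_pathOver' {Φ : Ctx S n} {Ψ : Ctx S m} {f : Fin m → Expr S n}
    {Δ : Ctx S k} {σ : Fin n → Expr S k} {y u : Fin m → Expr S k} :
    T.IsMor Δ (pathOver Φ Ψ f) (Fin.append (Fin.append σ y) u) ↔
      (T.IsMor Δ Φ σ ∧ T.IsMor Δ Ψ y) ∧ T.IsElemTel Δ (idCtxAt Ψ (fun i => (f i).subst σ) y) u := by
  rw [pathOver, isMor_append, isMor_append_toTel, idCtxAt_pathOver_subst]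

theorem isMor_pathOver {Φ : Ctx S n} {Ψ : Ctx S m} {f : Fin m → Expr S n} (hΦ : T.Wf Φ)
    (hf : T.IsMor Φ Ψ f) {Δ : Ctx S k} (hΔ : T.Wf Δ) {σ : Fin n → Expr S k}
    {y u : Fin m → Expr S k} :
    T.IsMor Δ (pathOver Φ Ψ f) (Fin.append (Fin.append σ y) u) ↔
      T.IsMor Δ Φ σ ∧ T.IsMor Δ Ψ.path (tri (fun i => (f i).subst σ) y u) := by
  rw [isMor_pathOver', isMor_path_iff', and_assoc]
  exact ⟨fun h => ⟨h.1, isMor_comp hΔ hΦ h.1 hf, h.2⟩, fun h => ⟨h.1, h.2.2⟩⟩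

theorem wf_pathOver {Φ : Ctx S n} {Ψ : Ctx S m} {f : Fin m → Expr S n} (hΦ : T.Wf Φ)
    (hΨ : T.Wf Ψ) (hf : T.IsMor Φ Ψ f) : T.Wf (pathOver Φ Ψ f) := by
  obtain ⟨hw, hy⟩ := wf_toTel hΦ hΨ
  have hx := isMor_castAdd hw
  have hfx := isMor_comp hw hΦ hx hf
  simp only [← rename_eq_subst] at hfx
  exact (wf_append_subst hw (isMor_append_toTel.2 ⟨hfx, hy⟩) (ctxElim hΨ).wf).1

theorem reflAt_succ (Ψ : Ctx S (n + 1)) (σ : Fin n → Expr S k) (x : Expr S k) :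
    reflAt Ψ (ext σ x) = ext (reflAt Ψ.init σ) (.refl ((Ψ (Fin.last n)).subst σ) x) := by
  rw [← reflAt_snoc, Ctx.snoc_init]

/-- The inclusion of the variables of `(x, y, u)` with last components moved to the end. -/
def pathMove (n m : ℕ) : Fin (n + (m + 1) + (m + 1)) → Fin (n + m + m + 1 + 1) :=
  Fin.append (Fin.append (fun i => (Fin.castAdd m (Fin.castAdd m i)).castSucc.castSucc)
      (Fin.snoc (α := fun _ => Fin (n + m + m + 1 + 1))
        (fun i => (Fin.castAdd m (Fin.natAdd n i)).castSucc.castSucc) (Fin.last _).castSucc))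
    (Fin.snoc (α := fun _ => Fin (n + m + m + 1 + 1))
        (fun i => (Fin.natAdd (n + m) i).castSucc.castSucc) (Fin.last _))

/-- The inverse of `pathMove`. -/
def pathUnmove (n m : ℕ) : Fin (n + m + m + 1 + 1) → Fin (n + (m + 1) + (m + 1)) :=
  Fin.snoc (α := fun _ => Fin (n + (m + 1) + (m + 1)))
    (Fin.snoc (α := fun _ => Fin (n + (m + 1) + (m + 1)))
      (Fin.append (Fin.append (fun i => Fin.castAdd (m + 1) (Fin.castAdd (m + 1) i))
        (fun i => Fin.castAdd (m + 1) (Fin.natAdd n i.castSucc)))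
        (fun i => Fin.natAdd (n + (m + 1)) i.castSucc))
      (Fin.castAdd (m + 1) (Fin.natAdd n (Fin.last m))))
    (Fin.natAdd (n + (m + 1)) (Fin.last m))

theorem comp_pathMove {α : Type*} (x : Fin n → α) (y u : Fin m → α) (y' v : α) :
    (fun i => Fin.snoc (α := fun _ => α) (Fin.snoc (α := fun _ => α)
      (Fin.append (Fin.append x y) u) y') v (pathMove n m i)) =
    Fin.append (Fin.append x (Fin.snoc (α := fun _ => α) y y'))
      (Fin.snoc (α := fun _ => α) u v) := by
  rw [pathMove, comp_append, comp_append, comp_snoc, comp_snoc]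
  simp only [Fin.snoc_castSucc, Fin.snoc_last, Fin.append_left, Fin.append_right]

theorem pathMove_pathUnmove (i : Fin (n + m + m + 1 + 1)) : pathMove n m (pathUnmove n m i) = i := by
  revert i
  refine Fin.lastCases ?_ (Fin.lastCases ?_ ?_)
  · rw [pathUnmove, Fin.snoc_last, pathMove, Fin.append_right, Fin.snoc_last]
  · rw [pathUnmove, Fin.snoc_castSucc, Fin.snoc_last, pathMove, Fin.append_left, Fin.append_right,
      Fin.snoc_last]
  · rw [forall_fin_add, forall_fin_add]
    refine ⟨⟨fun i => ?_, fun i => ?_⟩, fun i => ?_⟩ <;>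
    simp only [pathUnmove, pathMove, Fin.append_left, Fin.append_right, Fin.snoc_castSucc]


theorem pathUnmove_pathMove (i : Fin (n + (m + 1) + (m + 1))) :
    pathUnmove n m (pathMove n m i) = i := by
  revert i
  rw [forall_fin_add, forall_fin_add]
  refine ⟨⟨fun i => ?_, Fin.lastCases ?_ fun i => ?_⟩, Fin.lastCases ?_ fun i => ?_⟩ <;>
    simp only [pathUnmove, pathMove, Fin.append_left, Fin.append_right, Fin.snoc_castSucc,
      Fin.snoc_last]

theorem append_append_var (n m l : ℕ) : Fin.append (Fin.append
      (fun i => .var (Fin.castAdd l (Fin.castAdd m i)))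
      (fun i => .var (Fin.castAdd l (Fin.natAdd n i)))) (fun i => .var (Fin.natAdd (n + m) i)) =
      (fun i => .var i : Fin (n + m + l) → Expr S (n + m + l)) := by
  have := congrArg (fun τ : Fin (n + m) → Expr S (n + m) => fun i =>
    (τ i).subst (fun i => (.var (Fin.castAdd l i) : Expr S (n + m + l)))) (append_var (S := S) n m)
  simp only [append_subst, Expr.subst_mk_var] at this
  rw [← append_var (n + m) l, ← this]

theorem eqElem_refl_congr {Γ : Ctx S n} {A a b : Expr S n} (hΓ : T.Wf Γ)
    (h : T.Der Γ (eqElem a b A)) : T.Der Γ (eqElem (.refl A a) (.refl A b) (.Id A a a)) := by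
  have hab := T.presup_eqElem hΓ h
  have h1 := wf_snoc hΓ (T.presup_elem hΓ hab.1)
  have hx := der_var h1 (Fin.last n)
  rw [Ctx.typ_snoc_last] at hx
  have hv := isMor_id hΓ
  have e := Expr.subst_var A
  have := T.subst_eqElem hΓ h1 (isMor_snoc.2 ⟨hv, e.symm ▸ hab.1⟩)
    (isMor_snoc.2 ⟨hv, e.symm ▸ hab.2⟩) (morEq_snoc.2 ⟨morEq_refl hΓ hv, e.symm ▸ h⟩)
    (T.id_intro h1 hx)
  simpa only [Expr.subst_mk_refl, Expr.subst_mk_Id, Expr.subst_rename, Expr.subst_mk_var,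
    Fin.snoc_castSucc, Fin.snoc_last, e] using this

theorem LiftProp.refl {Φ : Ctx S n} (hΦ : T.Wf Φ) : T.LiftProp Φ Φ (fun i => .var i) := by
  intro B c hB hc
  rw [Expr.subst_var] at hc ⊢
  exact ⟨c, hc, by rw [Expr.subst_var]; exact T.eqElem_refl hΦ hc⟩

/-- Induction on the length of `Ψ`. For `Ψ = (Ψ', A)` and `f = (f0, f1)`, the mapping path space is,
up to the order of its variables, the based path space of `A(y)` at `u_!(f1(x))` over the mapping
path space `M` of `f0`. The inclusion of `Φ` thus factors through `M`: the first factor has the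
extension property by induction and the second by based path induction. -/
theorem liftProp_pathOver {Φ : Ctx S n} {Ψ : Ctx S m} {f : Fin m → Expr S n} (hΦ : T.Wf Φ)
    (hΨ : T.Wf Ψ) (hf : T.IsMor Φ Ψ f) :
    T.LiftProp Φ (pathOver Φ Ψ f) (Fin.append (Fin.append (fun i => .var i) f) (reflAt Ψ f)) := by
  induction m with
  | zero =>
    have e : pathOver Φ Ψ f = Φ := by rw [pathOver, Ctx.append_zero, Ctx.append_zero]
    have e' : Fin.append (Fin.append (fun i => .var i) f) (reflAt Ψ f) =
      (fun i => .var i : Fin n → Expr S n) := by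
      funext i
      exact (Fin.append_left _ _ i).trans (Fin.append_left _ _ i)
    rw [e, e']
    exact LiftProp.refl hΦ
  | succ m ih =>
    obtain ⟨f0, f1, rfl⟩ : ∃ f0 f1, f = ext f0 f1 := ⟨_, _, (snoc_eta f).symm⟩
    obtain ⟨hΨ0, hA⟩ := wf_succ.1 hΨ
    obtain ⟨hf0, hf1⟩ := isMor_succ.1 hf
    have hM := wf_pathOver hΦ hΨ0 hf0
    set A := Ψ (Fin.last m) with hAdef
    set M := pathOver Φ Ψ.init f0 with hMdef
    let X : Fin n → Expr S (n + m + m) := fun i => .var (Fin.castAdd m (Fin.castAdd m i))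
    let Y : Fin m → Expr S (n + m + m) := fun i => .var (Fin.castAdd m (Fin.natAdd n i))
    let U : Fin m → Expr S (n + m + m) := fun i => .var (Fin.natAdd (n + m) i)
    -- The base point `u_!(f1(x)) ∈ A(y)`, the source that the definition of identity contexts
    -- prescribes for the last component of a path.
    let a : Expr S (n + m + m) := (transport Ψ.init A).subst
      (ext (tri (fun i => (f0 i).subst X) Y U) (f1.subst X))
    have eV : Fin.append (Fin.append X Y) U = fun i => .var i := append_append_var n m m
    have hid := isMor_id hM
    rw [← eV, hMdef, isMor_pathOver hΦ hf0 hM] at hid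
    obtain ⟨hX, htri⟩ := hid
    have ha : T.Der M (isElem a (A.subst Y)) :=
      (ctxElim hΨ0).transport_elem hA hM htri (by
        have := T.subst hM hΦ hX hf1
        rwa [Judgement.subst, Expr.subst_subst] at this)
    have hP := wf_basedPath hM ha
    have hQ := wf_pathOver hΦ hΨ hf
    have eY : ∀ {k : ℕ} (σ : Fin n → Expr S k) (y u : Fin m → Expr S k),
        (A.subst Y).subst (Fin.append (Fin.append σ y) u) = A.subst y := by
      intro k σ y u
      rw [Expr.subst_subst]
      simp only [Y, Expr.subst_mk_var, Fin.append_left, Fin.append_right]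
    have ea : ∀ {k : ℕ} (σ : Fin n → Expr S k) (y u : Fin m → Expr S k),
        a.subst (Fin.append (Fin.append σ y) u) = (transport Ψ.init A).subst
          (ext (tri (fun i => (f0 i).subst σ) y u) (f1.subst σ)) := by
      intro k σ y u
      have e1 : (fun i => (X i).subst (Fin.append (Fin.append σ y) u)) = σ := by
        simp only [X, Expr.subst_mk_var, Fin.append_left]
      have e2 : (fun i => (Y i).subst (Fin.append (Fin.append σ y) u)) = y := by
        simp only [Y, Expr.subst_mk_var, Fin.append_left, Fin.append_right]
      have e3 : (fun i => (U i).subst (Fin.append (Fin.append σ y) u)) = u := by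
        simp only [U, Expr.subst_mk_var, Fin.append_right]
      simp only [a]
      rw [Expr.subst_subst, ext_subst, comp_tri (f := fun e : Expr S _ => e.subst _), e2, e3]
      simp only [Expr.subst_subst, e1]
    -- The based path space over `M` and the mapping path space of `f` receive the same morphisms up
    -- to reordering. Applied to identity substitutions this shows that `pathMove` and `pathUnmove`
    -- are context morphisms.
    have hPQ : ∀ {k : ℕ} {Δ : Ctx S k} {σ : Fin n → Expr S k} {y u : Fin m → Expr S k}
        {y' v : Expr S k}, T.Wf Δ →
        (T.IsMor Δ (basedPath M (A.subst Y) a) (ext (ext (Fin.append (Fin.append σ y) u) y') v) ↔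
          T.IsMor Δ (pathOver Φ Ψ (ext f0 f1))
            (Fin.append (Fin.append σ (ext y y')) (ext u v))) := by
      intro k Δ σ y u y' v hΔ
      rw [isMor_basedPath, isMor_pathOver hΦ hf0 hΔ, isMor_pathOver hΦ hf hΔ, ext_subst,
        isMor_path_succ, eY, ea]
      constructor
      · rintro ⟨⟨⟨h1, h2⟩, h3⟩, h4⟩
        refine ⟨h1, h2, ?_, h3, h4⟩
        have := T.subst hΔ hΦ h1 hf1
        rwa [Judgement.subst, Expr.subst_subst] at this
      · rintro ⟨h1, h2, -, h3, h4⟩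
        exact ⟨⟨⟨h1, h2⟩, h3⟩, h4⟩
    have eP : ext (ext (Fin.append (Fin.append (fun i => (X i).subst fun i => .var i.castSucc.castSucc)
        (fun i => (Y i).subst fun i => .var i.castSucc.castSucc))
        (fun i => (U i).subst fun i => .var i.castSucc.castSucc))
        (.var (Fin.last (n + m + m)).castSucc)) (.var (Fin.last (n + m + m + 1))) =
        (fun i => .var i : Fin (n + m + m + 1 + 1) → Expr S (n + m + m + 1 + 1)) := by
      rw [← append_subst, ← append_subst, eV, ← ext_var,
        ← snoc_eta (fun i : Fin (n + m + m + 1) => (.var i.castSucc : Expr S (n + m + m + 1 + 1)))]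
      rfl
    have hρ : T.IsMor (basedPath M (A.subst Y) a) (pathOver Φ Ψ (ext f0 f1))
        (fun i => .var (pathMove n m i)) := by
      have h := (hPQ hP).1 (eP.symm ▸ isMor_id hP)
      exact (congrArg (T.IsMor _ _) ((comp_pathMove _ _ _ _ _).symm.trans
        (congrArg (fun τ : Fin _ → Expr S _ => fun i => τ (pathMove n m i)) eP))).mp h
    have hρ' : T.IsMor (pathOver Φ Ψ (ext f0 f1)) (basedPath M (A.subst Y) a)
        (fun i => .var (pathUnmove n m i)) := by
      rw [pathUnmove, comp_snoc, comp_snoc, comp_append, comp_append]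
      refine (hPQ hQ).2 ?_
      have e1 : ext _ _ = _ := snoc_eta (fun i : Fin (m + 1) =>
        (.var (Fin.castAdd (m + 1) (Fin.natAdd n i)) : Expr S (n + (m + 1) + (m + 1))))
      have e2 : ext _ _ = _ := snoc_eta (fun i : Fin (m + 1) =>
        (.var (Fin.natAdd (n + (m + 1)) i) : Expr S (n + (m + 1) + (m + 1))))
      rw [e1, e2, append_append_var]
      exact isMor_id hQ
    have hrΦ := isMor_id hΦ
    have hr0 : T.IsMor Φ M (Fin.append (Fin.append (fun i => .var i) f0) (reflAt Ψ.init f0)) := by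
      rw [hMdef, isMor_pathOver hΦ hf0 hΦ]
      simp only [Expr.subst_var]
      refine ⟨hrΦ, ?_⟩
      have := isMor_comp hΦ hΨ0 hf0 (ctxElim hΨ0).diag
      rwa [diagCtx_subst] at this
    have hι : T.IsMor M (basedPath M (A.subst Y) a)
        (ext (ext (fun i => .var i) a) (.refl (A.subst Y) a)) := by
      rw [isMor_basedPath, Expr.subst_var, Expr.subst_var]
      exact ⟨⟨isMor_id hM, ha⟩, T.id_intro hM ha⟩
    have L := (ih hΨ0 hf0).comp hΦ hM hP hr0 hι (liftProp_basedPath hM ha)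
    have hιr := isMor_comp hΦ hM hr0 hι
    have eg : ∀ {k : ℕ} (g : Fin (n + m + m) → Expr S k),
        (fun i => (ext (ext (fun i => .var i) a) (.refl (A.subst Y) a) i).subst g) =
          ext (ext g (a.subst g)) (.refl ((A.subst Y).subst g) (a.subst g)) := by
      intro k g
      rw [ext_subst, ext_subst, Expr.subst_mk_refl]
      rfl
    rw [eg] at L hιr
    have hr := (ctxElim hΨ0).transport_refl hA hΦ hf0 hf1
    have ea' := ea (fun i => .var i) f0 (reflAt Ψ.init f0)
    simp only [Expr.subst_var] at ea'
    rw [ea', eY] at L hιr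
    have hr' := T.id_intro hΦ hf1
    -- The factorisation ends at `(1_!(f1), r(1_!(f1)))` instead of `(f1, r(f1))`. Transport along
    -- `1` computes, so the tuples are definitionally equal and `LiftProp.congr` passes from one to
    -- the other.
    have hm : T.IsMor Φ (basedPath M (A.subst Y) a) (ext (ext
        (Fin.append (Fin.append (fun i => .var i) f0) (reflAt Ψ.init f0)) f1)
        (.refl (A.subst f0) f1)) := by
      rw [isMor_basedPath, eY, ea']
      exact ⟨⟨hr0, hf1⟩, T.conv_elem hΦ hr'
        (T.eqType_symm hΦ (eqType_Id hΦ hr (T.eqElem_refl hΦ hf1)))⟩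
    have L2 := (L.congr hΦ hP hιr hm (by
      rw [basedPath, morEq_snoc, morEq_snoc, eY]
      refine ⟨⟨morEq_refl hΦ hr0, hr⟩, ?_⟩
      simp only [Expr.subst_mk_Id, Expr.subst_rename, Fin.snoc_castSucc, Expr.subst_mk_var,
        Fin.snoc_last]
      rw [eY, ea']
      exact eqElem_refl_congr hΦ hr)).ren hP hQ hρ hρ' pathMove_pathUnmove pathUnmove_pathMove
    rw [comp_pathMove] at L2
    rw [reflAt_succ]
    exact L2

end TypeTheory

namespace TypeTheory
variable {T : TypeTheory S} {n m k l : ℕ}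

/-! ## Conversion in dependent contexts -/

/-- A tail `z` over `σ` is also a tail over any definitionally equal `τ`. The declarations of `Θ`
are treated in order, since converting the type of one component uses the equality already known for
the earlier ones. -/
theorem isMor_append_conv {Δ : Ctx S k} {Γ : Ctx S n} {Θ : Tel S n m} (hΔ : T.Wf Δ)
    (hΘ : T.Wf (Γ.append Θ)) {σ τ : Fin n → Expr S k} {z : Fin m → Expr S k}
    (hτ : T.IsMor Δ Γ τ) (h : T.MorEq Δ Γ σ τ)
    (hz : T.IsMor Δ (Γ.append Θ) (Fin.append σ z)) :
    T.IsMor Δ (Γ.append Θ) (Fin.append τ z) ∧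
      T.MorEq Δ (Γ.append Θ) (Fin.append σ z) (Fin.append τ z) := by
  induction m with
  | zero => exact ⟨isMor_append_iff.2 ⟨hτ, fun i => i.elim0⟩, morEq_append.2 ⟨h, fun i => i.elim0⟩⟩
  | succ m ih =>
    rw [Ctx.append_succ] at hΘ hz ⊢
    rw [append_succ_eq] at hz
    rw [append_succ_eq σ z, append_succ_eq τ z]
    obtain ⟨hΘ1, hB⟩ := wf_snoc_iff.1 hΘ
    obtain ⟨hz1, hz2⟩ := isMor_snoc.1 hz
    obtain ⟨h1, h2⟩ := ih hΘ1 hz1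
    rw [isMor_snoc, morEq_snoc]
    exact ⟨⟨h1, T.conv_elem hΔ hz2 (T.subst_eqType hΔ hΘ1 hz1 h1 h2 hB)⟩, h2,
      T.eqElem_refl hΔ hz2⟩

theorem eqElemTel_conv {Δ : Ctx S k} {Γ : Ctx S n} {Θ : Tel S n m} (hΔ : T.Wf Δ)
    (hΘ : T.Wf (Γ.append Θ)) {σ τ : Fin n → Expr S k} {z w : Fin m → Expr S k}
    (hσ : T.IsMor Δ Γ σ) (hτ : T.IsMor Δ Γ τ) (h : T.MorEq Δ Γ σ τ)
    (hz : T.IsElemTel Δ (Θ.subst σ) z) (hw : T.IsElemTel Δ (Θ.subst σ) w)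
    (hzw : T.EqElemTel Δ (Θ.subst σ) z w) : T.EqElemTel Δ (Θ.subst τ) z w := by
  have mz := isMor_append.2 ⟨hσ, hz⟩
  have mw := isMor_append.2 ⟨hσ, hw⟩
  obtain ⟨mz', ez⟩ := isMor_append_conv hΔ hΘ hτ h mz
  obtain ⟨mw', ew⟩ := isMor_append_conv hΔ hΘ hτ h mw
  have e1 := morEq_append.2 ⟨morEq_refl hΔ hσ, hzw⟩
  exact (morEq_append.1 (morEq_trans hΔ hΘ mz' mz (morEq_symm hΔ hΘ mz mz' ez)
    (morEq_trans hΔ hΘ mz mw e1 ew))).2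

theorem morEq_path {Ψ : Ctx S m} {Δ : Ctx S k} {a b a' b' u u' : Fin m → Expr S k} : T.MorEq Δ Ψ.path (tri a b u) (tri a' b' u') ↔
    (T.MorEq Δ Ψ a a' ∧ T.MorEq Δ Ψ b b') ∧ T.EqElemTel Δ (idCtxAt Ψ a b) u u' := by
  rw [tri, tri, Ctx.path, morEq_append, morEq_append_toTel]; rfl

section
variable {Ψ : Ctx S m} (hΨ : T.Wf Ψ) {Δ : Ctx S k} (hΔ : T.Wf Δ) {a b a' b' : Fin m → Expr S k}
include hΨ hΔ

theorem wf_idCtxAt (ha : T.IsMor Δ Ψ a) (hb : T.IsMor Δ Ψ b) :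
    T.Wf (Δ.append (idCtxAt Ψ a b)) :=
  (wf_append_subst hΔ (isMor_append_toTel.2 ⟨ha, hb⟩) (ctxElim hΨ).wf).1

theorem isElemTel_reflAt (ha : T.IsMor Δ Ψ a) : T.IsElemTel Δ (idCtxAt Ψ a a) (reflAt Ψ a) := by
  have := isMor_comp hΔ hΨ ha (ctxElim hΨ).diag
  rw [diagCtx_subst] at this
  exact (isMor_path_iff'.1 this).2.2

theorem isElemTel_idCtxAt_conv (ha : T.IsMor Δ Ψ a) (hb : T.IsMor Δ Ψ b)
    (ha' : T.IsMor Δ Ψ a') (hb' : T.IsMor Δ Ψ b') (haa' : T.MorEq Δ Ψ a a')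
    (hbb' : T.MorEq Δ Ψ b b') {z : Fin m → Expr S k} (hz : T.IsElemTel Δ (idCtxAt Ψ a b) z) :
    T.IsElemTel Δ (idCtxAt Ψ a' b') z :=
  (isMor_append.1 (isMor_append_conv hΔ (ctxElim hΨ).wf (isMor_append_toTel.2 ⟨ha', hb'⟩)
    (morEq_append_toTel.2 ⟨haa', hbb'⟩)
    (isMor_append.2 ⟨isMor_append_toTel.2 ⟨ha, hb⟩, hz⟩)).1).2

theorem eqElemTel_idCtxAt_conv (ha : T.IsMor Δ Ψ a) (hb : T.IsMor Δ Ψ b)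
    (ha' : T.IsMor Δ Ψ a') (hb' : T.IsMor Δ Ψ b') (haa' : T.MorEq Δ Ψ a a')
    (hbb' : T.MorEq Δ Ψ b b') {z w : Fin m → Expr S k} (hz : T.IsElemTel Δ (idCtxAt Ψ a b) z)
    (hw : T.IsElemTel Δ (idCtxAt Ψ a b) w) (hzw : T.EqElemTel Δ (idCtxAt Ψ a b) z w) :
    T.EqElemTel Δ (idCtxAt Ψ a' b') z w :=
  eqElemTel_conv hΔ (ctxElim hΨ).wf (isMor_append_toTel.2 ⟨ha, hb⟩)
    (isMor_append_toTel.2 ⟨ha', hb'⟩) (morEq_append_toTel.2 ⟨haa', hbb'⟩) hz hw hzw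

theorem transport_congr {A : Expr S m} (hA : T.Der Ψ (isType A)) {u u' : Fin m → Expr S k}
    {z z' : Expr S k} (hu : T.IsMor Δ Ψ.path (tri a b u)) (hu' : T.IsMor Δ Ψ.path (tri a' b' u'))
    (h : T.MorEq Δ Ψ.path (tri a b u) (tri a' b' u'))
    (hz : T.Der Δ (eqElem z z' (A.subst a))) :
    T.Der Δ (eqElem ((transport Ψ A).subst (ext (tri a b u) z))
      ((transport Ψ A).subst (ext (tri a' b' u') z')) (A.subst b)) := by
  obtain ⟨h1, h2, -⟩ := (ctxElim hΨ).transport_aux hA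
  have hz1 := T.presup_eqElem hΔ hz
  have e : ∀ a b u : Fin m → Expr S k, (A.rename PX).subst (tri a b u) = A.subst a := by
    intro a b u
    rw [Expr.subst_rename]; simp only [tri_PX]
  obtain ⟨ha, hb, -⟩ := isMor_path_iff'.1 hu
  obtain ⟨ha', -⟩ := isMor_path_iff'.1 hu'
  obtain ⟨⟨haa, -⟩, -⟩ := morEq_path.1 h
  have := T.subst_eqElem hΔ h1 (isMor_snoc.2 ⟨hu, (e a b u).symm ▸ hz1.1⟩)
    (isMor_snoc.2 ⟨hu', (e a' b' u').symm ▸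
      T.conv_elem hΔ hz1.2 (T.subst_eqType hΔ hΨ ha ha' haa hA)⟩)
    (morEq_snoc.2 ⟨h, (e a b u).symm ▸ hz⟩) h2
  rw [Expr.subst_rename] at this
  have e' : (fun i => Fin.snoc (α := fun _ => Expr S k) (tri a b u) z (Y i)) = b := by
    funext i
    exact (Fin.snoc_castSucc (α := fun _ => Expr S k) _ _ (PY i)).trans (tri_PY _ _ _ i)
  rwa [e'] at this

end

/-! ## Injective equivalences -/

/-- Extension of the identity and of reflexivity produces the data `s` and `ε`. Conversely,
transport along `ε` extends elements, and its computation rule makes the extension strict. -/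
theorem liftProp_iff_isInjectiveEquivalence {Φ : T.Context n} {Ψ : T.Context m}
    (f : CtxMor Φ Ψ) : T.LiftProp Φ.ctx Ψ.ctx f.tm ↔ IsInjectiveEquivalence f := by
  obtain ⟨Φ, hΦ⟩ := Φ
  obtain ⟨Ψ, hΨ⟩ := Ψ
  obtain ⟨f, hf⟩ := f
  dsimp only at hf
  have hid := isMor_id hΦ
  have hid' := isMor_id hΨ
  have hff := isElemTel_reflAt hΨ hΦ hf
  constructor
  · intro L
    obtain ⟨s, hs, hs'⟩ := L.ctx hΦ hΨ hf hΦ hid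
    have hsf := isMor_comp hΦ hΨ hf hs
    have hfs := isMor_comp hΨ hΦ hs hf
    have hfsf := isMor_comp hΦ hΨ hf hfs
    have hE : T.MorEq Φ Ψ (fun i => ((f i).subst s).subst f) f := by
      have := morEq_comp hΦ hΦ hΨ hsf hid hf hs' (morEq_refl hΦ hf)
      simpa only [Expr.subst_subst, Expr.subst_var] using this
    have hE' := morEq_symm hΦ hΨ hfsf hf hE
    have hrf := morEq_refl hΦ hf
    have e : (idCtxAt Ψ (fun i => (f i).subst s) (fun i => .var i)).subst f =
      idCtxAt Ψ (fun i => ((f i).subst s).subst f) f := idCtxAt_subst _ _ _ _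
    -- As `f(s(f(x))) = f(x)` holds definitionally, `1_{f(x)}` is an element of `Id_Ψ(f(s(f(x))),
    -- f(x))`, the restriction along `f` of the identity context in which `ε` has to live. Extending
    -- it gives `ε`.
    have hc := isElemTel_idCtxAt_conv hΨ hΦ hf hf hfsf hf hE' hrf hff
    obtain ⟨ε, hε, hε'⟩ := L.tel hΦ hΨ hf (wf_idCtxAt hΨ hΨ hfs hid') (c := reflAt Ψ f)
      (isMor_append.2 ⟨hf, by rw [e]; exact hc⟩)
    refine ⟨s, hs, morEq_symm hΦ hΦ hsf hid hs', ε, ?_, ?_⟩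
    · have := (isMor_append.1 hε).2
      rw [idCtxAt_subst] at this
      simpa only [Expr.subst_subst, Expr.subst_var, Expr.subst_mk_var] using this
    · have h1 := (morEq_append.1 hε').2
      have hεf := isMor_comp hΦ hΨ hf hε
      rw [append_subst] at hεf
      have h2 := (isMor_append.1 hεf).2
      simp only [Expr.subst_mk_var] at h2
      rw [e] at h1 h2
      exact eqElemTel_idCtxAt_conv hΨ hΦ hfsf hf hf hf hE hrf h2 hc h1
  · rintro ⟨s, hs, hs', ε, hε, hε'⟩ B c hB hc
    dsimp only at hs hs' hε hε'
    have hsf := isMor_comp hΦ hΨ hf hs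
    have hfs := isMor_comp hΨ hΦ hs hf
    have hfsf := isMor_comp hΦ hΨ hf hfs
    have hE : T.MorEq Φ Ψ (fun i => ((f i).subst s).subst f) f := by
      have := morEq_comp hΦ hΦ hΨ hsf hid hf (morEq_symm hΦ hΦ hid hsf hs') (morEq_refl hΦ hf)
      simpa only [Expr.subst_subst, Expr.subst_var] using this
    have hε1 := isMor_path_iff'.2 ⟨hfs, hid', hε⟩
    have hcs := T.subst hΨ hΦ hs hc
    rw [Judgement.subst, Expr.subst_subst] at hcs
    -- The extension is `d(y) = (ε_y)_!(c(s(y)))`.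
    have hd := (ctxElim hΨ).transport_elem hB hΨ hε1 hcs
    rw [Expr.subst_var] at hd
    refine ⟨_, hd, ?_⟩
    have m1 := isMor_comp hΦ hΨ hf hε1
    rw [comp_tri (f := fun e : Expr S m => e.subst f)] at m1
    simp only [Expr.subst_mk_var] at m1
    have m2 := isMor_path_iff'.2 ⟨hf, hf, hff⟩
    have hrf := morEq_refl hΦ hf
    have hεf := isElemTel_idCtxAt_conv hΨ hΦ hfsf hf hf hf hE hrf (isMor_path_iff'.1 m1).2.2
    -- The hypothesis `ε_{f(x)} = 1_{f(x)}` is an equation in `Id_Ψ(f(x), f(x))`; comparing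
    -- transports requires it in `Id_Ψ(f(s(f(x))), f(x))`.
    have e1 := eqElemTel_idCtxAt_conv hΨ hΦ hf hf hfsf hf (morEq_symm hΦ hΨ hfsf hf hE) hrf
      hεf hff hε'
    have hcc := T.subst_eqElem hΦ hΦ hsf hid (morEq_symm hΦ hΦ hid hsf hs') hc
    rw [Expr.subst_var, Expr.subst_subst] at hcc
    -- Replaces `ε_{f(x)}` by `1_{f(x)}` and `c(s(f(x)))` by `c(x)`; transport along `1` then leaves
    -- `c(x)`.
    have h3 := transport_congr hΨ hΦ hB m1 m2 (morEq_path.2 ⟨⟨hE, hrf⟩, e1⟩)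
      (z := c.subst fun i => (s i).subst f) (z' := c) (by simpa only [Expr.subst_subst] using hcc)
    have h4 := (ctxElim hΨ).transport_refl hB hΦ hf hc
    have := T.eqElem_trans hΦ h3 h4
    rw [Expr.subst_subst, comp_snoc (f := fun e : Expr S m => e.subst f),
      comp_tri (f := fun e : Expr S m => e.subst f)]
    simp only [Expr.subst_mk_var, Expr.subst_subst] at this ⊢
    exact this

/-! ## Maps of the classifying category -/

theorem toHom_eq_iff {Φ : T.Context n} {Ψ : T.Context m} {f g : CtxMor Φ Ψ} :
    f.toHom = g.toHom ↔ T.MorEq Φ.ctx Ψ.ctx f.tm g.tm :=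
  ⟨fun h => (@Quotient.exact _ (homSetoid Φ.toCl Ψ.toCl) _ _ h).2.2,
    fun h => @Quotient.sound _ (homSetoid Φ.toCl Ψ.toCl) _ _ ⟨f.isMor, g.isMor, h⟩⟩

/-- The identity context morphism. -/
def CtxMor.id (Φ : T.Context n) : CtxMor Φ Φ := ⟨fun i => .var i, isMor_id Φ.wf⟩

/-- Composition of context morphisms. -/
def CtxMor.comp {Φ : T.Context n} {Ψ : T.Context m} {Ξ : T.Context l} (f : CtxMor Φ Ψ)
    (g : CtxMor Ψ Ξ) : CtxMor Φ Ξ :=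
  ⟨fun i => (g.tm i).subst f.tm, isMor_comp Φ.wf Ψ.wf f.isMor g.isMor⟩

theorem toHom_id (Φ : T.Context n) : (CtxMor.id Φ).toHom = 𝟙 Φ.toCl := rfl

theorem toHom_comp {Φ : T.Context n} {Ψ : T.Context m} {Ξ : T.Context l} (f : CtxMor Φ Ψ)
    (g : CtxMor Ψ Ξ) : (f.comp g).toHom = f.toHom ≫ g.toHom := rfl

theorem exists_toHom {Φ : T.Context n} {Ψ : T.Context m} (g : Φ.toCl ⟶ Ψ.toCl) :
    ∃ f : CtxMor Φ Ψ, f.toHom = g := by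
  induction g using Quotient.inductionOn with | _ σ
  exact ⟨⟨σ.1, σ.2⟩, rfl⟩

theorem exists_toCl (P : T.Cl) : ∃ (n : ℕ) (Φ : T.Context n), Φ.toCl = P := by
  obtain ⟨n, q⟩ := P
  induction q using Quotient.inductionOn with | _ Φ
  exact ⟨n, Φ, rfl⟩

/-- An extension problem is the lifting problem whose bottom map is the identity of `Ψ`. Conversely,
a general problem with bottom map `b` reduces to extending an element of the type substituted along
`b`. -/
theorem classA_iff_liftProp {Φ : T.Context n} {Ψ : T.Context m} (f : CtxMor Φ Ψ) :
    T.classA f.toHom ↔ T.LiftProp Φ.ctx Ψ.ctx f.tm := by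
  constructor
  · intro h B c hB hc
    have := h _ (display.mk Ψ B hB)
    let t : CtxMor Φ (Ψ.ext B hB) := ⟨ext f.tm c, isMor_snoc.2 ⟨f.isMor, hc⟩⟩
    have sq : CommSq t.toHom f.toHom (Ψ.proj B hB).toHom (𝟙 _) := ⟨by
      rw [Category.comp_id, ← toHom_comp]
      refine toHom_eq_iff.2 ?_
      have : (t.comp (Ψ.proj B hB)).tm = f.tm := by
        funext i
        exact (Expr.subst_mk_var _ _).trans (Fin.snoc_castSucc (α := fun _ => Expr S n) _ _ i)
      rw [this]
      exact morEq_refl Φ.wf f.isMor⟩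
    obtain ⟨g, hg⟩ := exists_toHom sq.lift
    have hl := sq.fac_left
    have hr := sq.fac_right
    rw [← hg, ← toHom_comp, ← toHom_id, toHom_eq_iff] at hr
    rw [← hg, ← toHom_comp, toHom_eq_iff] at hl
    obtain ⟨g, hg'⟩ := g
    -- A filler is a pair `(g0, g1)` in which `g0` is only definitionally equal to the identity. Its
    -- last component has type `B(g0)` and is converted to `B`.
    obtain ⟨g0, g1, rfl⟩ : ∃ g0 g1, g = ext g0 g1 := ⟨_, _, (snoc_eta g).symm⟩
    obtain ⟨h0, h1⟩ := isMor_snoc.1 hg'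
    have e0 : (((⟨ext g0 g1, hg'⟩ : CtxMor Ψ (Ψ.ext B hB)).comp (Ψ.proj B hB)).tm) = g0 := by
      funext i
      exact (Expr.subst_mk_var _ _).trans (Fin.snoc_castSucc (α := fun _ => Expr S m) _ _ i)
    rw [e0] at hr
    have hE := T.subst_eqType Ψ.wf Ψ.wf h0 (isMor_id Ψ.wf) hr hB
    rw [Expr.subst_var] at hE
    refine ⟨g1, T.conv_elem Ψ.wf h1 hE, ?_⟩
    have hl' : T.MorEq Φ.ctx (Ψ.ctx.snoc B) (fun i => (ext g0 g1 i).subst f.tm) (ext f.tm c) := hl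
    rw [ext_subst, morEq_snoc] at hl'
    have hE2 := T.subst Φ.wf Ψ.wf f.isMor hE
    rw [Judgement.subst, Expr.subst_subst] at hE2
    exact T.conv_eqElem Φ.wf hl'.2 hE2
  · rintro L _ _ _ ⟨Γ, A, hA⟩
    refine ⟨fun {t b} sq => ?_⟩
    obtain ⟨t, rfl⟩ := exists_toHom t
    obtain ⟨b, rfl⟩ := exists_toHom b
    have hw := sq.w
    rw [← toHom_comp, ← toHom_comp, toHom_eq_iff] at hw
    obtain ⟨t, ht⟩ := t
    obtain ⟨t0, t1, rfl⟩ : ∃ t0 t1, t = ext t0 t1 := ⟨_, _, (snoc_eta t).symm⟩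
    obtain ⟨h0, h1⟩ := isMor_snoc.1 ht
    have e0 : (((⟨ext t0 t1, ht⟩ : CtxMor Φ (Γ.ext A hA)).comp (Γ.proj A hA)).tm) = t0 := by
      funext i
      exact (Expr.subst_mk_var _ _).trans (Fin.snoc_castSucc (α := fun _ => Expr S n) _ _ i)
    rw [e0] at hw
    have hbf := isMor_comp Φ.wf Ψ.wf f.isMor b.isMor
    -- The last component `t1` of the top map has a type over `t0`; commutativity of the square
    -- converts it to the restriction along `f` of the type pulled back along `b`.
    obtain ⟨d, hd, hd'⟩ := L (A.subst b.tm) t1 (T.subst Ψ.wf Γ.wf b.isMor hA) (by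
      rw [Expr.subst_subst]
      exact T.conv_elem Φ.wf h1 (T.subst_eqType Φ.wf Γ.wf h0 hbf hw hA))
    rw [Expr.subst_subst] at hd'
    let g : CtxMor Ψ (Γ.ext A hA) := ⟨ext b.tm d, isMor_snoc.2 ⟨b.isMor, hd⟩⟩
    refine ⟨⟨⟨g.toHom, ?_, ?_⟩⟩⟩
    · rw [← toHom_comp, toHom_eq_iff]
      change T.MorEq Φ.ctx (Γ.ctx.snoc A) (fun i => (ext b.tm d i).subst f.tm) (ext t0 t1)
      rw [ext_subst, morEq_snoc]
      exact ⟨morEq_symm Φ.wf Γ.wf h0 hbf hw, hd'⟩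
    · rw [← toHom_comp, toHom_eq_iff]
      have : (g.comp (Γ.proj A hA)).tm = b.tm := by
        funext i
        exact (Expr.subst_mk_var _ _).trans (Fin.snoc_castSucc (α := fun _ => Expr S m) _ _ i)
      rw [this]
      exact morEq_refl Ψ.wf b.isMor

end TypeTheory

namespace TypeTheory
variable {T : TypeTheory S} {n m k l : ℕ}

/-! ## Normal isofibrations -/

theorem morEq_pathOver {Φ : Ctx S n} {Ψ : Ctx S m} {f : Fin m → Expr S n} {Δ : Ctx S k}
    {σ σ' : Fin n → Expr S k} {y u y' u' : Fin m → Expr S k} :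
    T.MorEq Δ (pathOver Φ Ψ f) (Fin.append (Fin.append σ y) u) (Fin.append (Fin.append σ' y') u') ↔
      (T.MorEq Δ Φ σ σ' ∧ T.MorEq Δ Ψ y y') ∧
        T.EqElemTel Δ (idCtxAt Ψ (fun i => (f i).subst σ) y) u u' := by
  rw [pathOver, morEq_append, morEq_append_toTel, idCtxAt_pathOver_subst]

/-- The square has the identity on top and the projection to `y` at the bottom, with the inclusion
of reflexivities on the left. Its two triangles are precisely the two equations required of `j`. -/
theorem IsNormalIsofibration.of_classB {Φ : T.Context n} {Ψ : T.Context m} {f : CtxMor Φ Ψ}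
    (h : T.classB f.toHom) : IsNormalIsofibration f := by
  let P : T.Context (n + m + m) := ⟨pathCtx f, wf_pathOver Φ.wf Ψ.wf f.isMor⟩
  have hff := isElemTel_reflAt Ψ.wf Φ.wf f.isMor
  have hP := isMor_id P.wf
  rw [← append_append_var] at hP
  obtain ⟨⟨-, hY⟩, -⟩ := isMor_pathOver'.1 hP
  let i : CtxMor Φ P := ⟨Fin.append (Fin.append (fun i => .var i) f.tm) (reflAt Ψ.ctx f.tm),
    isMor_pathOver'.2 ⟨⟨isMor_id Φ.wf, f.isMor⟩, by simpa only [Expr.subst_var] using hff⟩⟩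
  let y : CtxMor P Ψ := ⟨_, hY⟩
  have hi : T.classA i.toHom := (classA_iff_liftProp i).2 (liftProp_pathOver Φ.wf Ψ.wf f.isMor)
  have := h _ hi
  have sq : CommSq (𝟙 Φ.toCl) i.toHom f.toHom y.toHom := ⟨by
    rw [Category.id_comp, ← toHom_comp]
    have : (i.comp y).tm = f.tm := by
      funext j
      refine (Expr.subst_mk_var _ _).trans ?_
      simp only [i, Fin.append_left, Fin.append_right]
    rw [toHom_eq_iff, this]
    exact morEq_refl Φ.wf f.isMor⟩
  obtain ⟨j, hj⟩ := exists_toHom sq.lift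
  have hl := sq.fac_left
  have hr := sq.fac_right
  rw [← hj, ← toHom_comp, toHom_eq_iff] at hr
  rw [← hj, ← toHom_comp, ← toHom_id, toHom_eq_iff] at hl
  exact ⟨j.tm, j.isMor, hr, hl⟩

/-- A map `g` in `𝒜` allows both the top of the square and a path to be extended; `j` then moves the
first extension along the path to one lying strictly over the bottom map. -/
theorem IsNormalIsofibration.classB {Φ : T.Context n} {Ψ : T.Context m} {f : CtxMor Φ Ψ}
    (h : IsNormalIsofibration f) : T.classB f.toHom := by
  obtain ⟨j, hj, hfj, hjr⟩ := h
  intro P Q g hg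
  obtain ⟨p, Γ, rfl⟩ := exists_toCl P
  obtain ⟨q, Δ, rfl⟩ := exists_toCl Q
  obtain ⟨g, rfl⟩ := exists_toHom g
  rw [classA_iff_liftProp] at hg
  refine ⟨fun {a b} sq => ?_⟩
  obtain ⟨a, rfl⟩ := exists_toHom a
  obtain ⟨b, rfl⟩ := exists_toHom b
  have hw := sq.w
  rw [← toHom_comp, ← toHom_comp, toHom_eq_iff] at hw
  obtain ⟨Γ, hΓ⟩ := Γ
  obtain ⟨Δ, hΔ⟩ := Δ
  obtain ⟨Φ, hΦ⟩ := Φ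
  obtain ⟨Ψ, hΨ⟩ := Ψ
  obtain ⟨f, hf⟩ := f
  obtain ⟨g, hgm⟩ := g
  obtain ⟨a, ha⟩ := a
  obtain ⟨b, hb⟩ := b
  replace hw : T.MorEq Γ Ψ (fun i => (f i).subst a) (fun i => (b i).subst g) := hw
  replace hj : T.IsMor (pathOver Φ Ψ f) Φ j := hj
  replace hfj : T.MorEq (pathOver Φ Ψ f) Ψ (fun i => (f i).subst j)
    (fun i => .var (Fin.castAdd m (Fin.natAdd n i))) := hfj
  dsimp only at hf hgm ha hb hg hjr
  have hM := wf_pathOver hΦ hΨ hf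
  -- `k` makes the upper triangle commute, but `f(k)` need not be `b`; they agree only after
  -- restriction along `g`.
  obtain ⟨k, hk, hka⟩ := hg.ctx hΓ hΔ hgm hΦ ha
  have hfk := isMor_comp hΔ hΦ hk hf
  have hkg := isMor_comp hΓ hΔ hgm hk
  have hfkg := isMor_comp hΓ hΔ hgm hfk
  have hbg := isMor_comp hΓ hΔ hgm hb
  have hfa := isMor_comp hΓ hΦ ha hf
  have hE : T.MorEq Γ Ψ (fun i => ((f i).subst k).subst g) (fun i => (f i).subst a) := by
    have := morEq_comp hΓ hΦ hΨ hkg ha hf hka (morEq_refl hΦ hf)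
    simpa only [Expr.subst_subst] using this
  have hE' := morEq_symm hΓ hΨ hfkg hfa hE
  -- Over `Γ` both `f(k(g))` and `b(g)` are definitionally `f(a)`, so `1_{f(a)}` is an identity
  -- between them. Extending it along `g` yields `u ∈ Id_Ψ(f(k), b)` over `Δ`.
  have hc := isElemTel_idCtxAt_conv hΨ hΓ hfa hfa hfkg hbg hE' hw (isElemTel_reflAt hΨ hΓ hfa)
  have e := idCtxAt_subst Ψ (fun i => (f i).subst k) b g
  obtain ⟨u, hu, hu'⟩ := hg.tel hΓ hΔ hgm (wf_idCtxAt hΨ hΔ hfk hb)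
    (isMor_append.2 ⟨hgm, by rw [e]; exact hc⟩)
  have hug := isMor_comp hΓ hΔ hgm hu
  rw [append_subst] at hug
  have h1 := (isMor_append.1 hug).2
  simp only [Expr.subst_mk_var] at h1
  have h2 := (morEq_append.1 hu').2
  have h3 := (isMor_append.1 hu).2
  rw [e] at h1 h2
  rw [idCtxAt_subst] at h3
  simp only [Expr.subst_var] at h3
  have hm : T.IsMor Δ (pathOver Φ Ψ f) (Fin.append (Fin.append k b) u) :=
    isMor_pathOver'.2 ⟨⟨hk, hb⟩, h3⟩
  have hh := isMor_comp hΔ hM hm hj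
  -- The filler is `j(k, b, u)`.
  let r : CtxMor (⟨Δ, hΔ⟩ : T.Context _) ⟨Φ, hΦ⟩ := ⟨_, hh⟩
  refine ⟨⟨⟨r.toHom, ?_, ?_⟩⟩⟩
  · rw [← toHom_comp, toHom_eq_iff]
    change T.MorEq Γ Φ (fun i => ((j i).subst (Fin.append (Fin.append k b) u)).subst g) a
    have hmg := isMor_comp hΓ hΔ hgm hm
    have hi : T.IsMor Φ (pathOver Φ Ψ f)
        (Fin.append (Fin.append (fun i => .var i) f) (reflAt Ψ f)) :=
      isMor_pathOver'.2 ⟨⟨isMor_id hΦ, hf⟩, by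
        simpa only [Expr.subst_var] using isElemTel_reflAt hΨ hΦ hf⟩
    have hia := isMor_comp hΓ hΦ ha hi
    -- Restricted along `g`, the triple `(k, b, u)` becomes `(a, f(a), 1_{f(a)})`, on which
    -- normality of `j` gives `a`.
    have hq : T.MorEq Γ (pathOver Φ Ψ f) (fun i => (Fin.append (Fin.append k b) u i).subst g)
        (fun i => (Fin.append (Fin.append (fun i => .var i) f) (reflAt Ψ f) i).subst a) := by
      rw [append_subst, append_subst, append_subst, append_subst, morEq_pathOver]
      simp only [Expr.subst_mk_var, reflAt_subst]
      refine ⟨⟨hka, morEq_symm hΓ hΨ hfa hbg hw⟩, ?_⟩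
      simpa only [Expr.subst_subst] using h2
    have h4 := morEq_comp hΓ hM hΦ hmg hia hj hq (morEq_refl hM hj)
    have hji := isMor_comp hΦ hM hi hj
    have h5 := morEq_comp hΓ hΦ hΦ ha ha hji (morEq_refl hΓ ha) hjr
    have h6 : T.MorEq Γ Φ (fun i => (j i).subst fun i => (Fin.append
        (Fin.append (fun i => .var i) f) (reflAt Ψ f) i).subst a) a := by
      simpa only [Expr.subst_subst, Expr.subst_mk_var] using h5
    have := morEq_trans hΓ hΦ (isMor_comp hΓ hM hmg hj)
      (isMor_comp hΓ hM hia hj) h4 h6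
    simpa only [Expr.subst_subst] using this
  · rw [← toHom_comp, toHom_eq_iff]
    change T.MorEq Δ Ψ (fun i => (f i).subst (fun i => (j i).subst _)) b
    have := morEq_comp hΔ hM hΨ hm hm (isMor_comp hM hΦ hj hf) (morEq_refl hΔ hm) hfj
    simpa only [Expr.subst_subst, Expr.subst_mk_var, Fin.append_left, Fin.append_right] using this

end TypeTheory
end DTT

/-! ### The two characterisations -/

theorem mainTheorem2 {S : DTT.Signature.{u}} (T : DTT.TypeTheory S) {n m : ℕ}
    {Φ : T.Context n} {Ψ : T.Context m} (f : DTT.TypeTheory.CtxMor Φ Ψ) :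
    (T.classA f.toHom ↔ DTT.TypeTheory.IsInjectiveEquivalence f) ∧
      (T.classB f.toHom ↔ DTT.TypeTheory.IsNormalIsofibration f) := by
  exact ⟨(DTT.TypeTheory.classA_iff_liftProp f).trans
      (DTT.TypeTheory.liftProp_iff_isInjectiveEquivalence f),
    DTT.TypeTheory.IsNormalIsofibration.of_classB, DTT.TypeTheory.IsNormalIsofibration.classB⟩
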